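/- Let $n\ge 3$, $1<p<\infty$, and let $k\in\mathbb N$ satisfy $k>1+n/p$. Write $r=|x|$, $\langle x\rangle=\sqrt{1+|x|^2}$ and $E_R=\{x\in\mathbb R^n: |x|>R\}$. For an integer $m\ge 0$ and $\delta\in\mathbb R$, let $W^{m,p}_\delta$ be the weighted Sobolev space of functions (or, componentwise, tensors) $u$ on $\mathbb R^n$ whose weak derivatives of order at most $m$ satisfy $$\sum_{|\alpha|\le m}\int_{\mathbb R^n}\langle x\rangle^{-n-p\delta+p|\alpha|}\,|\partial_\alpha u|^p\,dx<\infty ,$$ and let $W^{m,p}_{\delta^+}=\bigcap_{\epsilon>0}W^{m,p}_{\delta+\epsilon}$. Suppose that $g_{ab}$ is a (continuous) Riemannian metric on $\mathbb R^n$ that is asymptotically Euclidean of class $W^{k,p}_{(2-n)^+}$, i.e. $g_{ab}-\delta_{ab}\in W^{k,p}_{(2-n)^+}$, and that for some $R>0$ it admits the decomposition $$g_{ab}=\delta_{ab}+r^{2-n}\beta_{ab}+\gamma_{ab}\quad\text{on }E_R,$$ where $\beta_{ab}\in W^{k,p}_{\mathrm{loc}}(\mathbb R^n\setminus\{0\})$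 is homogeneous of degree zero and $\gamma_{ab}\in W^{k,p}_\eta$ for some $\eta<2-n$. Then there are a function $\zeta\in W^{k-2,p}(S^{n-1})$ and a function $R_{\mathrm{fast}}$ on $\mathbb R^n$ such that the scalar curvature satisfies $$R(g)=\zeta(x/r)\,r^{-n}+R_{\mathrm{fast}}\quad\text{almost everywhere on }E_R,$$ where $$R_{\mathrm{fast}}\in W^{k-2,p}_{\eta-2}\ \cup\ W^{k-2,p}_{(2-2n)^+}.$$ Moreover $\int_{S^{n-1}}\zeta\,dV_{S^{n-1}}=0$, and $\zeta\equiv 0$ if $\beta_{ab}$ is a constant multiple of $\delta_{ab}$. -/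

import Mathlib

open MeasureTheory

noncomputable section

/-- The partial derivative `∂_i f` of a (differentiable) function on `ℝⁿ`. -/
def pderiv {n : ℕ} (i : Fin n) (f : EuclideanSpace ℝ (Fin n) → ℝ) :
    EuclideanSpace ℝ (Fin n) → ℝ :=
  fun x => fderiv ℝ f x (EuclideanSpace.single i 1)

/-- The iterated partial derivative `∂_{i₁} ⋯ ∂_{iₘ} f`, where `L = [i₁, …, iₘ]`. -/
def multiDeriv {n : ℕ} (L : List (Fin n)) (f : EuclideanSpace ℝ (Fin n) → ℝ) :
    EuclideanSpace ℝ (Fin n) → ℝ :=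
  L.foldr pderiv f

/-- `v` is the weak (distributional) derivative `∂_{i₁} ⋯ ∂_{iₘ} u` on the open set `Ω`, where
`L = [i₁, …, iₘ]`: both functions are locally integrable on `Ω` and
`∫ u ∂_L φ = (-1)^m ∫ v φ` for all test functions `φ` on `Ω`. Each multi-index `α` is
represented by the lists `L` that contain `i` exactly `αᵢ` times. -/
def HasWeakDeriv {n : ℕ} (Ω : Set (EuclideanSpace ℝ (Fin n))) (L : List (Fin n))
    (u v : EuclideanSpace ℝ (Fin n) → ℝ) : Prop :=
  LocallyIntegrableOn u Ω ∧ LocallyIntegrableOn v Ω ∧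
    ∀ φ : EuclideanSpace ℝ (Fin n) → ℝ, ContDiff ℝ (⊤ : ℕ∞) φ → HasCompactSupport φ →
      tsupport φ ⊆ Ω →
        ∫ x, u x * multiDeriv L φ x = (-1 : ℝ) ^ L.length * ∫ x, v x * φ x

/-- The local Sobolev space `W^{k,p}_loc(Ω)`: all weak derivatives of order at most `k` exist on
`Ω` and are in `L^p` on the compact subsets of `Ω`. -/
def MemSobolevLoc {n : ℕ} (k : ℕ) (p : ℝ) (Ω : Set (EuclideanSpace ℝ (Fin n)))
    (u : EuclideanSpace ℝ (Fin n) → ℝ) : Prop :=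
  ∀ L : List (Fin n), L.length ≤ k → ∃ v : EuclideanSpace ℝ (Fin n) → ℝ,
    HasWeakDeriv Ω L u v ∧
      ∀ K ⊆ Ω, IsCompact K → MemLp v (ENNReal.ofReal p) (volume.restrict K)

/-- The weighted Sobolev space `W^{k,p}_δ` on `ℝⁿ`: all weak derivatives of order at most `k`
exist and `∫ ⟨x⟩^{-n - pδ + p|α|} |∂_α u|^p dx < ∞` for all `|α| ≤ k`, with
`⟨x⟩ = √(1 + |x|²)`. -/
def MemWeightedSobolev {n : ℕ} (k : ℕ) (p δ : ℝ) (u : EuclideanSpace ℝ (Fin n) → ℝ) : Prop :=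
  ∀ L : List (Fin n), L.length ≤ k → ∃ v : EuclideanSpace ℝ (Fin n) → ℝ,
    HasWeakDeriv Set.univ L u v ∧
      Integrable (fun x => Real.sqrt (1 + ‖x‖ ^ 2) ^ (-(n : ℝ) - p * δ + p * (L.length : ℝ)) *
        |v x| ^ p)

/-- The space `W^{k,p}_{δ⁺}`, the intersection of the spaces `W^{k,p}_{δ+ε}` over `ε > 0`. -/
def MemWeightedSobolevPlus {n : ℕ} (k : ℕ) (p δ : ℝ) (u : EuclideanSpace ℝ (Fin n) → ℝ) : Prop :=
  ∀ ε : ℝ, 0 < ε → MemWeightedSobolev k p (δ + ε) u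

/-- The extension of a function on the unit sphere to `ℝⁿ ∖ {0}` that is homogeneous of degree
zero, `x ↦ ζ (x / |x|)` (with the irrelevant value `0` at the origin). -/
def sphereExt {n : ℕ} (ζ : Metric.sphere (0 : EuclideanSpace ℝ (Fin n)) 1 → ℝ) :
    EuclideanSpace ℝ (Fin n) → ℝ :=
  open Classical in fun x =>
    if h : x = 0 then 0 else ζ ⟨‖x‖⁻¹ • x, by simp [norm_smul, h]⟩

/-- The surface measure on the unit sphere `S^{n-1}` of `ℝⁿ`. -/
def sphereMeasure (n : ℕ) : Measure (Metric.sphere (0 : EuclideanSpace ℝ (Fin n)) 1) :=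
  (volume : Measure (EuclideanSpace ℝ (Fin n))).toSphere

/-- The Sobolev space `W^{m,p}(S^{n-1})`: functions in `L^p(S^{n-1})` whose extension that is
homogeneous of degree zero lies in `W^{m,p}_loc(ℝⁿ ∖ {0})`. -/
def MemSobolevSphere {n : ℕ} (m : ℕ) (p : ℝ)
    (ζ : Metric.sphere (0 : EuclideanSpace ℝ (Fin n)) 1 → ℝ) : Prop :=
  MemLp ζ (ENNReal.ofReal p) (sphereMeasure n) ∧ MemSobolevLoc m p {0}ᶜ (sphereExt ζ)

/-- `g` is an asymptotically Euclidean metric of class `W^{k,p}_{τ⁺}` on `ℝⁿ`: a continuous field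
of symmetric positive definite matrices with `g - δ ∈ W^{k,p}_{τ⁺}`. (It is used for `k > n / p`,
where the elements of `W^{k,p}_loc` have continuous representatives.) -/
def IsAsymptoticallyEuclideanPlus {n : ℕ} (k : ℕ) (p τ : ℝ)
    (g : EuclideanSpace ℝ (Fin n) → Matrix (Fin n) (Fin n) ℝ) : Prop :=
  Continuous g ∧ (∀ x, (g x).PosDef) ∧
    ∀ a b, MemWeightedSobolevPlus k p τ (fun x => g x a b - (1 : Matrix (Fin n) (Fin n) ℝ) a b)

/-- A weak derivative `∂_L u` on `ℝⁿ` (unique up to null sets), and `0` if there is none. -/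
def weakDeriv {n : ℕ} (L : List (Fin n)) (u : EuclideanSpace ℝ (Fin n) → ℝ) :
    EuclideanSpace ℝ (Fin n) → ℝ :=
  open Classical in
    if h : ∃ v : EuclideanSpace ℝ (Fin n) → ℝ, HasWeakDeriv Set.univ L u v then h.choose else 0

/-- The Christoffel symbol `Γ^c_{ab} = ½ g^{cd} (∂_a g_{bd} + ∂_b g_{ad} - ∂_d g_{ab})` as a
function of the metric coefficients `G` and their first derivatives `D c a b = ∂_c g_{ab}`. -/
def christoffel {n : ℕ} (G : Matrix (Fin n) (Fin n) ℝ) (D : Fin n → Matrix (Fin n) (Fin n) ℝ)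
    (c a b : Fin n) : ℝ :=
  1 / 2 * ∑ d, G⁻¹ c d * (D a b d + D b a d - D d a b)

/-- The derivative `∂_e Γ^c_{ab}` as a function of the metric coefficients `G`, their first
derivatives `D` and their second derivatives `H e c a b = ∂_e ∂_c g_{ab}`, from the product rule
and `∂_e g⁻¹ = - g⁻¹ (∂_e g) g⁻¹`. -/
def christoffelDeriv {n : ℕ} (G : Matrix (Fin n) (Fin n) ℝ)
    (D : Fin n → Matrix (Fin n) (Fin n) ℝ) (H : Fin n → Fin n → Matrix (Fin n) (Fin n) ℝ)
    (e c a b : Fin n) : ℝ :=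
  1 / 2 * ∑ d, (-(G⁻¹ * D e * G⁻¹) c d * (D a b d + D b a d - D d a b) +
    G⁻¹ c d * (H e a b d + H e b a d - H e d a b))

/-- The Ricci curvature
`R_{ab} = ∂_c Γ^c_{ab} - ∂_b Γ^c_{ac} + Γ^c_{cd} Γ^d_{ab} - Γ^c_{bd} Γ^d_{ac}`. -/
def ricci {n : ℕ} (G : Matrix (Fin n) (Fin n) ℝ)
    (D : Fin n → Matrix (Fin n) (Fin n) ℝ) (H : Fin n → Fin n → Matrix (Fin n) (Fin n) ℝ)
    (a b : Fin n) : ℝ :=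
  ∑ c, (christoffelDeriv G D H c c a b - christoffelDeriv G D H b c a c) +
    ∑ c, ∑ d, (christoffel G D c c d * christoffel G D d a b -
      christoffel G D c b d * christoffel G D d a c)

/-- The scalar curvature `R(g) = g^{ab} R_{ab}` of a metric `g` on `ℝⁿ` whose coefficients are
twice weakly differentiable, as a function defined almost everywhere. -/
def scalarCurvature {n : ℕ} (g : EuclideanSpace ℝ (Fin n) → Matrix (Fin n) (Fin n) ℝ) :
    EuclideanSpace ℝ (Fin n) → ℝ :=
  fun x => ∑ a, ∑ b, (g x)⁻¹ a b *
    ricci (g x)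
      (fun c => Matrix.of fun i j => weakDeriv [c] (fun y => g y i j) x)
      (fun e c => Matrix.of fun i j => weakDeriv [e, c] (fun y => g y i j) x) a b

end

/-! Write `g = 1 + h`. The scalar curvature equals its linearisation at the flat metric, `∂_c ∂_a
h_{ac} - ∂_c ∂_c h_{aa}`, plus a remainder each of whose terms contains two first derivatives of
`g`, or a factor `g⁻¹ - 1` times a second derivative. If `h` has weight `σ`, the remainder has
weight `2σ - 2`; with `σ` slightly above `2 - n` this is slightly above `2 - 2n`
(`memWeightedSobolev_scalarCurvature_sub`). On `E_R` the linear part splits along the decomposition: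
the identity contributes nothing, `γ` contributes a term of weight `η - 2`, and `r^{2-n} β`
contributes a function homogeneous of degree `-n`, that is `ζ(x/r) r^{-n}`. The fast part is the
remainder plus the linear part of `γ`, and the larger of the two weights decides which alternative
holds.

The mean of `ζ` vanishes by scaling (`integral_mul_annularCutoff`). Let `B` be homogeneous of degree
`2 - n` and let `χ` be a radial cut-off equal to one near the origin. Integrating by parts twice and
rescaling shows that `∂∂B` has the same pairing with `χ(x/2)` as with `χ(x)`, in the sense that `B`
integrates equally against the second derivatives of both. So `∂∂B` integrates to zero against the
radial function `χ(x/2) - χ(x)`, and polar coordinates turn this into a positive multiple of the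
spherical mean. If `β = c δ`, the linear part is `c (1 - n) Δ r^{2-n} = 0`.

The analytic core is a multiplication theorem for weighted Sobolev spaces (`MemSobolevScale.mul`).
With respect to the measure `⟨x⟩^{-n} dx`, membership in the weighted space means that `⟨x⟩^{j-δ}
∂^j u` lies in `L^p`. A potential estimate bounds `u(x)` by averages of `u` and of `⟨x⟩ |∂u|` over
balls of radius comparable to `⟨x⟩`. On such balls the weight is essentially constant, so the usual
Sobolev gain of integrability holds with weights. Only subcritical exponents are used, and strict
inequalities leave room for this. Products are then estimated by Hölder's inequality and the Leibniz
rule, and `g⁻¹` by Cramer's rule together with the reciprocal of the determinant. -/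

section

open Set Filter Topology

open scoped ENNReal Convolution

/-! ### Calculus of weak derivatives on open sets -/

section WeakDerivatives

variable {n : ℕ} {Ω : Set (EuclideanSpace ℝ (Fin n))}

/-- Test functions on `Ω`: smooth functions with compact support contained in `Ω`. -/
structure IsTest (Ω : Set (EuclideanSpace ℝ (Fin n))) (φ : EuclideanSpace ℝ (Fin n) → ℝ) :
    Prop where
  contDiff : ContDiff ℝ (⊤ : ℕ∞) φ
  hasCompactSupport : HasCompactSupport φ
  tsupport_subset : tsupport φ ⊆ Ω

theorem tsupport_pderiv_subset (i : Fin n) (φ : EuclideanSpace ℝ (Fin n) → ℝ) :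
    tsupport (pderiv i φ) ⊆ tsupport φ := by
  refine closure_minimal (fun x hx => ?_) (isClosed_tsupport φ)
  apply support_fderiv_subset ℝ
  intro h
  apply hx
  simp [pderiv, h]

theorem ContDiff.pderiv {i : Fin n} {φ : EuclideanSpace ℝ (Fin n) → ℝ}
    (h : ContDiff ℝ (⊤ : ℕ∞) φ) : ContDiff ℝ (⊤ : ℕ∞) (pderiv i φ) := by
  have h1 : ContDiff ℝ (⊤ : ℕ∞) (fderiv ℝ φ) := h.fderiv_right (by simp)
  exact h1.clm_apply contDiff_const

theorem IsTest.pderiv {φ} (h : IsTest Ω φ) (i : Fin n) : IsTest Ω (pderiv i φ) := by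
  refine ⟨h.contDiff.pderiv, ?_, (tsupport_pderiv_subset i φ).trans h.tsupport_subset⟩
  exact h.hasCompactSupport.of_isClosed_subset (isClosed_tsupport _) (tsupport_pderiv_subset i φ)

theorem IsTest.multiDeriv {φ} (h : IsTest Ω φ) (L : List (Fin n)) : IsTest Ω (multiDeriv L φ) := by
  induction L with
  | nil => exact h
  | cons i L ih => exact ih.pderiv i

theorem locallyIntegrableOn_iff_isCompact (hΩ : IsOpen Ω) {u : EuclideanSpace ℝ (Fin n) → ℝ} :
    LocallyIntegrableOn u Ω ↔ ∀ K ⊆ Ω, IsCompact K → IntegrableOn u K :=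
  locallyIntegrableOn_iff hΩ.isLocallyClosed

/-- The product of a locally integrable function with a compactly supported continuous function
is integrable. -/
theorem MeasureTheory.LocallyIntegrableOn.integrable_mul_of_tsupport
    {u φ : EuclideanSpace ℝ (Fin n) → ℝ} (hu : LocallyIntegrableOn u Ω) (hφ : Continuous φ)
    (hc : HasCompactSupport φ) (hs : tsupport φ ⊆ Ω) : Integrable (fun x => u x * φ x) := by
  have h1 : IntegrableOn u (tsupport φ) := hu.integrableOn_compact_subset hs hc
  have h2 : IntegrableOn (fun x => u x * φ x) (tsupport φ) :=
    h1.mul_continuousOn hφ.continuousOn hc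
  refine (integrableOn_iff_integrable_of_support_subset ?_).1 h2
  intro x hx
  apply subset_tsupport
  intro h
  simp [h] at hx

theorem IsTest.integrable_mul {u φ} (h : IsTest Ω φ) (hu : LocallyIntegrableOn u Ω) :
    Integrable (fun x => u x * φ x) :=
  hu.integrable_mul_of_tsupport h.contDiff.continuous h.hasCompactSupport h.tsupport_subset

theorem hasWeakDeriv_singleton_iff {i : Fin n} {u v : EuclideanSpace ℝ (Fin n) → ℝ} :
    HasWeakDeriv Ω [i] u v ↔ LocallyIntegrableOn u Ω ∧ LocallyIntegrableOn v Ω ∧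
      ∀ φ, IsTest Ω φ → ∫ x, u x * pderiv i φ x = -∫ x, v x * φ x := by
  constructor
  · rintro ⟨h1, h2, h3⟩
    refine ⟨h1, h2, fun φ hφ => ?_⟩
    simpa [multiDeriv] using h3 φ hφ.1 hφ.2 hφ.3
  · rintro ⟨h1, h2, h3⟩
    refine ⟨h1, h2, fun φ a b c => ?_⟩
    simpa [multiDeriv] using h3 φ ⟨a, b, c⟩

theorem HasWeakDeriv.integral_eq {L : List (Fin n)} {u v φ} (h : HasWeakDeriv Ω L u v)
    (hφ : IsTest Ω φ) : ∫ x, u x * multiDeriv L φ x = (-1 : ℝ) ^ L.length * ∫ x, v x * φ x :=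
  h.2.2 φ hφ.1 hφ.2 hφ.3

theorem HasWeakDeriv.integral_pderiv_eq {i : Fin n} {u v φ} (h : HasWeakDeriv Ω [i] u v)
    (hφ : IsTest Ω φ) : ∫ x, u x * pderiv i φ x = -∫ x, v x * φ x :=
  (hasWeakDeriv_singleton_iff.1 h).2.2 φ hφ

/-- Locally integrable functions that agree as distributions on an open set agree a.e. on it. -/
theorem ae_eq_of_forall_isTest (hΩ : IsOpen Ω) {v w : EuclideanSpace ℝ (Fin n) → ℝ}
    (hv : LocallyIntegrableOn v Ω) (hw : LocallyIntegrableOn w Ω)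
    (h : ∀ φ, IsTest Ω φ → ∫ x, v x * φ x = ∫ x, w x * φ x) : v =ᵐ[volume.restrict Ω] w := by
  have := hΩ.ae_eq_zero_of_integral_contDiff_smul_eq_zero (hv.sub hw) (fun φ h1 h2 h3 => by
    have hφ : IsTest Ω φ := ⟨h1, h2, h3⟩
    have e : ∀ x, φ x • (v - w) x = v x * φ x - w x * φ x := fun x => by
      simp only [Pi.sub_apply, smul_eq_mul]; ring
    simp_rw [e]
    rw [integral_sub (hφ.integrable_mul hv) (hφ.integrable_mul hw), h φ hφ, sub_self])
  refine (ae_restrict_iff' hΩ.measurableSet).2 (this.mono fun x hx hxΩ => ?_)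
  exact sub_eq_zero.1 (hx hxΩ)

theorem integral_mul_congr_of_ae {v w φ : EuclideanSpace ℝ (Fin n) → ℝ} (hΩ : MeasurableSet Ω)
    (h : v =ᵐ[volume.restrict Ω] w) (hφ : tsupport φ ⊆ Ω) :
    ∫ x, v x * φ x = ∫ x, w x * φ x := by
  refine integral_congr_ae (((ae_restrict_iff' hΩ).1 h).mono fun x hx => ?_)
  by_cases hxs : φ x = 0
  · simp [hxs]
  · have : x ∈ Ω := hφ (subset_tsupport _ hxs)
    simp [hx this]

/-- Pairings with test functions determine a locally integrable function. This makes the arbitrary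
representative chosen by `weakDeriv` harmless, and later yields homogeneity of derivatives. -/
theorem HasWeakDeriv.ae_unique (hΩ : IsOpen Ω) {L : List (Fin n)} {u u' v w}
    (hu : u =ᵐ[volume.restrict Ω] u')
    (hv : HasWeakDeriv Ω L u v) (hw : HasWeakDeriv Ω L u' w) : v =ᵐ[volume.restrict Ω] w := by
  refine ae_eq_of_forall_isTest hΩ hv.2.1 hw.2.1 fun φ hφ => ?_
  have h1 := hv.integral_eq hφ
  have h2 := hw.integral_eq hφ
  rw [integral_mul_congr_of_ae hΩ.measurableSet hu (hφ.multiDeriv L).tsupport_subset, h2] at h1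
  exact (mul_left_cancel₀ (pow_ne_zero _ (by norm_num)) h1).symm

theorem HasWeakDeriv.congr_ae (hΩ : IsOpen Ω) {L : List (Fin n)} {u u' v v'}
    (h : HasWeakDeriv Ω L u v) (hu : u =ᵐ[volume.restrict Ω] u')
    (hv : v =ᵐ[volume.restrict Ω] v') : HasWeakDeriv Ω L u' v' := by
  refine ⟨h.1.congr hu, h.2.1.congr hv, fun φ h1 h2 h3 => ?_⟩
  have hφ : IsTest Ω φ := ⟨h1, h2, h3⟩
  rw [← integral_mul_congr_of_ae hΩ.measurableSet hu (hφ.multiDeriv L).tsupport_subset,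
    ← integral_mul_congr_of_ae hΩ.measurableSet hv hφ.tsupport_subset]
  exact h.integral_eq hφ

theorem HasWeakDeriv.mono {Ω' : Set (EuclideanSpace ℝ (Fin n))} {L : List (Fin n)} {u v}
    (h : HasWeakDeriv Ω' L u v) (hΩ : Ω ⊆ Ω') : HasWeakDeriv Ω L u v :=
  ⟨h.1.mono_set hΩ, h.2.1.mono_set hΩ, fun φ h1 h2 h3 => h.2.2 φ h1 h2 (h3.trans hΩ)⟩

theorem hasWeakDeriv_nil {u : EuclideanSpace ℝ (Fin n) → ℝ} (h : LocallyIntegrableOn u Ω) :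
    HasWeakDeriv Ω [] u u :=
  ⟨h, h, fun φ _ _ _ => by simp [multiDeriv]⟩

theorem HasWeakDeriv.ae_eq_of_nil (hΩ : IsOpen Ω) {u v} (h : HasWeakDeriv Ω [] u v) :
    u =ᵐ[volume.restrict Ω] v :=
  HasWeakDeriv.ae_unique hΩ (ae_eq_refl _) (hasWeakDeriv_nil h.1) h

/-- The head of the list is the derivative applied to `u` first. Together with
`HasWeakDeriv.of_cons` this allows induction on the order, one derivative at a time. -/
theorem HasWeakDeriv.cons {i : Fin n} {L : List (Fin n)} {u v w}
    (h : HasWeakDeriv Ω [i] u v) (h' : HasWeakDeriv Ω L v w) : HasWeakDeriv Ω (i :: L) u w := by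
  refine ⟨h.1, h'.2.1, fun φ h1 h2 h3 => ?_⟩
  have hφ : IsTest Ω φ := ⟨h1, h2, h3⟩
  have := h.integral_pderiv_eq (hφ.multiDeriv L)
  rw [h'.integral_eq hφ] at this
  change ∫ x, u x * _root_.pderiv i (_root_.multiDeriv L φ) x = _
  rw [this, List.length_cons, pow_succ]
  ring

theorem HasWeakDeriv.of_cons {i : Fin n} {L : List (Fin n)} {u v w}
    (h : HasWeakDeriv Ω [i] u v) (h' : HasWeakDeriv Ω (i :: L) u w) : HasWeakDeriv Ω L v w := by
  refine ⟨h.2.1, h'.2.1, fun φ h1 h2 h3 => ?_⟩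
  have hφ : IsTest Ω φ := ⟨h1, h2, h3⟩
  have e1 := h.integral_pderiv_eq (hφ.multiDeriv L)
  have e2 := h'.integral_eq hφ
  change ∫ x, u x * _root_.pderiv i (_root_.multiDeriv L φ) x = _ at e2
  rw [e2, List.length_cons, pow_succ] at e1
  linarith

theorem HasWeakDeriv.add {L : List (Fin n)} {u v u' v'}
    (h : HasWeakDeriv Ω L u v) (h' : HasWeakDeriv Ω L u' v') :
    HasWeakDeriv Ω L (fun x => u x + u' x) (fun x => v x + v' x) := by
  refine ⟨h.1.add h'.1, h.2.1.add h'.2.1, fun φ h1 h2 h3 => ?_⟩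
  have hφ : IsTest Ω φ := ⟨h1, h2, h3⟩
  simp_rw [add_mul]
  rw [integral_add ((hφ.multiDeriv L).integrable_mul h.1) ((hφ.multiDeriv L).integrable_mul h'.1),
    integral_add (hφ.integrable_mul h.2.1) (hφ.integrable_mul h'.2.1), h.integral_eq hφ,
    h'.integral_eq hφ]
  ring

theorem HasWeakDeriv.const_mul {L : List (Fin n)} {u v} (h : HasWeakDeriv Ω L u v) (c : ℝ) :
    HasWeakDeriv Ω L (fun x => c * u x) (fun x => c * v x) := by
  refine ⟨h.1.smul c, h.2.1.smul c, fun φ h1 h2 h3 => ?_⟩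
  have hφ : IsTest Ω φ := ⟨h1, h2, h3⟩
  simp_rw [mul_assoc]
  rw [integral_const_mul, integral_const_mul, h.integral_eq hφ]
  ring

theorem HasWeakDeriv.sub {L : List (Fin n)} {u v u' v'}
    (h : HasWeakDeriv Ω L u v) (h' : HasWeakDeriv Ω L u' v') :
    HasWeakDeriv Ω L (fun x => u x - u' x) (fun x => v x - v' x) := by
  convert h.add (h'.const_mul (-1)) using 2 <;> ring

theorem hasWeakDeriv_zero {L : List (Fin n)} : HasWeakDeriv Ω L (fun _ => 0) (fun _ => 0) := by
  have h : LocallyIntegrableOn (fun _ : EuclideanSpace ℝ (Fin n) => (0 : ℝ)) Ω :=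
    (locallyIntegrable_const 0).locallyIntegrableOn _
  exact ⟨h, h, fun φ _ _ _ => by simp⟩

theorem continuousOn_pderiv (hΩ : IsOpen Ω) {f : EuclideanSpace ℝ (Fin n) → ℝ}
    (hf : ContDiffOn ℝ 1 f Ω) (i : Fin n) : ContinuousOn (pderiv i f) Ω := by
  have h1 : ContinuousOn (fderiv ℝ f) Ω := hf.continuousOn_fderiv_of_isOpen hΩ le_rfl
  exact h1.clm_apply continuousOn_const

/-- A classical derivative is a weak derivative. -/
theorem hasWeakDeriv_pderiv (hΩ : IsOpen Ω) {f : EuclideanSpace ℝ (Fin n) → ℝ}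
    (hf : ContDiffOn ℝ 1 f Ω) (i : Fin n) : HasWeakDeriv Ω [i] f (pderiv i f) := by
  have h1 : LocallyIntegrableOn f Ω :=
    hf.continuousOn.locallyIntegrableOn hΩ.measurableSet
  have h2 : LocallyIntegrableOn (pderiv i f) Ω :=
    (continuousOn_pderiv hΩ hf i).locallyIntegrableOn hΩ.measurableSet
  refine hasWeakDeriv_singleton_iff.2 ⟨h1, h2, fun φ hφ => ?_⟩
  refine integral_mul_fderiv_eq_neg_fderiv_mul_of_integrable (hφ.integrable_mul h2)
    ((hφ.pderiv i).integrable_mul h1) (hφ.integrable_mul h1) (fun x hx => ?_) fun x _ => ?_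
  · exact (hf.differentiableOn one_ne_zero).differentiableAt
      (hΩ.mem_nhds (hφ.tsupport_subset hx))
  · exact (hφ.contDiff.differentiable (by simp)).differentiableAt

theorem hasWeakDeriv_const (hΩ : IsOpen Ω) (c : ℝ) (i : Fin n) :
    HasWeakDeriv Ω [i] (fun _ => c) (fun _ => 0) := by
  have := hasWeakDeriv_pderiv hΩ (f := fun _ => c) contDiffOn_const i
  have e : pderiv i (fun _ : EuclideanSpace ℝ (Fin n) => c) = fun _ => 0 := by
    ext x; simp [pderiv]
  rwa [e] at this

/-- Smoothness of `f` is needed only on `Ω`, since the product vanishes near every point off the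
support of `φ`. Powers of the norm on the punctured space are thus admissible factors. -/
theorem IsTest.smooth_mul (hΩ : IsOpen Ω) {f φ : EuclideanSpace ℝ (Fin n) → ℝ}
    (hφ : IsTest Ω φ) (hf : ContDiffOn ℝ (⊤ : ℕ∞) f Ω) : IsTest Ω (fun x => f x * φ x) := by
  have hts : tsupport (fun x => f x * φ x) ⊆ tsupport φ := tsupport_mul_subset_right
  refine ⟨contDiff_iff_contDiffAt.2 fun x => ?_, ?_, hts.trans hφ.tsupport_subset⟩
  · by_cases hx : x ∈ tsupport φ
    · exact (hf.contDiffAt (hΩ.mem_nhds (hφ.tsupport_subset hx))).mul hφ.contDiff.contDiffAt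
    · have : (fun x => f x * φ x) =ᶠ[𝓝 x] fun _ => 0 := by
        filter_upwards [notMem_tsupport_iff_eventuallyEq.1 hx] with y hy
        simp [hy]
      exact contDiffAt_const.congr_of_eventuallyEq this
  · exact hφ.hasCompactSupport.of_isClosed_subset (isClosed_tsupport _) hts

theorem MeasureTheory.LocallyIntegrableOn.continuousOn_mul' (hΩ : IsOpen Ω)
    {f u : EuclideanSpace ℝ (Fin n) → ℝ} (hu : LocallyIntegrableOn u Ω) (hf : ContinuousOn f Ω) :
    LocallyIntegrableOn (fun x => f x * u x) Ω :=
  (locallyIntegrableOn_iff_isCompact hΩ).2 fun _ hK hc =>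
    (hu.integrableOn_compact_subset hK hc).continuousOn_mul (hf.mono hK) hc

theorem pderiv_mul {f g : EuclideanSpace ℝ (Fin n) → ℝ} {x : EuclideanSpace ℝ (Fin n)}
    (hf : DifferentiableAt ℝ f x) (hg : DifferentiableAt ℝ g x) (i : Fin n) :
    pderiv i (fun y => f y * g y) x = f x * pderiv i g x + pderiv i f x * g x := by
  unfold pderiv
  rw [fderiv_fun_mul hf hg]
  simp [mul_comm]

/-- Leibniz rule for the product of a smooth and a weakly differentiable function. -/
theorem HasWeakDeriv.smooth_mul (hΩ : IsOpen Ω) {f u v : EuclideanSpace ℝ (Fin n) → ℝ} {i : Fin n}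
    (h : HasWeakDeriv Ω [i] u v) (hf : ContDiffOn ℝ (⊤ : ℕ∞) f Ω) :
    HasWeakDeriv Ω [i] (fun x => f x * u x) (fun x => f x * v x + pderiv i f x * u x) := by
  have hf1 : ContDiffOn ℝ 1 f Ω := hf.of_le (by exact_mod_cast le_top)
  have h1 : LocallyIntegrableOn (fun x => f x * u x) Ω := h.1.continuousOn_mul' hΩ hf.continuousOn
  have h2 : LocallyIntegrableOn (fun x => f x * v x) Ω :=
    h.2.1.continuousOn_mul' hΩ hf.continuousOn
  have h3 : LocallyIntegrableOn (fun x => pderiv i f x * u x) Ω :=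
    h.1.continuousOn_mul' hΩ (continuousOn_pderiv hΩ hf1 i)
  refine hasWeakDeriv_singleton_iff.2 ⟨h1, h2.add h3, fun φ hφ => ?_⟩
  have hfφ := hφ.smooth_mul hΩ hf
  have key := h.integral_pderiv_eq hfφ
  have e : ∀ x, u x * _root_.pderiv i (fun y => f y * φ y) x
      = f x * u x * _root_.pderiv i φ x + _root_.pderiv i f x * u x * φ x := by
    intro x
    by_cases hx : x ∈ tsupport φ
    · rw [pderiv_mul]
      · ring
      · exact (hf1.differentiableOn one_ne_zero).differentiableAt
          (hΩ.mem_nhds (hφ.tsupport_subset hx))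
      · exact (hφ.contDiff.differentiable (by simp)).differentiableAt
    · have hx1 : φ x = 0 := image_eq_zero_of_notMem_tsupport hx
      have hx2 : _root_.pderiv i φ x = 0 :=
        image_eq_zero_of_notMem_tsupport fun hh => hx (tsupport_pderiv_subset i φ hh)
      have hx3 : _root_.pderiv i (fun y => f y * φ y) x = 0 :=
        image_eq_zero_of_notMem_tsupport fun hh => hx
          (tsupport_mul_subset_right (tsupport_pderiv_subset i _ hh))
      simp [hx1, hx2, hx3]
  simp_rw [e] at key
  rw [integral_add ((hφ.pderiv i).integrable_mul h1) (hφ.integrable_mul h3)] at key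
  simp_rw [add_mul]
  rw [integral_add (hφ.integrable_mul h2) (hφ.integrable_mul h3)]
  have e2 : ∫ x, v x * (f x * φ x) = ∫ x, f x * v x * φ x := by
    congr 1; ext x; ring
  rw [e2] at key
  linarith

end WeakDerivatives

/-! ### Mollification: commutation with derivatives and local convergence -/

section Mollification

variable {n : ℕ}

/-- Jensen's inequality for powers with respect to a probability measure. -/
theorem lintegral_rpow_le_lintegral_rpow {α : Type*} [MeasurableSpace α] {P : Measure α}
    [IsProbabilityMeasure P] {f : α → ℝ≥0∞} (hf : AEMeasurable f P) {r : ℝ} (hr : 1 ≤ r) :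
    (∫⁻ a, f a ∂P) ^ r ≤ ∫⁻ a, f a ^ r ∂P := by
  have h := eLpNorm'_le_eLpNorm'_of_exponent_le one_pos hr P hf.aestronglyMeasurable
  simp only [eLpNorm', ENNReal.rpow_one, enorm_eq_self, div_one, one_div] at h
  have hr0 : 0 < r := by linarith
  calc (∫⁻ a, f a ∂P) ^ r ≤ ((∫⁻ a, f a ^ r ∂P) ^ r⁻¹) ^ r := by gcongr
    _ = ∫⁻ a, f a ^ r ∂P := by rw [← ENNReal.rpow_mul, inv_mul_cancel₀ hr0.ne', ENNReal.rpow_one]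

/-- A bump function supported in the ball of radius `1 / (j + 1)`. -/
noncomputable def mollBump (n j : ℕ) : ContDiffBump (0 : EuclideanSpace ℝ (Fin n)) where
  rIn := 1 / (j + 1) / 2
  rOut := 1 / (j + 1)
  rIn_pos := by positivity
  rIn_lt_rOut := by
    have : (0 : ℝ) < 1 / (j + 1) := by positivity
    linarith

/-- The mollification of `f` at scale `1 / (j + 1)`. -/
noncomputable def mollify (j : ℕ) (f : EuclideanSpace ℝ (Fin n) → ℝ) : EuclideanSpace ℝ (Fin n) → ℝ :=
  (mollBump n j).normed volume ⋆[ContinuousLinearMap.lsmul ℝ ℝ, volume] f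

theorem tendsto_mollBump_rOut : Tendsto (fun j => (mollBump n j).rOut) atTop (𝓝 0) :=
  tendsto_one_div_add_atTop_nhds_zero_nat

theorem mollBump_rOut_le (j : ℕ) : (mollBump n j).rOut ≤ 1 := by
  change 1 / ((j : ℝ) + 1) ≤ 1
  rw [div_le_one (by positivity)]
  linarith [(Nat.cast_nonneg j : (0 : ℝ) ≤ j)]

theorem mollify_apply (j : ℕ) (f : EuclideanSpace ℝ (Fin n) → ℝ) (x : EuclideanSpace ℝ (Fin n)) :
    mollify j f x = ∫ t, (mollBump n j).normed volume t * f (x - t) := rfl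

theorem mollify_apply' (j : ℕ) (f : EuclideanSpace ℝ (Fin n) → ℝ) (x : EuclideanSpace ℝ (Fin n)) :
    mollify j f x = ∫ t, (mollBump n j).normed volume (x - t) * f t :=
  convolution_lsmul_swap

theorem contDiff_mollify (j : ℕ) {f : EuclideanSpace ℝ (Fin n) → ℝ} (hf : LocallyIntegrable f) :
    ContDiff ℝ (⊤ : ℕ∞) (mollify j f) :=
  (mollBump n j).hasCompactSupport_normed.contDiff_convolution_left _
    (mollBump n j).contDiff_normed hf

theorem ae_tendsto_mollify {f : EuclideanSpace ℝ (Fin n) → ℝ} (hf : LocallyIntegrable f) :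
    ∀ᵐ x, Tendsto (fun j => mollify j f x) atTop (𝓝 (f x)) := by
  refine ContDiffBump.ae_convolution_tendsto_right_of_locallyIntegrable (K := 2)
    tendsto_mollBump_rOut (Eventually.of_forall fun j => ?_) hf
  change 1 / ((j : ℝ) + 1) ≤ 2 * (1 / (j + 1) / 2)
  linarith

theorem tendsto_mollify_of_continuous {f : EuclideanSpace ℝ (Fin n) → ℝ} (hf : Continuous f)
    (x : EuclideanSpace ℝ (Fin n)) : Tendsto (fun j => mollify j f x) atTop (𝓝 (f x)) :=
  ContDiffBump.convolution_tendsto_right_of_continuous tendsto_mollBump_rOut hf x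

theorem integrable_mollBump_mul (j : ℕ) {f : EuclideanSpace ℝ (Fin n) → ℝ}
    (hf : LocallyIntegrable f) (x : EuclideanSpace ℝ (Fin n)) :
    Integrable (fun t => (mollBump n j).normed volume (x - t) * f t) := by
  have h := (locallyIntegrableOn_univ.2 hf).integrable_mul_of_tsupport
    (φ := fun t => (mollBump n j).normed volume (x - t))
    ((mollBump n j).continuous_normed.comp (by fun_prop))
    ((mollBump n j).hasCompactSupport_normed.comp_homeomorph (Homeomorph.subLeft x))
    (subset_univ _)
  simpa only [mul_comm] using h

theorem isTest_mollBump_sub (j : ℕ) (x : EuclideanSpace ℝ (Fin n)) :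
    IsTest univ (fun t => (mollBump n j).normed volume (x - t)) :=
  ⟨(mollBump n j).contDiff_normed.comp (by fun_prop),
    (mollBump n j).hasCompactSupport_normed.comp_homeomorph (Homeomorph.subLeft x),
    subset_univ _⟩

theorem pderiv_comp_sub_left {f : EuclideanSpace ℝ (Fin n) → ℝ} (hf : Differentiable ℝ f)
    (i : Fin n) (x t : EuclideanSpace ℝ (Fin n)) :
    pderiv i (fun s => f (x - s)) t = -pderiv i f (x - t) := by
  have h1 : HasFDerivAt (fun s : EuclideanSpace ℝ (Fin n) => x - s)
      (-(ContinuousLinearMap.id ℝ (EuclideanSpace ℝ (Fin n)))) t := (hasFDerivAt_id t).const_sub x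
  have h2 := (hf (x - t)).hasFDerivAt.comp t h1
  unfold pderiv
  rw [show (fun s => f (x - s)) = f ∘ fun s => x - s from rfl, h2.fderiv]
  simp

/-- Mollification commutes with weak derivatives. -/
theorem HasWeakDeriv.pderiv_mollify {i : Fin n} {u v} (h : HasWeakDeriv univ [i] u v) (j : ℕ) :
    pderiv i (mollify j u) = mollify j v := by
  have hu : LocallyIntegrable u := locallyIntegrableOn_univ.1 h.1
  ext x
  have h1 := (mollBump n j).hasCompactSupport_normed.hasFDerivAt_convolution_left
    (μ := volume) (ContinuousLinearMap.lsmul ℝ ℝ)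
    ((mollBump n j).contDiff_normed (μ := volume) (n := 1)) hu x
  have h2 : pderiv i (mollify j u) x
      = ∫ t, pderiv i ((mollBump n j).normed volume) (x - t) * u t := by
    unfold pderiv mollify
    rw [h1.fderiv, convolution_eq_swap, ContinuousLinearMap.integral_apply]
    · rfl
    · have hc : HasCompactSupport (fderiv ℝ ((mollBump n j).normed volume)) :=
        (mollBump n j).hasCompactSupport_normed.fderiv ℝ
      have := hc.convolutionExists_left (μ := volume)
        ((ContinuousLinearMap.lsmul ℝ ℝ).precompL (EuclideanSpace ℝ (Fin n)))
        (((mollBump n j).contDiff_normed (μ := volume) (n := 1)).continuous_fderiv one_ne_zero) hu x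
      exact this.integrable_swap
  rw [h2, mollify_apply']
  -- Test against the reflected bump `t ↦ ρ(x - t)`; the sign of the reflection cancels the sign of
  -- the integration by parts.
  have h3 := h.integral_pderiv_eq (isTest_mollBump_sub j x)
  simp_rw [pderiv_comp_sub_left (((mollBump n j).contDiff_normed (μ := volume)
    (n := 1)).differentiable one_ne_zero), mul_neg] at h3
  rw [integral_neg, neg_inj] at h3
  simp_rw [mul_comm] at h3 ⊢
  exact h3

theorem mollify_sub (j : ℕ) {f g : EuclideanSpace ℝ (Fin n) → ℝ} (hf : LocallyIntegrable f)
    (hg : LocallyIntegrable g) (x : EuclideanSpace ℝ (Fin n)) :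
    mollify j (f - g) x = mollify j f x - mollify j g x := by
  simp_rw [mollify_apply', Pi.sub_apply, mul_sub]
  exact integral_sub (integrable_mollBump_mul j hf x) (integrable_mollBump_mul j hg x)

/-- A mollification is an average over a ball of radius at most one. The resulting lower bound does
not depend on `j`, as the reciprocal rule requires. -/
theorem le_mollify (j : ℕ) {f : EuclideanSpace ℝ (Fin n) → ℝ} (hf : LocallyIntegrable f) {c : ℝ}
    {x : EuclideanSpace ℝ (Fin n)} (hc : ∀ y ∈ Metric.ball x 1, c ≤ f y) : c ≤ mollify j f x := by
  rw [mollify_apply']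
  have h1 : ∫ t, (mollBump n j).normed volume (x - t) * c = c := by
    rw [integral_mul_const,
      integral_sub_left_eq_self (fun t => (mollBump n j).normed volume t) volume x,
      ContDiffBump.integral_normed, one_mul]
  rw [← h1]
  refine integral_mono (integrable_mollBump_mul j (locallyIntegrable_const c) x)
    (integrable_mollBump_mul j hf x) fun t => ?_
  by_cases ht : t ∈ Metric.ball x 1
  · exact mul_le_mul_of_nonneg_left (hc t ht) ((mollBump n j).nonneg_normed _)
  · have : (mollBump n j).normed volume (x - t) = 0 := by
      by_contra h0
      have h1 : x - t ∈ Function.support ((mollBump n j).normed volume) := h0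
      rw [ContDiffBump.support_normed_eq] at h1
      apply ht
      rw [Metric.mem_ball, dist_comm, dist_eq_norm]
      rw [Metric.mem_ball, dist_zero_right] at h1
      exact h1.trans_le (mollBump_rOut_le j)
    simp [this]

theorem mollify_congr_of_eqOn_ball (j : ℕ) {f g : EuclideanSpace ℝ (Fin n) → ℝ}
    {x : EuclideanSpace ℝ (Fin n)} (h : ∀ y ∈ Metric.ball x 1, f y = g y) :
    mollify j f x = mollify j g x := by
  rw [mollify_apply', mollify_apply']
  congr 1
  ext t
  by_cases ht : t ∈ Metric.ball x 1
  · rw [h t ht]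
  · have : (mollBump n j).normed volume (x - t) = 0 := by
      by_contra h0
      have h1 : x - t ∈ Function.support ((mollBump n j).normed volume) := h0
      rw [ContDiffBump.support_normed_eq] at h1
      apply ht
      rw [Metric.mem_ball, dist_comm, dist_eq_norm]
      rw [Metric.mem_ball, dist_zero_right] at h1
      exact h1.trans_le (mollBump_rOut_le j)
    simp [this]

/-- Young's inequality for mollifications. -/
theorem eLpNorm_mollify_le (j : ℕ) {f : EuclideanSpace ℝ (Fin n) → ℝ} {r : ℝ} (hr : 1 ≤ r)
    (hf : AEStronglyMeasurable f) :
    eLpNorm (mollify j f) (ENNReal.ofReal r) volume ≤ eLpNorm f (ENNReal.ofReal r) volume := by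
  have hr0 : 0 < r := by linarith
  set ρ := (mollBump n j).normed volume with hρ
  have hρm : Measurable fun t => ENNReal.ofReal (ρ t) :=
    (mollBump n j).continuous_normed.measurable.ennreal_ofReal
  -- Convolution with the bump is an expectation under the probability measure with density `ρ`, so
  -- Jensen, Tonelli and translation invariance suffice.
  have hprob : IsProbabilityMeasure (volume.withDensity fun t => ENNReal.ofReal (ρ t)) := by
    constructor
    rw [withDensity_apply _ MeasurableSet.univ, Measure.restrict_univ,
      ← ofReal_integral_eq_lintegral_ofReal (mollBump n j).integrable_normed
        (Eventually.of_forall fun t => (mollBump n j).nonneg_normed t),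
      ContDiffBump.integral_normed, ENNReal.ofReal_one]
  set P := volume.withDensity fun t => ENNReal.ofReal (ρ t) with hP
  have hac : P ≪ volume := withDensity_absolutelyContinuous _ _
  have h1 : eLpNorm f (ENNReal.ofReal r) volume = (∫⁻ x, ‖f x‖ₑ ^ r) ^ (1 / r) := by
    rw [eLpNorm_eq_lintegral_rpow_enorm_toReal (by simpa using hr0) ENNReal.ofReal_ne_top,
      ENNReal.toReal_ofReal hr0.le]
  have h2 : eLpNorm (mollify j f) (ENNReal.ofReal r) volume
      = (∫⁻ x, ‖mollify j f x‖ₑ ^ r) ^ (1 / r) := by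
    rw [eLpNorm_eq_lintegral_rpow_enorm_toReal (by simpa using hr0) ENNReal.ofReal_ne_top,
      ENNReal.toReal_ofReal hr0.le]
  rw [h1, h2]
  gcongr 1
  have hsub : Measurable fun z : EuclideanSpace ℝ (Fin n) × EuclideanSpace ℝ (Fin n) =>
    z.1 - z.2 := by fun_prop
  have hqmp : Measure.QuasiMeasurePreserving
      (fun z : EuclideanSpace ℝ (Fin n) × EuclideanSpace ℝ (Fin n) => z.1 - z.2)
      (volume.prod P) volume :=
    (quasiMeasurePreserving_sub volume volume).mono_left
      (Measure.AbsolutelyContinuous.prod (Measure.AbsolutelyContinuous.refl _) hac)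
  have hfm : AEMeasurable
      (fun z : EuclideanSpace ℝ (Fin n) × EuclideanSpace ℝ (Fin n) => ‖f (z.1 - z.2)‖ₑ)
      (volume.prod P) := (hf.comp_quasiMeasurePreserving hqmp).enorm
  have hfx : ∀ x, AEMeasurable (fun t => ‖f (x - t)‖ₑ) volume := fun x =>
    (hf.comp_quasiMeasurePreserving
      (quasiMeasurePreserving_sub_left volume x)).enorm
  calc ∫⁻ x, ‖mollify j f x‖ₑ ^ r
      ≤ ∫⁻ x, (∫⁻ t, ‖f (x - t)‖ₑ ∂P) ^ r := by
        refine lintegral_mono fun x => ?_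
        dsimp only
        gcongr
        rw [mollify_apply]
        refine (enorm_integral_le_lintegral_enorm _).trans_eq ?_
        rw [hP, lintegral_withDensity_eq_lintegral_mul₀ hρm.aemeasurable (hfx x)]
        refine lintegral_congr fun t => ?_
        rw [enorm_mul, Pi.mul_apply, Real.enorm_eq_ofReal ((mollBump n j).nonneg_normed t)]
    _ ≤ ∫⁻ x, ∫⁻ t, ‖f (x - t)‖ₑ ^ r ∂P :=
        lintegral_mono fun x => lintegral_rpow_le_lintegral_rpow ((hfx x).mono_ac hac) hr
    _ = ∫⁻ t, ∫⁻ x, ‖f (x - t)‖ₑ ^ r ∂volume ∂P := by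
        exact lintegral_lintegral_swap (f := fun x t => ‖f (x - t)‖ₑ ^ r) (hfm.pow_const r)
    _ = ∫⁻ x, ‖f x‖ₑ ^ r := by
        have h3 : ∀ t, ∫⁻ x, ‖f (x - t)‖ₑ ^ r = ∫⁻ x, ‖f x‖ₑ ^ r := fun t =>
          lintegral_sub_right_eq_self (μ := volume) (fun x => ‖f x‖ₑ ^ r) t
        simp_rw [h3]
        rw [lintegral_const, measure_univ, mul_one]

/-- Local `L^r` convergence of mollifications. -/
theorem tendsto_eLpNorm_mollify_sub {f : EuclideanSpace ℝ (Fin n) → ℝ} {r : ℝ} (hr : 1 ≤ r)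
    (hf : ∀ K, IsCompact K → MemLp f (ENNReal.ofReal r) (volume.restrict K))
    {K : Set (EuclideanSpace ℝ (Fin n))} (hK : IsCompact K) :
    Tendsto (fun j => eLpNorm (fun x => mollify j f x - f x) (ENNReal.ofReal r)
      (volume.restrict K)) atTop (𝓝 0) := by
  have hr1 : (1 : ℝ≥0∞) ≤ ENNReal.ofReal r := by simpa using ENNReal.ofReal_le_ofReal hr
  -- All bumps have radius at most one, so on `K` the mollifications see `f` only on this
  -- thickening, and `f` may be truncated to it.
  set K' := Metric.cthickening 1 K with hK'
  have hK'c : IsCompact K' := hK.cthickening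
  have hK'm : MeasurableSet K' := hK'c.measurableSet
  set F := K'.indicator f with hF
  have hFm : MemLp F (ENNReal.ofReal r) volume := (memLp_indicator_iff_restrict hK'm).2 (hf K' hK'c)
  have hFl : LocallyIntegrable F := hFm.locallyIntegrable hr1
  rw [ENNReal.tendsto_nhds_zero]
  intro ε hε
  have hε3 : ε / 3 ≠ 0 := by
    simpa using hε.ne'
  obtain ⟨g, hgc, hgF, hg, hgm⟩ := hFm.exists_hasCompactSupport_eLpNorm_sub_le
    ENNReal.ofReal_ne_top hε3
  have hgl : LocallyIntegrable g := hg.locallyIntegrable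
  have huc : UniformContinuous g := hg.uniformContinuous_of_tendsto_cocompact
    (hgc.is_zero_at_infty)
  -- uniform approximation on `K`
  have hvol : volume K ≠ ∞ := hK.measure_lt_top.ne
  obtain ⟨δ, hδ, hδε⟩ : ∃ δ : ℝ, 0 < δ ∧
      (volume.restrict K) univ ^ (ENNReal.ofReal r).toReal⁻¹ * ENNReal.ofReal δ ≤ ε / 3 := by
    have hC : (volume.restrict K) univ ^ (ENNReal.ofReal r).toReal⁻¹ ≠ ∞ := by
      rw [Measure.restrict_apply_univ]
      exact ENNReal.rpow_ne_top_of_nonneg (by positivity) hvol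
    have ht : Tendsto (fun δ : ℝ => (volume.restrict K) univ ^ (ENNReal.ofReal r).toReal⁻¹ *
        ENNReal.ofReal δ) (𝓝[>] 0) (𝓝 0) := by
      have h1 : Tendsto (fun δ : ℝ => ENNReal.ofReal δ) (𝓝[>] 0) (𝓝 0) := by
        have := (ENNReal.continuous_ofReal.tendsto 0).mono_left
          (nhdsWithin_le_nhds (s := Ioi (0 : ℝ)))
        simpa using this
      simpa using ENNReal.Tendsto.const_mul h1 (Or.inr hC)
    have h2 := (ENNReal.tendsto_nhds_zero.1 ht (ε / 3) (pos_iff_ne_zero.2 hε3)).and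
      self_mem_nhdsWithin
    obtain ⟨δ, h3, h4⟩ := h2.exists
    exact ⟨δ, h4, h3⟩
  obtain ⟨η, hη, hηg⟩ := Metric.uniformContinuous_iff.1 huc δ hδ
  have hev := (tendsto_mollBump_rOut (n := n)).eventually (gt_mem_nhds hη)
  filter_upwards [hev] with j hj
  have hunif : ∀ x, ‖mollify j g x - g x‖ ≤ δ := fun x => by
    rw [← dist_eq_norm]
    refine ContDiffBump.dist_normed_convolution_le hg.aestronglyMeasurable fun y hy => ?_
    exact (hηg ((Metric.mem_ball.1 hy).trans hj)).le
  have hmeas : ∀ {h : EuclideanSpace ℝ (Fin n) → ℝ}, LocallyIntegrable h →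
      AEStronglyMeasurable (mollify j h) volume := fun hh =>
    (contDiff_mollify j hh).continuous.aestronglyMeasurable
  have hsplit : EqOn (fun x => mollify j f x - f x)
      ((mollify j (F - g) + fun x => mollify j g x - g x) + (g - F)) K := fun x hx => by
    have hxK : x ∈ K' := Metric.self_subset_cthickening K hx
    have e1 : mollify j f x = mollify j F x := mollify_congr_of_eqOn_ball j fun y hy => by
      have : y ∈ K' := Metric.mem_cthickening_of_dist_le y x 1 K hx (Metric.mem_ball.1 hy).le
      simp [hF, this]
    simp only [Pi.add_apply, Pi.sub_apply]
    rw [mollify_sub j hFl hgl, e1, show F x = f x from indicator_of_mem hxK f]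
    ring
  have hμ : volume.restrict K ≤ (volume : Measure (EuclideanSpace ℝ (Fin n))) :=
    Measure.restrict_le_self
  have hm1 : AEStronglyMeasurable (mollify j (F - g)) (volume.restrict K) :=
    (hmeas (hFl.sub hgl)).mono_measure hμ
  have hm2 : AEStronglyMeasurable (fun x => mollify j g x - g x) (volume.restrict K) :=
    ((hmeas hgl).sub hg.aestronglyMeasurable).mono_measure hμ
  have hm3 : AEStronglyMeasurable (g - F) (volume.restrict K) :=
    (hgm.1.sub hFm.1).mono_measure hμ
  calc eLpNorm (fun x => mollify j f x - f x) (ENNReal.ofReal r) (volume.restrict K)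
      = eLpNorm ((mollify j (F - g) + fun x => mollify j g x - g x) + (g - F))
          (ENNReal.ofReal r) (volume.restrict K) :=
        eLpNorm_congr_ae ((ae_restrict_iff' hK.measurableSet).2
          (Eventually.of_forall fun x hx => hsplit hx))
    _ ≤ eLpNorm (mollify j (F - g)) (ENNReal.ofReal r) (volume.restrict K) +
          eLpNorm (fun x => mollify j g x - g x) (ENNReal.ofReal r) (volume.restrict K) +
          eLpNorm (g - F) (ENNReal.ofReal r) (volume.restrict K) :=
        (eLpNorm_add_le (hm1.add hm2) hm3 hr1).trans
          (add_le_add_left (eLpNorm_add_le hm1 hm2 hr1) _)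
    _ ≤ ε / 3 + ε / 3 + ε / 3 := by
        refine add_le_add (add_le_add ?_ ?_) ?_
        · exact (eLpNorm_mono_measure _ hμ).trans
            ((eLpNorm_mollify_le j hr (hFm.1.sub hgm.1)).trans hgF)
        · exact (eLpNorm_le_of_ae_bound (Eventually.of_forall hunif)).trans hδε
        · rw [eLpNorm_sub_comm]
          exact (eLpNorm_mono_measure _ hμ).trans hgF
    _ = ε := ENNReal.add_thirds ε

end Mollification

/-! ### Product and reciprocal rules for weak derivatives -/

section ProductRule

variable {n : ℕ}

theorem tendsto_integral_mul_test {K : Set (EuclideanSpace ℝ (Fin n))} (hK : IsCompact K)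
    {q q' : ℝ≥0∞} [hq : ENNReal.HolderConjugate q q'] {F : ℕ → EuclideanSpace ℝ (Fin n) → ℝ}
    {F₀ G φ : EuclideanSpace ℝ (Fin n) → ℝ}
    (hF : ∀ j, AEStronglyMeasurable (F j) (volume.restrict K))
    (hF₀ : MemLp F₀ q (volume.restrict K))
    (hlim : Tendsto (fun j => eLpNorm (fun x => F j x - F₀ x) q (volume.restrict K)) atTop (𝓝 0))
    (hG : MemLp G q' (volume.restrict K)) (hφ : Continuous φ) (hφK : tsupport φ ⊆ K) :
    Tendsto (fun j => ∫ x, F j x * G x * φ x) atTop (𝓝 (∫ x, F₀ x * G x * φ x)) := by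
  have hred : ∀ H : EuclideanSpace ℝ (Fin n) → ℝ,
      ∫ x, H x * G x * φ x = ∫ x in K, H x * (G x * φ x) := fun H => by
    rw [setIntegral_eq_integral_of_forall_compl_eq_zero fun x hx => ?_]
    · simp_rw [mul_assoc]
    · rw [image_eq_zero_of_notMem_tsupport fun h => hx (hφK h)]; simp
  simp_rw [hred]
  obtain ⟨C, hC⟩ := hK.exists_bound_of_continuousOn hφ.continuousOn
  have hφtop : MemLp φ ⊤ (volume.restrict K) :=
    memLp_top_of_bound hφ.aestronglyMeasurable C
      ((ae_restrict_iff' hK.measurableSet).2 (Eventually.of_forall hC))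
  have hGφ : MemLp (fun x => G x * φ x) q' (volume.restrict K) := hφtop.mul hG
  have hint : ∀ {H : EuclideanSpace ℝ (Fin n) → ℝ}, MemLp H q (volume.restrict K) →
      Integrable (fun x => H x * (G x * φ x)) (volume.restrict K) := fun hH =>
    memLp_one_iff_integrable.1 (hGφ.mul hH)
  have hbound : ∀ j, eLpNorm (fun x => F j x * (G x * φ x) - F₀ x * (G x * φ x)) 1
      (volume.restrict K) ≤ eLpNorm (fun x => F j x - F₀ x) q (volume.restrict K) *
        eLpNorm (fun x => G x * φ x) q' (volume.restrict K) := fun j => by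
    have := eLpNorm_smul_le_mul_eLpNorm (p := q) (q := q') (r := 1) hGφ.1 ((hF j).sub hF₀.1)
    refine le_trans (le_of_eq ?_) this
    congr 1
    ext x
    simp [sub_mul]
  -- The `F j` are not assumed to be in `L^q`; they are once their distance to `F₀` drops below one.
  have hmem : ∀ᶠ j in atTop, MemLp (F j) q (volume.restrict K) := by
    filter_upwards [hlim.eventually (gt_mem_nhds one_pos)] with j hj
    have h1 : MemLp (fun x => F j x - F₀ x) q (volume.restrict K) :=
      ⟨(hF j).sub hF₀.1, hj.trans ENNReal.one_lt_top⟩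
    convert h1.add hF₀ using 1
    ext x
    simp
  refine tendsto_integral_of_L1' _ (hint hF₀).1 (hmem.mono fun j hj => hint hj) ?_
  refine tendsto_of_tendsto_of_tendsto_of_le_of_le tendsto_const_nhds ?_ (fun _ => zero_le) hbound
  simpa using ENNReal.Tendsto.mul_const hlim (Or.inr hGφ.2.ne)

/-- `u` and `v` lie locally in Lebesgue spaces with Hölder conjugate exponents, the one of `v`
being finite. -/
def LocHolder (u v : EuclideanSpace ℝ (Fin n) → ℝ) : Prop :=
  ∃ (a : ℝ) (a' : ℝ≥0∞), 1 ≤ a ∧ ENNReal.HolderConjugate (ENNReal.ofReal a) a' ∧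
    (∀ K, IsCompact K → MemLp v (ENNReal.ofReal a) (volume.restrict K)) ∧
    ∀ K, IsCompact K → MemLp u a' (volume.restrict K)

theorem LocHolder.locallyIntegrable {u v : EuclideanSpace ℝ (Fin n) → ℝ} (h : LocHolder u v) :
    LocallyIntegrable (fun x => v x * u x) := by
  obtain ⟨a, a', _, _, h1, h2⟩ := h
  exact locallyIntegrableOn_univ.1 <| (locallyIntegrableOn_iff_isCompact isOpen_univ).2
    fun K _ hK => memLp_one_iff_integrable.1 ((h2 K hK).mul' (h1 K hK))

theorem LocHolder.tendsto_integral {u v φ : EuclideanSpace ℝ (Fin n) → ℝ} (h : LocHolder u v)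
    (hv : LocallyIntegrable v) (hφ : IsTest univ φ) :
    Tendsto (fun j => ∫ x, mollify j v x * u x * φ x) atTop (𝓝 (∫ x, v x * u x * φ x)) := by
  obtain ⟨a, a', ha, _, h1, h2⟩ := h
  exact tendsto_integral_mul_test (q := ENNReal.ofReal a) (q' := a') hφ.hasCompactSupport
    (fun j => (contDiff_mollify j hv).continuous.aestronglyMeasurable)
    (h1 _ hφ.hasCompactSupport) (tendsto_eLpNorm_mollify_sub ha h1 hφ.hasCompactSupport)
    (h2 _ hφ.hasCompactSupport) hφ.contDiff.continuous subset_rfl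

/-- The product rule for weak derivatives, under Hölder conjugate local integrability. -/
theorem HasWeakDeriv.mul {i : Fin n} {u u' v v' : EuclideanSpace ℝ (Fin n) → ℝ}
    (hu : HasWeakDeriv univ [i] u u') (hv : HasWeakDeriv univ [i] v v')
    (h : LocHolder u v) (h1 : LocHolder u' v) (h2 : LocHolder u v') :
    HasWeakDeriv univ [i] (fun x => v x * u x) (fun x => v x * u' x + v' x * u x) := by
  have hvl : LocallyIntegrable v := locallyIntegrableOn_univ.1 hv.1
  have hvl' : LocallyIntegrable v' := locallyIntegrableOn_univ.1 hv.2.1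
  have hl1 := locallyIntegrableOn_univ.2 h1.locallyIntegrable
  have hl2 := locallyIntegrableOn_univ.2 h2.locallyIntegrable
  refine hasWeakDeriv_singleton_iff.2
    ⟨locallyIntegrableOn_univ.2 h.locallyIntegrable, hl1.add hl2, fun φ hφ => ?_⟩
  -- With `v` mollified, the Leibniz rule for a smooth factor applies, and each of the three
  -- integrals passes to the limit. Mollifications converge in `L^a` only for finite `a`, which is
  -- why the finite exponent is placed on `v`.
  have e : ∀ j, ∫ x, mollify j v x * u x * pderiv i φ x
      = -((∫ x, mollify j v x * u' x * φ x) + ∫ x, mollify j v' x * u x * φ x) := fun j => by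
    have hc : ∀ {w : EuclideanSpace ℝ (Fin n) → ℝ}, LocallyIntegrable w →
        ContDiffOn ℝ (⊤ : ℕ∞) (mollify j w) univ := fun hw => (contDiff_mollify j hw).contDiffOn
    rw [(hu.smooth_mul isOpen_univ (hc hvl)).integral_pderiv_eq hφ, hv.pderiv_mollify]
    simp_rw [add_mul]
    rw [integral_add (hφ.integrable_mul (hu.2.1.continuousOn_mul' isOpen_univ
      (hc hvl).continuousOn)) (hφ.integrable_mul (hu.1.continuousOn_mul' isOpen_univ
      (hc hvl').continuousOn))]
  have t1 := h.tendsto_integral hvl (hφ.pderiv i)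
  simp_rw [e] at t1
  have t2 := ((h1.tendsto_integral hvl hφ).add (h2.tendsto_integral hvl' hφ)).neg
  rw [tendsto_nhds_unique t1 t2]
  simp_rw [add_mul]
  rw [integral_add (hφ.integrable_mul hl1) (hφ.integrable_mul hl2)]

/-- Weak derivative of the reciprocal of a positive continuous function. -/
theorem HasWeakDeriv.inv {i : Fin n} {f f' : EuclideanSpace ℝ (Fin n) → ℝ}
    (hf : HasWeakDeriv univ [i] f f') (hc : Continuous f) (hpos : ∀ x, 0 < f x) :
    HasWeakDeriv univ [i] (fun x => (f x)⁻¹) (fun x => -((f x)⁻¹ ^ 2) * f' x) := by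
  have hl : LocallyIntegrable f := hc.locallyIntegrable
  have hl' : LocallyIntegrable f' := locallyIntegrableOn_univ.1 hf.2.1
  have hinv : Continuous fun x => (f x)⁻¹ := hc.inv₀ fun x => (hpos x).ne'
  -- Positivity of `f` on the thickened compact set bounds all mollifications below at once, so
  -- their reciprocals are smooth and uniformly bounded on `K`.
  have hmin : ∀ K : Set (EuclideanSpace ℝ (Fin n)), IsCompact K →
      ∃ c > 0, ∀ j, ∀ x ∈ K, c ≤ mollify j f x := fun K hK => by
    have hK' : IsCompact (Metric.cthickening 1 K) := hK.cthickening
    obtain ⟨c, hc0, hcK⟩ := hK'.exists_forall_le' (a := 0) hc.continuousOn fun x _ => hpos x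
    refine ⟨c, hc0, fun j x hx => le_mollify j hl fun y hy => hcK y ?_⟩
    exact Metric.mem_cthickening_of_dist_le y x 1 K hx (Metric.mem_ball.1 hy).le
  have hmpos : ∀ j x, 0 < mollify j f x := fun j x => by
    obtain ⟨c, hc0, h⟩ := hmin {x} isCompact_singleton
    exact hc0.trans_le (h j x rfl)
  refine hasWeakDeriv_singleton_iff.2 ⟨hinv.locallyIntegrable.locallyIntegrableOn _,
    hf.2.1.continuousOn_mul' isOpen_univ (hinv.pow 2).neg.continuousOn, fun φ hφ => ?_⟩
  set K := tsupport φ with hK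
  have hKc : IsCompact K := hφ.hasCompactSupport
  obtain ⟨c, hc0, hcK⟩ := hmin K hKc
  have hsm : ∀ j, ContDiff ℝ (⊤ : ℕ∞) fun x => (mollify j f x)⁻¹ := fun j =>
    (contDiff_mollify j hl).inv fun x => (hmpos j x).ne'
  have e : ∀ j, ∫ x, (mollify j f x)⁻¹ * pderiv i φ x
      = ∫ x, mollify j f' x * (mollify j f x)⁻¹ ^ 2 * φ x := fun j => by
    have h1 := (hasWeakDeriv_pderiv isOpen_univ ((hsm j).contDiffOn.of_le
      (by exact_mod_cast le_top)) i).integral_pderiv_eq hφ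
    rw [h1, ← integral_neg]
    congr 1
    ext x
    have h2 : pderiv i (fun y => (mollify j f y)⁻¹) x
        = -((mollify j f x)⁻¹ ^ 2) * mollify j f' x := by
      rw [← hf.pderiv_mollify j]
      have hd : HasFDerivAt (mollify j f) (fderiv ℝ (mollify j f) x) x :=
        ((contDiff_mollify j hl).differentiable (by simp)).differentiableAt.hasFDerivAt
      have hd' : HasFDerivAt (fun y => (mollify j f y)⁻¹) _ x :=
        (hasDerivAt_inv (hmpos j x).ne').comp_hasFDerivAt x hd
      unfold pderiv
      rw [hd'.fderiv]
      simp
    rw [h2]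
    ring
  have hbd : ∀ j, ∀ x ∈ K, |(mollify j f x)⁻¹| ≤ c⁻¹ := fun j x hx => by
    rw [abs_of_pos (inv_pos.2 (hmpos j x))]
    exact inv_anti₀ hc0 (hcK j x hx)
  have t1 : Tendsto (fun j => ∫ x, (mollify j f x)⁻¹ * pderiv i φ x) atTop
      (𝓝 (∫ x, (f x)⁻¹ * pderiv i φ x)) := by
    refine tendsto_integral_of_dominated_convergence (fun x => c⁻¹ * |pderiv i φ x|)
      (fun j => ((hsm j).continuous.mul (hφ.pderiv i).contDiff.continuous).aestronglyMeasurable)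
      ?_ (fun j => Eventually.of_forall fun x => ?_) (Eventually.of_forall fun x => ?_)
    · exact (((hφ.pderiv i).contDiff.continuous.integrable_of_hasCompactSupport
        (hφ.pderiv i).hasCompactSupport).abs).const_mul _
    · rw [Real.norm_eq_abs, abs_mul]
      by_cases hx : x ∈ K
      · gcongr; exact hbd j x hx
      · rw [image_eq_zero_of_notMem_tsupport fun h => hx (tsupport_pderiv_subset i φ h)]; simp
    · exact ((tendsto_mollify_of_continuous hc x).inv₀ (hpos x).ne').mul_const _
  have t2 : Tendsto (fun j => ∫ x, f' x * ((mollify j f x)⁻¹ ^ 2 * φ x)) atTop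
      (𝓝 (∫ x, f' x * ((f x)⁻¹ ^ 2 * φ x))) := by
    refine tendsto_integral_of_dominated_convergence (fun x => c⁻¹ ^ 2 * |f' x * φ x|)
      (fun j => ?_) ?_ (fun j => Eventually.of_forall fun x => ?_) (Eventually.of_forall fun x => ?_)
    · exact hl'.aestronglyMeasurable.mul
        (((hsm j).continuous.pow 2).mul hφ.contDiff.continuous).aestronglyMeasurable
    · exact (hφ.integrable_mul hf.2.1).abs.const_mul _
    · rw [Real.norm_eq_abs, abs_mul, abs_mul, abs_pow, abs_mul]
      by_cases hx : x ∈ K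
      · calc |f' x| * (|(mollify j f x)⁻¹| ^ 2 * |φ x|)
            ≤ |f' x| * (c⁻¹ ^ 2 * |φ x|) := by gcongr; exact hbd j x hx
          _ = _ := by ring
      · rw [image_eq_zero_of_notMem_tsupport hx]; simp
    · exact (((((tendsto_mollify_of_continuous hc x).inv₀ (hpos x).ne').pow 2).mul_const _).const_mul
        _)
  -- Since `f'` is only locally integrable, there is no domination for its mollifications. Their
  -- error is instead controlled in `L¹` against a bounded multiplier.
  have t3 : Tendsto (fun j => ∫ x, (mollify j f' x - f' x) * ((mollify j f x)⁻¹ ^ 2 * φ x)) atTop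
      (𝓝 0) := by
    obtain ⟨M, hM⟩ := hφ.contDiff.continuous.bounded_above_of_compact_support hφ.hasCompactSupport
    have hM0 : 0 ≤ M := (norm_nonneg _).trans (hM 0)
    have h1loc : ∀ K, IsCompact K → MemLp f' (ENNReal.ofReal 1) (volume.restrict K) :=
      fun K hK => by
        rw [ENNReal.ofReal_one, memLp_one_iff_integrable]
        exact hl'.integrableOn_isCompact hK
    have hL := tendsto_eLpNorm_mollify_sub le_rfl h1loc hKc
    have hL' := ENNReal.Tendsto.const_mul (a := ENNReal.ofReal (c⁻¹ ^ 2 * M)) hL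
      (Or.inr ENNReal.ofReal_ne_top)
    rw [mul_zero] at hL'
    rw [tendsto_zero_iff_enorm_tendsto_zero]
    refine tendsto_of_tendsto_of_tendsto_of_le_of_le tendsto_const_nhds hL' (fun _ => zero_le)
      fun j => ?_
    dsimp only
    rw [ENNReal.ofReal_one, eLpNorm_one_eq_lintegral_enorm,
      ← lintegral_const_mul' _ _ ENNReal.ofReal_ne_top]
    rw [← setIntegral_eq_integral_of_forall_compl_eq_zero (s := K) fun x hx => by
      rw [image_eq_zero_of_notMem_tsupport hx]; simp]
    refine (enorm_integral_le_lintegral_enorm _).trans (setLIntegral_mono' hKc.measurableSet ?_)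
    intro x hx
    rw [enorm_mul, mul_comm]
    gcongr
    rw [Real.enorm_eq_ofReal_abs, abs_mul, abs_pow]
    refine ENNReal.ofReal_le_ofReal ?_
    gcongr
    · exact hbd j x hx
    · exact hM x
  have t4 := t2.add t3
  rw [add_zero] at t4
  have e2 : ∀ j, (∫ x, f' x * ((mollify j f x)⁻¹ ^ 2 * φ x)) +
      ∫ x, (mollify j f' x - f' x) * ((mollify j f x)⁻¹ ^ 2 * φ x)
      = ∫ x, (mollify j f x)⁻¹ * pderiv i φ x := fun j => by
    rw [e, ← integral_add]
    · congr 1; ext x; ring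
    · have h3 := hφ.integrable_mul (hf.2.1.continuousOn_mul' isOpen_univ
        ((hsm j).continuous.pow 2).continuousOn)
      refine h3.congr (Eventually.of_forall fun x => ?_)
      simp only [Pi.pow_apply]; ring
    · have h3 := hφ.integrable_mul ((((contDiff_mollify j hl').continuous.locallyIntegrable.sub
        hl').locallyIntegrableOn univ).continuousOn_mul' isOpen_univ
        ((hsm j).continuous.pow 2).continuousOn)
      refine h3.congr (Eventually.of_forall fun x => ?_)
      simp only [Pi.pow_apply, Pi.sub_apply]; ring
  simp_rw [e2] at t4
  rw [tendsto_nhds_unique t1 t4, ← integral_neg]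
  congr 1
  ext x
  ring

end ProductRule

/-! ### Shifts at scale `⟨x⟩` and the measure `⟨x⟩^{-n} dx` -/

section WeightedMeasure

variable {n : ℕ}

/-- The weight `⟨x⟩ = √(1 + |x|²)`. -/
noncomputable def jap (x : EuclideanSpace ℝ (Fin n)) : ℝ := Real.sqrt (1 + ‖x‖ ^ 2)

theorem one_le_jap (x : EuclideanSpace ℝ (Fin n)) : 1 ≤ jap x := by
  rw [jap, Real.one_le_sqrt]
  nlinarith [sq_nonneg ‖x‖]

theorem jap_pos (x : EuclideanSpace ℝ (Fin n)) : 0 < jap x := one_pos.trans_le (one_le_jap x)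

theorem norm_le_jap (x : EuclideanSpace ℝ (Fin n)) : ‖x‖ ≤ jap x :=
  Real.le_sqrt_of_sq_le (by linarith)

theorem jap_le_one_add_norm (x : EuclideanSpace ℝ (Fin n)) : jap x ≤ 1 + ‖x‖ :=
  Real.sqrt_le_iff.2 ⟨by positivity, by nlinarith [norm_nonneg x]⟩

theorem contDiff_jap : ContDiff ℝ (⊤ : ℕ∞) (jap (n := n)) :=
  (contDiff_const.add (contDiff_norm_sq ℝ)).sqrt fun x => by positivity

theorem continuous_jap : Continuous (jap (n := n)) := contDiff_jap.continuous

theorem continuous_jap_rpow (s : ℝ) : Continuous fun x : EuclideanSpace ℝ (Fin n) => jap x ^ s :=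
  continuous_jap.rpow_const fun x => Or.inl (jap_pos x).ne'

/-- From `⟨x⟩² - ⟨y⟩² = |x|² - |y|²`. The Lipschitz constant one is what makes shifts by at most
half of `⟨x⟩` injective and leaves the weight comparable. -/
theorem abs_jap_sub_le (x y : EuclideanSpace ℝ (Fin n)) : |jap x - jap y| ≤ ‖x - y‖ := by
  have hx := jap_pos x
  have hy := jap_pos y
  have hx2 : jap x ^ 2 = 1 + ‖x‖ ^ 2 := Real.sq_sqrt (by positivity)
  have hy2 : jap y ^ 2 = 1 + ‖y‖ ^ 2 := Real.sq_sqrt (by positivity)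
  have h1 : (jap x - jap y) * (jap x + jap y) = (‖x‖ - ‖y‖) * (‖x‖ + ‖y‖) := by nlinarith
  have h2 : |jap x - jap y| * (jap x + jap y) = |‖x‖ - ‖y‖| * (‖x‖ + ‖y‖) := by
    rw [← abs_of_pos (add_pos hx hy), ← abs_mul, h1, abs_mul,
      abs_of_nonneg (add_nonneg (norm_nonneg x) (norm_nonneg y))]
  have h3 : |‖x‖ - ‖y‖| * (‖x‖ + ‖y‖) ≤ ‖x - y‖ * (jap x + jap y) := by
    gcongr
    · exact abs_norm_sub_norm_le x y
    · exact norm_le_jap x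
    · exact norm_le_jap y
  exact le_of_mul_le_mul_right (h2.trans_le h3) (add_pos hx hy)

/-- The translation of `x` by `⟨x⟩ / 2` times `w`. -/
noncomputable def japShift (w x : EuclideanSpace ℝ (Fin n)) : EuclideanSpace ℝ (Fin n) :=
  x + (jap x / 2) • w

theorem continuous_japShift :
    Continuous fun z : EuclideanSpace ℝ (Fin n) × EuclideanSpace ℝ (Fin n) =>
      japShift z.1 z.2 :=
  continuous_snd.add (((continuous_jap.comp continuous_snd).div_const 2).smul continuous_fst)

theorem measurable_japShift (w : EuclideanSpace ℝ (Fin n)) : Measurable (japShift w) :=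
  (continuous_japShift.comp (Continuous.prodMk_right w)).measurable

/-- The shift is the identity plus a map of Lipschitz constant at most `1/2`. -/
theorem antilipschitz_japShift {w : EuclideanSpace ℝ (Fin n)} (hw : ‖w‖ ≤ 1) :
    AntilipschitzWith 2 (japShift w) := by
  refine AntilipschitzWith.of_le_mul_dist fun x y => ?_
  rw [dist_eq_norm, dist_eq_norm]
  have h1 : japShift w x - japShift w y = (x - y) + ((jap x - jap y) / 2) • w := by
    simp only [japShift]
    module
  have h2 : ‖((jap x - jap y) / 2) • w‖ ≤ ‖x - y‖ / 2 := by
    rw [norm_smul, Real.norm_eq_abs, abs_div, abs_two]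
    calc |jap x - jap y| / 2 * ‖w‖ ≤ ‖x - y‖ / 2 * 1 := by
          gcongr
          exact abs_jap_sub_le x y
      _ = _ := mul_one _
  have h3 := norm_sub_le (japShift w x - japShift w y) (((jap x - jap y) / 2) • w)
  have h4 : japShift w x - japShift w y - ((jap x - jap y) / 2) • w = x - y := by
    rw [h1]; abel
  rw [h4] at h3
  push_cast
  linarith

theorem abs_jap_japShift_sub_le {w : EuclideanSpace ℝ (Fin n)} (hw : ‖w‖ ≤ 1)
    (x : EuclideanSpace ℝ (Fin n)) : |jap (japShift w x) - jap x| ≤ jap x / 2 := by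
  refine (abs_jap_sub_le _ _).trans ?_
  have : japShift w x - x = (jap x / 2) • w := by simp [japShift]
  rw [this, norm_smul, Real.norm_eq_abs, abs_of_pos (half_pos (jap_pos x))]
  exact mul_le_of_le_one_right (half_pos (jap_pos x)).le hw

theorem jap_japShift_le {w : EuclideanSpace ℝ (Fin n)} (hw : ‖w‖ ≤ 1)
    (x : EuclideanSpace ℝ (Fin n)) : jap (japShift w x) ≤ 2 * jap x := by
  have := (abs_le.1 (abs_jap_japShift_sub_le hw x)).2
  linarith [jap_pos x]

theorem jap_le_japShift {w : EuclideanSpace ℝ (Fin n)} (hw : ‖w‖ ≤ 1)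
    (x : EuclideanSpace ℝ (Fin n)) : jap x ≤ 2 * jap (japShift w x) := by
  have := (abs_le.1 (abs_jap_japShift_sub_le hw x)).1
  linarith

/-- Powers of the weight are comparable at `x` and at the shifted points. -/
theorem jap_rpow_le (s : ℝ) {w : EuclideanSpace ℝ (Fin n)} (hw : ‖w‖ ≤ 1)
    (x : EuclideanSpace ℝ (Fin n)) : jap x ^ s ≤ 2 ^ |s| * jap (japShift w x) ^ s := by
  have hx := jap_pos x
  have hy := jap_pos (japShift w x)
  rcases le_total 0 s with hs | hs
  · rw [abs_of_nonneg hs, ← Real.mul_rpow (by norm_num) hy.le]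
    exact Real.rpow_le_rpow hx.le (jap_le_japShift hw x) hs
  · have h1 := Real.rpow_le_rpow_of_nonpos hy (jap_japShift_le hw x) hs
    rw [Real.mul_rpow (by norm_num) hx.le] at h1
    rw [abs_of_nonpos hs]
    calc jap x ^ s = 2 ^ (-s) * (2 ^ s * jap x ^ s) := by
          rw [← mul_assoc, ← Real.rpow_add (by norm_num)]; simp
      _ ≤ _ := by gcongr

/-- Lebesgue measure is a multiple of `n`-dimensional Hausdorff measure, which an antilipschitz map
controls directly; no Jacobian has to be computed. -/
theorem volume_preimage_japShift_le {w : EuclideanSpace ℝ (Fin n)} (hw : ‖w‖ ≤ 1)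
    (S : Set (EuclideanSpace ℝ (Fin n))) :
    volume (japShift w ⁻¹' S) ≤ 2 ^ n * volume S := by
  have hH : (Measure.hausdorffMeasure (n : ℝ) : Measure (EuclideanSpace ℝ (Fin n))).IsAddHaarMeasure
      := by
    simpa using isAddHaarMeasure_hausdorffMeasure (E := EuclideanSpace ℝ (Fin n))
  have h := Measure.isAddLeftInvariant_eq_smul (volume : Measure (EuclideanSpace ℝ (Fin n)))
    (Measure.hausdorffMeasure (n : ℝ))
  rw [h, Measure.smul_apply, Measure.smul_apply]
  have h2 := (antilipschitz_japShift hw).hausdorffMeasure_preimage_le (Nat.cast_nonneg n) S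
  simp only [ENNReal.rpow_natCast, ENNReal.coe_ofNat] at h2
  simp only [ENNReal.smul_def, smul_eq_mul]
  rw [mul_left_comm (2 ^ n)]
  gcongr

theorem map_japShift_le {w : EuclideanSpace ℝ (Fin n)} (hw : ‖w‖ ≤ 1) :
    (volume : Measure (EuclideanSpace ℝ (Fin n))).map (japShift w) ≤ (2 : ℝ≥0∞) ^ n • volume :=
  Measure.le_iff.2 fun S hS => by
    rw [Measure.map_apply (measurable_japShift w) hS]
    exact volume_preimage_japShift_le hw S

theorem lintegral_japShift_le {w : EuclideanSpace ℝ (Fin n)} (hw : ‖w‖ ≤ 1)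
    {F : EuclideanSpace ℝ (Fin n) → ℝ≥0∞} (hF : Measurable F) :
    ∫⁻ x, F (japShift w x) ≤ 2 ^ n * ∫⁻ x, F x := by
  rw [← lintegral_map hF (measurable_japShift w), ← smul_eq_mul, ← lintegral_smul_measure]
  exact lintegral_mono' (map_japShift_le hw) le_rfl

/-- The measure `⟨x⟩⁻ⁿ dx`. -/
noncomputable def japMeasure (n : ℕ) : Measure (EuclideanSpace ℝ (Fin n)) :=
  volume.withDensity fun x => ENNReal.ofReal (jap x ^ (-(n : ℝ)))

theorem measurable_japWeight (s : ℝ) :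
    Measurable fun x : EuclideanSpace ℝ (Fin n) => ENNReal.ofReal (jap x ^ s) :=
  (continuous_jap_rpow s).measurable.ennreal_ofReal

theorem lintegral_japMeasure {F : EuclideanSpace ℝ (Fin n) → ℝ≥0∞} (hF : Measurable F) :
    ∫⁻ x, F x ∂japMeasure n = ∫⁻ x, ENNReal.ofReal (jap x ^ (-(n : ℝ))) * F x :=
  lintegral_withDensity_eq_lintegral_mul _ (measurable_japWeight _) hF

theorem japMeasure_absolutelyContinuous : japMeasure n ≪ volume :=
  withDensity_absolutelyContinuous _ _

theorem absolutelyContinuous_japMeasure : volume ≪ japMeasure n :=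
  withDensity_absolutelyContinuous' (measurable_japWeight _).aemeasurable
    (Eventually.of_forall fun x => by
      simpa only [ne_eq, ENNReal.ofReal_eq_zero, not_le] using Real.rpow_pos_of_pos (jap_pos x) _)

theorem ae_japMeasure : ae (japMeasure n) = ae volume :=
  le_antisymm (japMeasure_absolutelyContinuous.ae_le) (absolutelyContinuous_japMeasure.ae_le)

instance : SigmaFinite (japMeasure n) :=
  SigmaFinite.withDensity_of_ne_top (Eventually.of_forall fun _ => ENNReal.ofReal_ne_top)

/-- One factor `2^n` comes from the volume distortion, the other from comparing the weights at `x`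
and at the shifted point. -/
theorem lintegral_japShift_japMeasure_le {w : EuclideanSpace ℝ (Fin n)} (hw : ‖w‖ ≤ 1)
    {F : EuclideanSpace ℝ (Fin n) → ℝ≥0∞} (hF : Measurable F) :
    ∫⁻ x, F (japShift w x) ∂japMeasure n ≤ 4 ^ n * ∫⁻ x, F x ∂japMeasure n := by
  rw [lintegral_japMeasure (F := fun x => F (japShift w x)) (hF.comp (measurable_japShift w)),
    lintegral_japMeasure hF]
  calc ∫⁻ x, ENNReal.ofReal (jap x ^ (-(n : ℝ))) * F (japShift w x)
      ≤ ∫⁻ x, 2 ^ n * (ENNReal.ofReal (jap (japShift w x) ^ (-(n : ℝ))) * F (japShift w x)) := by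
        refine lintegral_mono fun x => ?_
        rw [← mul_assoc]
        gcongr
        refine (ENNReal.ofReal_le_ofReal (jap_rpow_le _ hw x)).trans_eq ?_
        rw [ENNReal.ofReal_mul (by positivity), abs_neg, Nat.abs_cast, Real.rpow_natCast,
          ENNReal.ofReal_pow (by norm_num), ENNReal.ofReal_ofNat]
    _ = 2 ^ n * ∫⁻ x, ENNReal.ofReal (jap (japShift w x) ^ (-(n : ℝ))) * F (japShift w x) := by
        rw [lintegral_const_mul' _ _ (by simp)]
    _ ≤ 2 ^ n * (2 ^ n * ∫⁻ x, ENNReal.ofReal (jap x ^ (-(n : ℝ))) * F x) := by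
        gcongr
        exact lintegral_japShift_le (F := fun y => ENNReal.ofReal (jap y ^ (-(n : ℝ))) * F y) hw
          ((measurable_japWeight _).mul hF)
    _ = _ := by
        rw [← mul_assoc, ← mul_pow]; norm_num

/-- The average of `F` over the shifts of `x` by `w`, with `w` distributed according to `Q`. -/
noncomputable def shiftAvg (Q : Measure (EuclideanSpace ℝ (Fin n)))
    (F : EuclideanSpace ℝ (Fin n) → ℝ≥0∞) (x : EuclideanSpace ℝ (Fin n)) : ℝ≥0∞ :=
  ∫⁻ w, F (japShift w x) ∂Q

theorem measurable_comp_japShift {F : EuclideanSpace ℝ (Fin n) → ℝ≥0∞} (hF : Measurable F) :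
    Measurable fun z : EuclideanSpace ℝ (Fin n) × EuclideanSpace ℝ (Fin n) =>
      F (japShift z.1 z.2) :=
  hF.comp continuous_japShift.measurable

theorem measurable_shiftAvg (Q : Measure (EuclideanSpace ℝ (Fin n))) [SFinite Q]
    {F : EuclideanSpace ℝ (Fin n) → ℝ≥0∞} (hF : Measurable F) : Measurable (shiftAvg Q F) :=
  (measurable_comp_japShift hF).lintegral_prod_left'

theorem shiftAvg_mono {Q : Measure (EuclideanSpace ℝ (Fin n))}
    {F G : EuclideanSpace ℝ (Fin n) → ℝ≥0∞} (h : ∀ x, F x ≤ G x) (x : EuclideanSpace ℝ (Fin n)) :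
    shiftAvg Q F x ≤ shiftAvg Q G x := lintegral_mono fun _ => h _

theorem shiftAvg_add {Q : Measure (EuclideanSpace ℝ (Fin n))}
    {F G : EuclideanSpace ℝ (Fin n) → ℝ≥0∞} (hF : Measurable F) (x : EuclideanSpace ℝ (Fin n)) :
    shiftAvg Q (fun y => F y + G y) x = shiftAvg Q F x + shiftAvg Q G x :=
  lintegral_add_left (hF.comp (continuous_japShift.comp
    (Continuous.prodMk_left x)).measurable) _

/-- Averages over shifts are locally bounded in `L¹`. -/
theorem setLIntegral_shiftAvg_le {Q : Measure (EuclideanSpace ℝ (Fin n))} [IsProbabilityMeasure Q]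
    (hQ : ∀ᵐ w ∂Q, ‖w‖ ≤ 1) {F : EuclideanSpace ℝ (Fin n) → ℝ≥0∞} (hF : Measurable F) (N : ℝ) :
    ∫⁻ x in Metric.closedBall 0 N, shiftAvg Q F x
      ≤ 2 ^ n * ∫⁻ x in Metric.closedBall 0 (2 * N + 1), F x := by
  unfold shiftAvg
  rw [lintegral_lintegral_swap (f := fun x w => F (japShift w x))
    ((measurable_comp_japShift hF).comp measurable_swap).aemeasurable]
  calc ∫⁻ w, ∫⁻ x in Metric.closedBall 0 N, F (japShift w x) ∂volume ∂Q
      ≤ ∫⁻ _, 2 ^ n * ∫⁻ x in Metric.closedBall 0 (2 * N + 1), F x ∂volume ∂Q := by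
        refine lintegral_mono_ae (hQ.mono fun w hw => ?_)
        rw [← lintegral_indicator Metric.isClosed_closedBall.measurableSet,
          ← lintegral_indicator Metric.isClosed_closedBall.measurableSet]
        refine le_trans (lintegral_mono fun x => ?_) (lintegral_japShift_le hw
          (hF.indicator (Metric.isClosed_closedBall (x := (0 : EuclideanSpace ℝ (Fin n)))
            (ε := 2 * N + 1)).measurableSet))
        by_cases hx : x ∈ Metric.closedBall (0 : EuclideanSpace ℝ (Fin n)) N
        · rw [indicator_of_mem hx, indicator_of_mem]
          rw [mem_closedBall_zero_iff] at hx ⊢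
          have h1 : ‖japShift w x‖ ≤ ‖x‖ + ‖(jap x / 2) • w‖ := norm_add_le _ _
          rw [norm_smul, Real.norm_eq_abs, abs_of_pos (half_pos (jap_pos x))] at h1
          have h2 := mul_le_of_le_one_right (half_pos (jap_pos x)).le hw
          linarith [jap_le_one_add_norm x, norm_nonneg x]
        · rw [indicator_of_notMem hx]; exact zero_le
    _ = _ := by rw [lintegral_const, measure_univ, mul_one]

end WeightedMeasure

/-! ### Potential estimate at scale `⟨x⟩` -/

section PointwiseEstimate

variable {n : ℕ}

/-- The uniform probability measure on the unit ball. -/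
noncomputable def ballProb (n : ℕ) : Measure (EuclideanSpace ℝ (Fin n)) :=
  (volume (Metric.closedBall (0 : EuclideanSpace ℝ (Fin n)) 1))⁻¹ •
    volume.restrict (Metric.closedBall 0 1)

theorem volume_unitBall_ne_zero :
    volume (Metric.closedBall (0 : EuclideanSpace ℝ (Fin n)) 1) ≠ 0 :=
  (Metric.measure_closedBall_pos _ _ one_pos).ne'

theorem volume_unitBall_ne_top :
    volume (Metric.closedBall (0 : EuclideanSpace ℝ (Fin n)) 1) ≠ ∞ :=
  measure_closedBall_lt_top.ne

instance : IsProbabilityMeasure (ballProb n) := by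
  constructor
  rw [ballProb, Measure.smul_apply, Measure.restrict_apply_univ, smul_eq_mul,
    ENNReal.inv_mul_cancel volume_unitBall_ne_zero volume_unitBall_ne_top]

theorem ae_ballProb : ∀ᵐ w ∂ballProb n, ‖w‖ ≤ 1 := by
  refine Measure.ae_smul_measure ?_ _
  refine (ae_restrict_iff' Metric.isClosed_closedBall.measurableSet).2
    (Eventually.of_forall fun w hw => ?_)
  simpa using hw

instance : IsProbabilityMeasure (volume.restrict (Ioc (0 : ℝ) 1)) := ⟨by simp⟩

theorem measurable_scale :
    Measurable fun q : EuclideanSpace ℝ (Fin n) × ℝ => q.2 • q.1 := by fun_prop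

/-- The distribution of `t w` for independent uniform `t ∈ (0, 1]` and `w` in the unit ball. -/
noncomputable def coneProb (n : ℕ) : Measure (EuclideanSpace ℝ (Fin n)) :=
  ((ballProb n).prod (volume.restrict (Ioc (0 : ℝ) 1))).map fun q => q.2 • q.1

instance : IsProbabilityMeasure (coneProb n) :=
  Measure.isProbabilityMeasure_map measurable_scale.aemeasurable

theorem ae_coneProb : ∀ᵐ w ∂coneProb n, ‖w‖ ≤ 1 := by
  refine (ae_map_iff measurable_scale.aemeasurable
    (measurableSet_le measurable_norm measurable_const)).2 ?_
  have h1 : ∀ᵐ q ∂(ballProb n).prod (volume.restrict (Ioc (0 : ℝ) 1)), ‖q.1‖ ≤ 1 :=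
    Measure.quasiMeasurePreserving_fst.ae ae_ballProb
  have h2 : ∀ᵐ q ∂(ballProb n).prod (volume.restrict (Ioc (0 : ℝ) 1)), q.2 ∈ Ioc (0 : ℝ) 1 :=
    Measure.quasiMeasurePreserving_snd.ae (ae_restrict_mem measurableSet_Ioc)
  filter_upwards [h1, h2] with q hq1 hq2
  rw [norm_smul, Real.norm_eq_abs, abs_of_pos hq2.1]
  exact mul_le_one₀ hq2.2 (norm_nonneg _) hq1

theorem shiftAvg_coneProb {F : EuclideanSpace ℝ (Fin n) → ℝ≥0∞} (hF : Measurable F)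
    (x : EuclideanSpace ℝ (Fin n)) :
    shiftAvg (coneProb n) F x
      = ∫⁻ z, ∫⁻ t in Ioc (0 : ℝ) 1, F (japShift (t • z) x) ∂volume ∂ballProb n := by
  have hm : Measurable fun w => F (japShift w x) :=
    (measurable_comp_japShift hF).comp (Measurable.prodMk measurable_id measurable_const)
  rw [shiftAvg, coneProb, lintegral_map hm measurable_scale,
    lintegral_prod (fun q : EuclideanSpace ℝ (Fin n) × ℝ => F (japShift (q.2 • q.1) x))
      (hm.comp measurable_scale).aemeasurable]

theorem fderiv_apply_eq_sum (f : EuclideanSpace ℝ (Fin n) → ℝ) (y w : EuclideanSpace ℝ (Fin n)) :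
    fderiv ℝ f y w = ∑ i, w i * pderiv i f y := by
  have h : w = ∑ i, w i • EuclideanSpace.single i (1 : ℝ) := by
    ext j
    simp [Pi.single_apply]
  conv_lhs => rw [h]
  simp [pderiv]

/-- The potential estimate for `C¹` functions. -/
theorem enorm_le_shiftAvg_of_contDiff {f : EuclideanSpace ℝ (Fin n) → ℝ} (hf : ContDiff ℝ 1 f)
    (x : EuclideanSpace ℝ (Fin n)) :
    ‖f x‖ₑ ≤ shiftAvg (ballProb n) (fun y => ‖f y‖ₑ) x +
      ENNReal.ofReal (jap x) * shiftAvg (coneProb n) (fun y => ∑ i, ‖pderiv i f y‖ₑ) x := by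
  have hd : ∀ i, Continuous (pderiv i f) := fun i =>
    (hf.continuous_fderiv one_ne_zero).clm_apply continuous_const
  have hm : Measurable fun y => ∑ i, ‖pderiv i f y‖ₑ :=
    Finset.measurable_sum _ fun i _ => (hd i).measurable.enorm
  rw [shiftAvg_coneProb hm, shiftAvg, ← lintegral_const_mul' _ _ ENNReal.ofReal_ne_top,
    ← lintegral_add_left]
  swap
  · exact (hf.continuous.measurable.enorm).comp (continuous_japShift.comp
      (Continuous.prodMk_left x)).measurable
  calc ‖f x‖ₑ = ∫⁻ _, ‖f x‖ₑ ∂ballProb n := by rw [lintegral_const, measure_univ, mul_one]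
    _ ≤ _ := by
      refine lintegral_mono_ae (ae_ballProb.mono fun z hz => ?_)
      set γ' := (jap x / 2) • z with hγ'
      have hline : ∀ t : ℝ, japShift (t • z) x = x + t • γ' := fun t => by
        rw [japShift, hγ', smul_comm]
      have hder : ∀ t : ℝ, HasDerivAt (fun t : ℝ => f (x + t • γ'))
          (fderiv ℝ f (x + t • γ') γ') t := fun t => by
        have h1 : HasDerivAt (fun t : ℝ => x + t • γ') γ' t := by
          simpa using ((hasDerivAt_id t).smul_const γ').const_add x
        exact ((hf.differentiable one_ne_zero) _).hasFDerivAt.comp_hasDerivAt t h1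
      have hcont : Continuous fun t : ℝ => fderiv ℝ f (x + t • γ') γ' :=
        ((hf.continuous_fderiv one_ne_zero).comp (by fun_prop)).clm_apply continuous_const
      have hftc := intervalIntegral.integral_eq_sub_of_hasDerivAt (a := 0) (b := 1)
        (fun t _ => hder t) (hcont.intervalIntegrable 0 1)
      -- Fundamental theorem of calculus along the segment from `x` to its shift by `z`. Averaging
      -- over `z` in the unit ball gives the claim, the factor `⟨x⟩` bounding the length of the
      -- segment.
      have e : f x = f (japShift z x) - ∫ t in (0 : ℝ)..1, fderiv ℝ f (x + t • γ') γ' := by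
        rw [hftc, ← one_smul ℝ z, hline 1]
        simp
      rw [e]
      refine (enorm_sub_le).trans (add_le_add le_rfl ?_)
      rw [intervalIntegral.integral_of_le zero_le_one,
        ← lintegral_const_mul' _ _ ENNReal.ofReal_ne_top]
      refine (enorm_integral_le_lintegral_enorm _).trans (lintegral_mono fun t => ?_)
      rw [hline, fderiv_apply_eq_sum, Finset.mul_sum]
      refine (enorm_sum_le _ _).trans (Finset.sum_le_sum fun i _ => ?_)
      rw [enorm_mul]
      gcongr
      rw [Real.enorm_eq_ofReal_abs]
      refine ENNReal.ofReal_le_ofReal ?_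
      have h2 : |γ' i| ≤ ‖γ'‖ := by
        rw [← Real.norm_eq_abs]; exact PiLp.norm_apply_le γ' i
      refine h2.trans ?_
      rw [hγ', norm_smul, Real.norm_eq_abs, abs_of_pos (half_pos (jap_pos x))]
      have := mul_le_of_le_one_right (half_pos (jap_pos x)).le hz
      linarith [jap_pos x]

theorem setLIntegral_mollify_sub_tendsto {f : EuclideanSpace ℝ (Fin n) → ℝ}
    (hf : LocallyIntegrable f) {K : Set (EuclideanSpace ℝ (Fin n))} (hK : IsCompact K) :
    Tendsto (fun j => ∫⁻ x in K, ‖mollify j f x - f x‖ₑ) atTop (𝓝 0) := by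
  have h := tendsto_eLpNorm_mollify_sub (r := 1) le_rfl (f := f) (fun K hK => by
    rw [ENNReal.ofReal_one, memLp_one_iff_integrable]
    exact hf.integrableOn_isCompact hK) hK
  simpa only [ENNReal.ofReal_one, eLpNorm_one_eq_lintegral_enorm] using h

/-- The potential estimate for weakly differentiable functions. -/
theorem ae_enorm_le_shiftAvg {u : EuclideanSpace ℝ (Fin n) → ℝ}
    {v : Fin n → EuclideanSpace ℝ (Fin n) → ℝ} (hu : Measurable u) (hv : ∀ i, Measurable (v i))
    (h : ∀ i, HasWeakDeriv univ [i] u (v i)) (hul : LocallyIntegrable u) :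
    ∀ᵐ x, ‖u x‖ₑ ≤ shiftAvg (ballProb n) (fun y => ‖u y‖ₑ) x +
      ENNReal.ofReal (jap x) * shiftAvg (coneProb n) (fun y => ∑ i, ‖v i y‖ₑ) x := by
  have hvl : ∀ i, LocallyIntegrable (v i) := fun i => locallyIntegrableOn_univ.1 (h i).2.1
  have hmu : ∀ j, Measurable (mollify j u) := fun j => (contDiff_mollify j hul).continuous.measurable
  have hmv : ∀ j i, Measurable (mollify j (v i)) := fun j i =>
    (contDiff_mollify j (hvl i)).continuous.measurable
  -- the error terms
  set e : ℕ → EuclideanSpace ℝ (Fin n) → ℝ≥0∞ := fun j x =>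
    shiftAvg (ballProb n) (fun y => ‖mollify j u y - u y‖ₑ) x +
      ENNReal.ofReal (jap x) *
        shiftAvg (coneProb n) (fun y => ∑ i, ‖mollify j (v i) y - v i y‖ₑ) x with he
  have hm1 : ∀ j, Measurable fun y => ‖mollify j u y - u y‖ₑ := fun j => ((hmu j).sub hu).enorm
  have hm2 : ∀ j, Measurable fun y => ∑ i, ‖mollify j (v i) y - v i y‖ₑ := fun j =>
    Finset.measurable_sum _ fun i _ => ((hmv j i).sub (hv i)).enorm
  have hme : ∀ j, Measurable (e j) := fun j =>
    (measurable_shiftAvg _ (hm1 j)).add ((by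
      simpa using measurable_japWeight (n := n) 1 :
        Measurable fun x : EuclideanSpace ℝ (Fin n) => ENNReal.ofReal (jap x)).mul
      (measurable_shiftAvg _ (hm2 j)))
  have hest : ∀ j x, ‖mollify j u x‖ₑ ≤ (shiftAvg (ballProb n) (fun y => ‖u y‖ₑ) x +
      ENNReal.ofReal (jap x) * shiftAvg (coneProb n) (fun y => ∑ i, ‖v i y‖ₑ) x) + e j x := by
    intro j x
    refine (enorm_le_shiftAvg_of_contDiff ((contDiff_mollify j hul).of_le
      (by exact_mod_cast le_top)) x).trans ?_
    have a1 : shiftAvg (ballProb n) (fun y => ‖mollify j u y‖ₑ) x ≤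
        shiftAvg (ballProb n) (fun y => ‖u y‖ₑ) x +
          shiftAvg (ballProb n) (fun y => ‖mollify j u y - u y‖ₑ) x := by
      rw [← shiftAvg_add hu.enorm]
      refine shiftAvg_mono (fun y => ?_) x
      calc ‖mollify j u y‖ₑ = ‖u y + (mollify j u y - u y)‖ₑ := by congr 1; ring
        _ ≤ _ := enorm_add_le _ _
    have a2 : shiftAvg (coneProb n) (fun y => ∑ i, ‖pderiv i (mollify j u) y‖ₑ) x ≤
        shiftAvg (coneProb n) (fun y => ∑ i, ‖v i y‖ₑ) x +
          shiftAvg (coneProb n) (fun y => ∑ i, ‖mollify j (v i) y - v i y‖ₑ) x := by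
      rw [← shiftAvg_add (Finset.measurable_sum _ fun i _ => (hv i).enorm)]
      refine shiftAvg_mono (fun y => ?_) x
      rw [← Finset.sum_add_distrib]
      refine Finset.sum_le_sum fun i _ => ?_
      rw [(h i).pderiv_mollify]
      calc ‖mollify j (v i) y‖ₑ = ‖v i y + (mollify j (v i) y - v i y)‖ₑ := by congr 1; ring
        _ ≤ _ := enorm_add_le _ _
    calc _ ≤ _ := add_le_add a1 (mul_le_mul_right a2 _)
      _ = _ := by rw [mul_add, he]; ring
  -- The error terms vanish in `L¹` on every ball, because mollifications converge in `L¹` on the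
  -- larger ball that the shifts reach.
  have hlim : ∀ N : ℕ, Tendsto (fun j => ∫⁻ x in Metric.closedBall 0 (N : ℝ), e j x) atTop
      (𝓝 0) := fun N => by
    set K := Metric.closedBall (0 : EuclideanSpace ℝ (Fin n)) (2 * (N : ℝ) + 1) with hK
    have hKc : IsCompact K := isCompact_closedBall _ _
    have hbd : ∀ j, ∫⁻ x in Metric.closedBall 0 (N : ℝ), e j x ≤
        2 ^ n * (∫⁻ x in K, ‖mollify j u x - u x‖ₑ) + ENNReal.ofReal (1 + N) * (2 ^ n *
          ∑ i, ∫⁻ x in K, ‖mollify j (v i) x - v i x‖ₑ) := fun j => by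
      rw [he, lintegral_add_left (measurable_shiftAvg _ (hm1 j))]
      refine add_le_add (setLIntegral_shiftAvg_le ae_ballProb (hm1 j) N) ?_
      have hsum : ∑ i, ∫⁻ x in K, ‖mollify j (v i) x - v i x‖ₑ
          = ∫⁻ x in K, ∑ i, ‖mollify j (v i) x - v i x‖ₑ :=
        (lintegral_finsetSum (f := fun i x => ‖mollify j (v i) x - v i x‖ₑ) _
          fun i _ => ((hmv j i).sub (hv i)).enorm).symm
      rw [hsum]
      refine le_trans ?_ (mul_le_mul_right (setLIntegral_shiftAvg_le ae_coneProb (hm2 j) N) _)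
      rw [← lintegral_const_mul' _ _ ENNReal.ofReal_ne_top]
      refine setLIntegral_mono' Metric.isClosed_closedBall.measurableSet fun x hx => ?_
      gcongr
      have := jap_le_one_add_norm x
      rw [mem_closedBall_zero_iff] at hx
      linarith
    refine tendsto_of_tendsto_of_tendsto_of_le_of_le tendsto_const_nhds ?_ (fun _ => zero_le) hbd
    have t1 := ENNReal.Tendsto.const_mul (a := (2 : ℝ≥0∞) ^ n)
      (setLIntegral_mollify_sub_tendsto hul hKc) (Or.inr (by simp))
    have t2 := ENNReal.Tendsto.const_mul (a := (2 : ℝ≥0∞) ^ n) (tendsto_finsetSum Finset.univ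
      fun i _ => setLIntegral_mollify_sub_tendsto (hvl i) hKc) (Or.inr (by simp))
    have t3 := ENNReal.Tendsto.const_mul (a := ENNReal.ofReal (1 + N)) t2 (Or.inr (by simp))
    simpa using t1.add t3
  -- Fatou makes the lower limit of the errors vanish almost everywhere. That gives arbitrarily
  -- large `j` with small error, so no subsequence has to be extracted.
  have hfatou : ∀ N : ℕ, ∀ᵐ x, x ∈ Metric.closedBall (0 : EuclideanSpace ℝ (Fin n)) (N : ℝ) →
      liminf (fun j => e j x) atTop = 0 := fun N => by
    have h1 : ∫⁻ x in Metric.closedBall 0 (N : ℝ), liminf (fun j => e j x) atTop ≤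
        liminf (fun j => ∫⁻ x in Metric.closedBall 0 (N : ℝ), e j x) atTop :=
      lintegral_liminf_le hme
    rw [(hlim N).liminf_eq, nonpos_iff_eq_zero,
      lintegral_eq_zero_iff (Measurable.liminf hme)] at h1
    exact (ae_restrict_iff' Metric.isClosed_closedBall.measurableSet).1 h1
  filter_upwards [ae_all_iff.2 hfatou, ae_tendsto_mollify hul] with x hx hxu
  obtain ⟨N, hN⟩ := exists_nat_ge ‖x‖
  have h0 := hx N (by simpa using hN)
  refine ENNReal.le_of_forall_pos_le_add fun ε hε _ => ?_
  have hε' : (0 : ℝ≥0∞) < (ε / 2 : NNReal) := by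
    exact_mod_cast half_pos hε
  have hfreq : ∃ᶠ j in atTop, e j x < (ε / 2 : NNReal) := by
    refine frequently_lt_of_liminf_lt (by isBoundedDefault) ?_
    rw [h0]; exact hε'
  have hev : ∀ᶠ j in atTop, ‖u x - mollify j u x‖ₑ < (ε / 2 : NNReal) := by
    have : Tendsto (fun j => ‖u x - mollify j u x‖ₑ) atTop (𝓝 0) := by
      rw [← tendsto_zero_iff_enorm_tendsto_zero]
      simpa using hxu.const_sub (u x)
    exact this.eventually (gt_mem_nhds hε')
  obtain ⟨j, hj1, hj2⟩ := (hfreq.and_eventually hev).exists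
  calc ‖u x‖ₑ = ‖mollify j u x + (u x - mollify j u x)‖ₑ := by congr 1; ring
    _ ≤ ‖mollify j u x‖ₑ + ‖u x - mollify j u x‖ₑ := enorm_add_le _ _
    _ ≤ _ := add_le_add (hest j x) hj2.le
    _ ≤ _ := by
      rw [add_assoc]
      refine add_le_add le_rfl ?_
      calc e j x + (ε / 2 : NNReal) ≤ (ε / 2 : NNReal) + (ε / 2 : NNReal) := by gcongr
        _ = ε := by rw [← ENNReal.coe_add, add_halves]

end PointwiseEstimate

/-! ### One step of the weighted Sobolev embedding -/

section EmbeddingStep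

variable {n : ℕ}

/-- The average of `F` over a ball around `x` of radius `t ⟨x⟩ / 2`. -/
noncomputable def ballAvg (t : ℝ) (F : EuclideanSpace ℝ (Fin n) → ℝ≥0∞)
    (x : EuclideanSpace ℝ (Fin n)) : ℝ≥0∞ :=
  ∫⁻ z, F (japShift (t • z) x) ∂ballProb n

theorem measurable_ballAvg_uncurry {F : EuclideanSpace ℝ (Fin n) → ℝ≥0∞} (hF : Measurable F) :
    Measurable fun q : ℝ × EuclideanSpace ℝ (Fin n) => ballAvg q.1 F q.2 := by
  have h : Measurable fun r : (ℝ × EuclideanSpace ℝ (Fin n)) × EuclideanSpace ℝ (Fin n) =>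
      F (japShift (r.1.1 • r.2) r.1.2) :=
    (measurable_comp_japShift hF).comp (by fun_prop : Measurable
      fun r : (ℝ × EuclideanSpace ℝ (Fin n)) × EuclideanSpace ℝ (Fin n) =>
        (r.1.1 • r.2, r.1.2))
  exact h.lintegral_prod_right'

theorem shiftAvg_ballProb (F : EuclideanSpace ℝ (Fin n) → ℝ≥0∞) (x : EuclideanSpace ℝ (Fin n)) :
    shiftAvg (ballProb n) F x = ballAvg 1 F x := by
  simp [shiftAvg, ballAvg]

theorem shiftAvg_coneProb_eq {F : EuclideanSpace ℝ (Fin n) → ℝ≥0∞} (hF : Measurable F)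
    (x : EuclideanSpace ℝ (Fin n)) :
    shiftAvg (coneProb n) F x = ∫⁻ t in Ioc (0 : ℝ) 1, ballAvg t F x := by
  have hm : Measurable fun w => F (japShift w x) :=
    (measurable_comp_japShift hF).comp (Measurable.prodMk measurable_id measurable_const)
  rw [shiftAvg_coneProb hF]
  exact lintegral_lintegral_swap (f := fun z t => F (japShift (t • z) x))
    (hm.comp measurable_scale).aemeasurable

theorem lintegral_affine (G : EuclideanSpace ℝ (Fin n) → ℝ≥0∞) (hG : Measurable G)
    (x : EuclideanSpace ℝ (Fin n)) {s : ℝ} (hs : 0 < s) :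
    ∫⁻ z, G (x + s • z) = ENNReal.ofReal (s ^ (-(n : ℝ))) * ∫⁻ z, G z := by
  have h1 : ∫⁻ z, G (x + s • z) = ∫⁻ z, G (x + z) ∂(Measure.map (s • ·) volume) := by
    rw [lintegral_map (f := fun z => G (x + z)) (hG.comp (measurable_const_add x))
      (measurable_const_smul s)]
  rw [h1, Measure.map_addHaar_smul _ hs.ne', lintegral_smul_measure,
    lintegral_add_left_eq_self, smul_eq_mul, finrank_euclideanSpace_fin,
    Real.rpow_neg hs.le, Real.rpow_natCast, abs_of_pos (by positivity)]

/-- The averages over balls are controlled pointwise by the `L^a` norm. -/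
theorem exists_ballAvg_rpow_le (n : ℕ) : ∃ C : ℝ≥0∞, C ≠ ∞ ∧
    ∀ (F : EuclideanSpace ℝ (Fin n) → ℝ≥0∞), Measurable F → ∀ a : ℝ, 1 ≤ a →
    ∀ t ∈ Ioc (0 : ℝ) 1, ∀ x, ballAvg t F x ^ a ≤
      C * ENNReal.ofReal t ^ (-(n : ℝ)) * ∫⁻ y, F y ^ a ∂japMeasure n := by
  set V := volume (Metric.closedBall (0 : EuclideanSpace ℝ (Fin n)) 1) with hV
  refine ⟨V⁻¹ * 4 ^ n, ENNReal.mul_ne_top (ENNReal.inv_ne_top.2 volume_unitBall_ne_zero)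
    (by simp), fun F hF a ha t ht x => ?_⟩
  have ht0 : 0 < t := ht.1
  have hsm : Measurable fun z : EuclideanSpace ℝ (Fin n) => F (japShift (t • z) x) :=
    (measurable_comp_japShift hF).comp (by fun_prop : Measurable
      fun z : EuclideanSpace ℝ (Fin n) => (t • z, x))
  have hGm : Measurable fun y => F y ^ a := hF.pow_const a
  set w : EuclideanSpace ℝ (Fin n) → ℝ≥0∞ := fun y => ENNReal.ofReal (jap y ^ (-(n : ℝ))) with hw
  have hwm : Measurable w := measurable_japWeight _
  set s := t * (jap x / 2) with hs
  have hs0 : 0 < s := mul_pos ht0 (half_pos (jap_pos x))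
  have hshift : ∀ z, japShift (t • z) x = x + s • z := fun z => by
    rw [japShift, smul_smul, hs, mul_comm]
  have hwx0 : w x ≠ 0 := by
    simpa only [hw, ne_eq, ENNReal.ofReal_eq_zero, not_le] using Real.rpow_pos_of_pos (jap_pos x) _
  have hwx : w x ≠ ∞ := ENNReal.ofReal_ne_top
  have key : w x * ∫⁻ z in Metric.closedBall 0 1, F (japShift (t • z) x) ^ a
      ≤ 2 ^ n * (ENNReal.ofReal (s ^ (-(n : ℝ))) * ∫⁻ y, F y ^ a ∂japMeasure n) := by
    rw [lintegral_japMeasure hGm, ← lintegral_affine (fun y => w y * F y ^ a) (hwm.mul hGm) x hs0,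
      ← lintegral_const_mul' _ _ hwx, ← lintegral_const_mul' _ _ (by simp)]
    refine le_trans (setLIntegral_mono' Metric.isClosed_closedBall.measurableSet fun z hz => ?_)
      (setLIntegral_le_lintegral _ _)
    rw [← hshift, ← mul_assoc]
    gcongr
    rw [mem_closedBall_zero_iff] at hz
    have htz : ‖t • z‖ ≤ 1 := by
      rw [norm_smul, Real.norm_eq_abs, abs_of_pos ht0]
      exact mul_le_one₀ ht.2 (norm_nonneg _) hz
    refine (ENNReal.ofReal_le_ofReal (jap_rpow_le _ htz x)).trans_eq ?_
    rw [ENNReal.ofReal_mul (by positivity), abs_neg, Nat.abs_cast, Real.rpow_natCast,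
      ENNReal.ofReal_pow (by norm_num), ENNReal.ofReal_ofNat]
  -- The scaling Jacobian splits into `t^{-n}`, a constant and `⟨x⟩^{-n}`. The last factor cancels
  -- the weight multiplied in on the left, so the bound is uniform in `x`.
  have hws : ENNReal.ofReal (s ^ (-(n : ℝ))) = w x * (2 ^ n * ENNReal.ofReal t ^ (-(n : ℝ))) := by
    rw [hs, Real.mul_rpow ht0.le (half_pos (jap_pos x)).le, Real.div_rpow (jap_pos x).le (by norm_num),
      ENNReal.ofReal_mul (by positivity), ENNReal.ofReal_rpow_of_pos ht0, hw, div_eq_mul_inv,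
      ← Real.rpow_neg (by norm_num), neg_neg, ENNReal.ofReal_mul (Real.rpow_nonneg (jap_pos x).le _),
      Real.rpow_natCast, ENNReal.ofReal_pow (by norm_num), ENNReal.ofReal_ofNat]
    ring
  rw [hws] at key
  have key2 : ∫⁻ z in Metric.closedBall 0 1, F (japShift (t • z) x) ^ a
      ≤ 4 ^ n * ENNReal.ofReal t ^ (-(n : ℝ)) * ∫⁻ y, F y ^ a ∂japMeasure n := by
    refine (ENNReal.mul_le_mul_iff_right hwx0 hwx).1 (key.trans_eq ?_)
    rw [show (4 : ℝ≥0∞) ^ n = 2 ^ n * 2 ^ n by rw [← mul_pow]; norm_num]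
    ring
  calc ballAvg t F x ^ a ≤ ∫⁻ z, F (japShift (t • z) x) ^ a ∂ballProb n :=
        lintegral_rpow_le_lintegral_rpow hsm.aemeasurable ha
    _ = V⁻¹ * ∫⁻ z in Metric.closedBall 0 1, F (japShift (t • z) x) ^ a := by
        rw [ballProb, lintegral_smul_measure, smul_eq_mul]
    _ ≤ V⁻¹ * (4 ^ n * ENNReal.ofReal t ^ (-(n : ℝ)) * ∫⁻ y, F y ^ a ∂japMeasure n) := by gcongr
    _ = _ := by ring

theorem lintegral_ballAvg_rpow_le {F : EuclideanSpace ℝ (Fin n) → ℝ≥0∞} (hF : Measurable F)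
    {a : ℝ} (ha : 1 ≤ a) {t : ℝ} (ht : t ∈ Ioc (0 : ℝ) 1) :
    ∫⁻ x, ballAvg t F x ^ a ∂japMeasure n ≤ 4 ^ n * ∫⁻ y, F y ^ a ∂japMeasure n := by
  have hm : Measurable fun q : EuclideanSpace ℝ (Fin n) × EuclideanSpace ℝ (Fin n) =>
      F (japShift (t • q.2) q.1) ^ a :=
    ((measurable_comp_japShift hF).comp (by fun_prop : Measurable
      fun q : EuclideanSpace ℝ (Fin n) × EuclideanSpace ℝ (Fin n) => (t • q.2, q.1))).pow_const a
  calc ∫⁻ x, ballAvg t F x ^ a ∂japMeasure n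
      ≤ ∫⁻ x, ∫⁻ z, F (japShift (t • z) x) ^ a ∂ballProb n ∂japMeasure n := by
        refine lintegral_mono fun x => lintegral_rpow_le_lintegral_rpow ?_ ha
        exact ((measurable_comp_japShift hF).comp (by fun_prop : Measurable
          fun z : EuclideanSpace ℝ (Fin n) => (t • z, x))).aemeasurable
    _ = ∫⁻ z, ∫⁻ x, F (japShift (t • z) x) ^ a ∂japMeasure n ∂ballProb n :=
        lintegral_lintegral_swap (f := fun x z => F (japShift (t • z) x) ^ a) hm.aemeasurable
    _ ≤ ∫⁻ _, 4 ^ n * ∫⁻ y, F y ^ a ∂japMeasure n ∂ballProb n := by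
        refine lintegral_mono_ae (ae_ballProb.mono fun z hz => ?_)
        refine lintegral_japShift_japMeasure_le (F := fun y => F y ^ a) ?_ (hF.pow_const a)
        rw [norm_smul, Real.norm_eq_abs, abs_of_pos ht.1]
        exact mul_le_one₀ ht.2 (norm_nonneg _) hz
    _ = _ := by rw [lintegral_const, measure_univ, mul_one]

/-- Averages over balls map `L^a` to `L^q` for `q ≥ a`, with a loss in the radius. -/
theorem exists_lintegral_ballAvg_rpow_le {F : EuclideanSpace ℝ (Fin n) → ℝ≥0∞} (hF : Measurable F)
    {a q : ℝ} (ha : 1 ≤ a) (haq : a ≤ q) (hN : ∫⁻ y, F y ^ a ∂japMeasure n ≠ ∞) :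
    ∃ D : ℝ≥0∞, D ≠ ∞ ∧ ∀ t ∈ Ioc (0 : ℝ) 1, ∫⁻ x, ballAvg t F x ^ q ∂japMeasure n ≤
      D * ENNReal.ofReal t ^ (-(n * (q / a - 1))) := by
  obtain ⟨C, hC, h⟩ := exists_ballAvg_rpow_le n
  set N := ∫⁻ y, F y ^ a ∂japMeasure n with hN'
  have ha0 : 0 < a := by linarith
  have hexp : 0 ≤ q / a - 1 := by
    rw [sub_nonneg, le_div_iff₀ ha0]; linarith
  refine ⟨(C * N) ^ (q / a - 1) * (4 ^ n * N), ENNReal.mul_ne_top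
    (ENNReal.rpow_ne_top_of_nonneg hexp (ENNReal.mul_ne_top hC hN))
    (ENNReal.mul_ne_top (by simp) hN), fun t ht => ?_⟩
  -- Interpolation: `q/a - 1` powers of `A^a`, where `A` is the average, go into the pointwise
  -- bound, and one remaining power is integrated.
  have hpt : ∀ x, ballAvg t F x ^ q ≤
      (C * ENNReal.ofReal t ^ (-(n : ℝ)) * N) ^ (q / a - 1) * ballAvg t F x ^ a := fun x => by
    calc ballAvg t F x ^ q = (ballAvg t F x ^ a) ^ (q / a - 1) * ballAvg t F x ^ a := by
          rw [← ENNReal.rpow_mul, ← ENNReal.rpow_add_of_nonneg _ _ (by positivity) ha0.le]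
          congr 1; field_simp; ring
      _ ≤ _ := by gcongr; exact h F hF a ha t ht x
  have hτ0 : ENNReal.ofReal t ≠ 0 := by simpa using ht.1
  have hτ : ENNReal.ofReal t ^ (-(n : ℝ)) ≠ ∞ :=
    ENNReal.rpow_ne_top_of_ne_zero hτ0 ENNReal.ofReal_ne_top
  calc ∫⁻ x, ballAvg t F x ^ q ∂japMeasure n
      ≤ ∫⁻ x, (C * ENNReal.ofReal t ^ (-(n : ℝ)) * N) ^ (q / a - 1) * ballAvg t F x ^ a
          ∂japMeasure n := lintegral_mono hpt
    _ = (C * ENNReal.ofReal t ^ (-(n : ℝ)) * N) ^ (q / a - 1) *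
          ∫⁻ x, ballAvg t F x ^ a ∂japMeasure n := by
        rw [lintegral_const_mul' _ _ (ENNReal.rpow_ne_top_of_nonneg hexp
          (ENNReal.mul_ne_top (ENNReal.mul_ne_top hC hτ) hN))]
    _ ≤ (C * ENNReal.ofReal t ^ (-(n : ℝ)) * N) ^ (q / a - 1) * (4 ^ n * N) := by
        gcongr; exact lintegral_ballAvg_rpow_le hF ha ht
    _ = _ := by
        rw [mul_right_comm C, ENNReal.mul_rpow_of_nonneg _ _ hexp, ← ENNReal.rpow_mul, neg_mul]
        ring

/-- The probability measure `(1 - l) t^{-l} dt` on `(0, 1]`. -/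
noncomputable def powProb (l : ℝ) : Measure ℝ :=
  (volume.restrict (Ioc (0 : ℝ) 1)).withDensity fun t =>
    ENNReal.ofReal (1 - l) * ENNReal.ofReal t ^ (-l)

theorem measurable_powDensity (l : ℝ) :
    Measurable fun t : ℝ => ENNReal.ofReal (1 - l) * ENNReal.ofReal t ^ (-l) :=
  (ENNReal.measurable_ofReal.pow_const _).const_mul _

theorem lintegral_ofReal_rpow {l : ℝ} (hl : l < 1) :
    ∫⁻ t in Ioc (0 : ℝ) 1, ENNReal.ofReal t ^ (-l) = ENNReal.ofReal (1 - l)⁻¹ := by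
  have h1 : ∫⁻ t in Ioc (0 : ℝ) 1, ENNReal.ofReal t ^ (-l)
      = ∫⁻ t in Ioc (0 : ℝ) 1, ENNReal.ofReal (t ^ (-l)) :=
    setLIntegral_congr_fun measurableSet_Ioc fun t ht => ENNReal.ofReal_rpow_of_pos ht.1
  have hint : IntervalIntegrable (fun t : ℝ => t ^ (-l)) volume 0 1 :=
    intervalIntegral.intervalIntegrable_rpow' (by linarith)
  rw [h1, ← ofReal_integral_eq_lintegral_ofReal
    ((intervalIntegrable_iff_integrableOn_Ioc_of_le zero_le_one).1 hint)
    ((ae_restrict_iff' measurableSet_Ioc).2 (Eventually.of_forall fun t ht =>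
      Real.rpow_nonneg ht.1.le _)), ← intervalIntegral.integral_of_le zero_le_one,
    integral_rpow (Or.inl (by linarith))]
  congr 1
  rw [Real.one_rpow, Real.zero_rpow (by linarith)]
  field_simp
  ring

theorem isProbabilityMeasure_powProb {l : ℝ} (hl : l < 1) : IsProbabilityMeasure (powProb l) := by
  constructor
  rw [powProb, withDensity_apply _ MeasurableSet.univ, Measure.restrict_univ,
    lintegral_const_mul' _ _ ENNReal.ofReal_ne_top, lintegral_ofReal_rpow hl,
    ← ENNReal.ofReal_mul (by linarith), mul_inv_cancel₀ (by linarith), ENNReal.ofReal_one]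

theorem lintegral_powProb {l : ℝ} {F : ℝ → ℝ≥0∞} (hF : Measurable F) :
    ∫⁻ t, F t ∂powProb l
      = ∫⁻ t in Ioc (0 : ℝ) 1, ENNReal.ofReal (1 - l) * ENNReal.ofReal t ^ (-l) * F t :=
  lintegral_withDensity_eq_lintegral_mul _ (measurable_powDensity l) hF

/-- The potential `∫₀¹ A_t F dt` maps `L^a` to `L^q` if `1 / q > 1 / a - 1 / n`. -/
theorem lintegral_shiftAvg_coneProb_rpow_lt_top {F : EuclideanSpace ℝ (Fin n) → ℝ≥0∞}
    (hF : Measurable F) {a q : ℝ} (ha : 1 ≤ a) (haq : a ≤ q) (hl : n * (1 / a - 1 / q) < 1)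
    (hN : ∫⁻ y, F y ^ a ∂japMeasure n ≠ ∞) :
    ∫⁻ x, shiftAvg (coneProb n) F x ^ q ∂japMeasure n < ∞ := by
  obtain ⟨D, hD, h⟩ := exists_lintegral_ballAvg_rpow_le hF ha haq hN
  have ha0 : 0 < a := by linarith
  have hq0 : 0 < q := by linarith
  -- `t^{-l}` is the loss in the `L^a` to `L^q` bound of the average of radius `t`. Being integrable
  -- at zero, it can be normalised to a probability density. Jensen under this density produces
  -- `t^{lq}`, which cancels the loss exactly.
  set l := n * (1 / a - 1 / q) with hl'
  have hlq : n * (q / a - 1) = l * q := by rw [hl']; field_simp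
  have hprob := isProbabilityMeasure_powProb hl
  have hc0 : ENNReal.ofReal (1 - l) ≠ 0 := by simpa using hl
  have hc : ENNReal.ofReal (1 - l) ≠ ∞ := ENNReal.ofReal_ne_top
  have hB : Measurable fun r : ℝ × EuclideanSpace ℝ (Fin n) => ballAvg r.1 F r.2 :=
    measurable_ballAvg_uncurry hF
  have hBt : ∀ x, Measurable fun t : ℝ => ballAvg t F x := fun x =>
    hB.comp (Measurable.prodMk measurable_id measurable_const)
  have hpow : ∀ t ∈ Ioc (0 : ℝ) 1, ENNReal.ofReal t ^ (-l) * ENNReal.ofReal t ^ l = 1 :=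
    fun t ht => by
      rw [← ENNReal.rpow_add _ _ (by simpa using ht.1) ENNReal.ofReal_ne_top, neg_add_cancel,
        ENNReal.rpow_zero]
  set G : EuclideanSpace ℝ (Fin n) → ℝ → ℝ≥0∞ := fun x t =>
    (ENNReal.ofReal (1 - l))⁻¹ * ENNReal.ofReal t ^ l * ballAvg t F x with hG
  have hGm : Measurable (Function.uncurry G) := by
    refine Measurable.mul ?_ (hB.comp measurable_swap)
    exact ((ENNReal.measurable_ofReal.comp measurable_snd).pow_const _).const_mul _
  have hGt : ∀ x, Measurable (G x) := fun x =>
    hGm.comp (Measurable.prodMk measurable_const measurable_id)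
  have e1 : ∀ x, shiftAvg (coneProb n) F x = ∫⁻ t, G x t ∂powProb l := fun x => by
    rw [shiftAvg_coneProb_eq hF, lintegral_powProb (hGt x)]
    refine setLIntegral_congr_fun measurableSet_Ioc fun t ht => ?_
    calc ballAvg t F x = (ENNReal.ofReal (1 - l) * (ENNReal.ofReal (1 - l))⁻¹) *
          (ENNReal.ofReal t ^ (-l) * ENNReal.ofReal t ^ l) * ballAvg t F x := by
          rw [hpow t ht, ENNReal.mul_inv_cancel hc0 hc, one_mul, one_mul]
      _ = _ := by rw [hG]; ring
  have : SFinite (powProb l) := inferInstance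
  calc ∫⁻ x, shiftAvg (coneProb n) F x ^ q ∂japMeasure n
      ≤ ∫⁻ x, ∫⁻ t, G x t ^ q ∂powProb l ∂japMeasure n := by
        refine lintegral_mono fun x => ?_
        dsimp only
        rw [e1]
        exact lintegral_rpow_le_lintegral_rpow (hGt x).aemeasurable (ha.trans haq)
    _ = ∫⁻ t, ∫⁻ x, G x t ^ q ∂japMeasure n ∂powProb l :=
        lintegral_lintegral_swap (f := fun x t => G x t ^ q) (hGm.pow_const q).aemeasurable
    _ ≤ ∫⁻ _, (ENNReal.ofReal (1 - l))⁻¹ ^ q * D ∂powProb l := by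
        have hae : ∀ᵐ t ∂powProb l, t ∈ Ioc (0 : ℝ) 1 :=
          (withDensity_absolutelyContinuous _ _).ae_le (ae_restrict_mem measurableSet_Ioc)
        refine lintegral_mono_ae (hae.mono fun t ht => ?_)
        have hτ0 : ENNReal.ofReal t ≠ 0 := by simpa using ht.1
        have hτl : ENNReal.ofReal t ^ l ≠ ∞ :=
          ENNReal.rpow_ne_top_of_ne_zero hτ0 ENNReal.ofReal_ne_top
        simp only [hG]
        simp_rw [ENNReal.mul_rpow_of_nonneg _ _ hq0.le]
        rw [lintegral_const_mul' _ _ (ENNReal.mul_ne_top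
          (ENNReal.rpow_ne_top_of_nonneg hq0.le (ENNReal.inv_ne_top.2 hc0))
          (ENNReal.rpow_ne_top_of_nonneg hq0.le hτl)), mul_assoc]
        gcongr
        calc (ENNReal.ofReal t ^ l) ^ q * ∫⁻ x, ballAvg t F x ^ q ∂japMeasure n
            ≤ (ENNReal.ofReal t ^ l) ^ q * (D * ENNReal.ofReal t ^ (-(n * (q / a - 1)))) := by
              gcongr; exact h t ht
          _ = D := by
              rw [hlq, ← ENNReal.rpow_mul, mul_left_comm,
                ← ENNReal.rpow_add _ _ hτ0 ENNReal.ofReal_ne_top, add_neg_cancel,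
                ENNReal.rpow_zero, mul_one]
    _ < ∞ := by
        rw [lintegral_const, measure_univ, mul_one]
        exact ENNReal.mul_lt_top (ENNReal.rpow_lt_top_of_nonneg hq0.le (ENNReal.inv_ne_top.2 hc0))
          hD.lt_top

/-- The potential `∫₀¹ A_t F dt` is bounded if `F ∈ L^a` with `a > n`. -/
theorem exists_shiftAvg_coneProb_le {F : EuclideanSpace ℝ (Fin n) → ℝ≥0∞}
    (hF : Measurable F) {a : ℝ} (ha : 1 ≤ a) (hl : n / a < 1)
    (hN : ∫⁻ y, F y ^ a ∂japMeasure n ≠ ∞) :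
    ∃ M : ℝ≥0∞, M ≠ ∞ ∧ ∀ x, shiftAvg (coneProb n) F x ≤ M := by
  obtain ⟨C, hC, h⟩ := exists_ballAvg_rpow_le n
  set N := ∫⁻ y, F y ^ a ∂japMeasure n with hN'
  have ha0 : 0 < a := by linarith
  have hCN : (C * N) ^ (1 / a) ≠ ∞ :=
    ENNReal.rpow_ne_top_of_nonneg (by positivity) (ENNReal.mul_ne_top hC hN)
  refine ⟨(C * N) ^ (1 / a) * ENNReal.ofReal (1 - n / a)⁻¹,
    ENNReal.mul_ne_top hCN ENNReal.ofReal_ne_top, fun x => ?_⟩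
  -- The pointwise bound on the average of radius `t` grows like `t^{-n/a}`, which is integrable at
  -- zero.
  rw [shiftAvg_coneProb_eq hF, ← lintegral_ofReal_rpow hl, ← lintegral_const_mul' _ _ hCN]
  refine setLIntegral_mono' measurableSet_Ioc fun t ht => ?_
  calc ballAvg t F x = (ballAvg t F x ^ a) ^ (1 / a) := by
        rw [← ENNReal.rpow_mul, mul_one_div_cancel ha0.ne', ENNReal.rpow_one]
    _ ≤ (C * ENNReal.ofReal t ^ (-(n : ℝ)) * N) ^ (1 / a) := by
        gcongr; exact h F hF a ha t ht x
    _ = _ := by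
        rw [mul_right_comm C, ENNReal.mul_rpow_of_nonneg _ _ (by positivity), ← ENNReal.rpow_mul]
        congr 2; ring

/-- The averages and potentials over shifts map `L^a` to `L^{1/θ}` if `θ > 1 / a - 1 / n`. -/
theorem eLpNorm_shiftAvg_lt_top {F : EuclideanSpace ℝ (Fin n) → ℝ≥0∞}
    (hF : Measurable F) {a θ : ℝ} (ha : 1 ≤ a) (hθ0 : 0 ≤ θ) (hθ1 : θ ≤ 1 / a)
    (hθ : 1 / a - 1 / n < θ) (hN : ∫⁻ y, F y ^ a ∂japMeasure n ≠ ∞) :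
    eLpNorm (shiftAvg (ballProb n) F) (ENNReal.ofReal θ)⁻¹ (japMeasure n) < ∞ ∧
    eLpNorm (shiftAvg (coneProb n) F) (ENNReal.ofReal θ)⁻¹ (japMeasure n) < ∞ := by
  have ha0 : 0 < a := by linarith
  -- In dimension zero the convention `1 / 0 = 0` makes the two bounds on `θ` contradictory.
  have hn : 0 < (n : ℝ) := by
    rcases Nat.eq_zero_or_pos n with h | h
    · subst h; simp at hθ; simp at hθ1; linarith
    · exact_mod_cast h
  have h1 : (1 : ℝ) ∈ Ioc (0 : ℝ) 1 := ⟨one_pos, le_rfl⟩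
  have hbdd : ∀ {G : EuclideanSpace ℝ (Fin n) → ℝ≥0∞} {M : ℝ≥0∞}, M ≠ ∞ → (∀ x, G x ≤ M) →
      eLpNorm G ∞ (japMeasure n) < ∞ := fun hM h => by
    rw [eLpNorm_exponent_top]
    exact (eLpNormEssSup_le_of_ae_enorm_bound (Eventually.of_forall h)).trans_lt hM.lt_top
  -- `θ` is the reciprocal of the target exponent, so `θ = 0` is the `L^∞` case.
  rcases hθ0.eq_or_lt with h0 | h0
  · subst h0
    simp only [ENNReal.ofReal_zero, ENNReal.inv_zero]
    have hl : n / a < 1 := by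
      have h2 : 1 / a < 1 / n := by linarith
      rw [div_lt_one ha0]
      exact (one_div_lt_one_div ha0 hn).1 h2
    constructor
    · obtain ⟨C, hC, h⟩ := exists_ballAvg_rpow_le n
      refine hbdd (M := (C * ENNReal.ofReal 1 ^ (-(n : ℝ)) * ∫⁻ y, F y ^ a ∂japMeasure n) ^ (1 / a))
        ?_ fun x => ?_
      · refine ENNReal.rpow_ne_top_of_nonneg (by positivity) (ENNReal.mul_ne_top ?_ hN)
        simpa using hC
      · rw [shiftAvg_ballProb]
        calc ballAvg 1 F x = (ballAvg 1 F x ^ a) ^ (1 / a) := by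
              rw [← ENNReal.rpow_mul, mul_one_div_cancel ha0.ne', ENNReal.rpow_one]
          _ ≤ _ := by gcongr; exact h F hF a ha 1 h1 x
    · obtain ⟨M, hM, h⟩ := exists_shiftAvg_coneProb_le hF ha hl hN
      exact hbdd hM h
  · set q := 1 / θ with hq
    have hq0 : 0 < q := by positivity
    have hqθ : (ENNReal.ofReal θ)⁻¹ = ENNReal.ofReal q := by
      rw [hq, one_div, ENNReal.ofReal_inv_of_pos h0]
    have haq : a ≤ q := by
      rw [hq, le_div_iff₀ h0]
      rw [le_div_iff₀ ha0] at hθ1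
      linarith
    have hl : n * (1 / a - 1 / q) < 1 := by
      rw [hq, one_div_one_div]
      calc n * (1 / a - θ) < n * (1 / n) := by gcongr; linarith
        _ = 1 := mul_one_div_cancel hn.ne'
    have hconv : ∀ {G : EuclideanSpace ℝ (Fin n) → ℝ≥0∞}, ∫⁻ x, G x ^ q ∂japMeasure n < ∞ →
        eLpNorm G (ENNReal.ofReal q) (japMeasure n) < ∞ := fun h => by
      rw [eLpNorm_lt_top_iff_lintegral_rpow_enorm_lt_top (by simpa using hq0)
        ENNReal.ofReal_ne_top, ENNReal.toReal_ofReal hq0.le]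
      simpa using h
    rw [hqθ]
    refine ⟨hconv ?_, hconv (lintegral_shiftAvg_coneProb_rpow_lt_top hF ha haq hl hN)⟩
    obtain ⟨D, hD, h⟩ := exists_lintegral_ballAvg_rpow_le hF ha haq hN
    simp_rw [shiftAvg_ballProb]
    refine (h 1 h1).trans_lt ?_
    simpa using hD.lt_top

/-- Weights pass inside averages at the cost of a constant, because they are comparable at `x` and
at its shifts. This reduces the weighted embedding to unweighted bounds on averages. -/
theorem ofReal_jap_rpow_mul_shiftAvg_le {Q : Measure (EuclideanSpace ℝ (Fin n))}
    (hQ : ∀ᵐ w ∂Q, ‖w‖ ≤ 1) (F : EuclideanSpace ℝ (Fin n) → ℝ≥0∞) (s : ℝ)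
    (x : EuclideanSpace ℝ (Fin n)) :
    ENNReal.ofReal (jap x ^ s) * shiftAvg Q F x ≤ ENNReal.ofReal (2 ^ |s|) *
      shiftAvg Q (fun y => ENNReal.ofReal (jap y ^ s) * F y) x := by
  unfold shiftAvg
  rw [← lintegral_const_mul' _ _ ENNReal.ofReal_ne_top,
    ← lintegral_const_mul' _ _ ENNReal.ofReal_ne_top]
  refine lintegral_mono_ae (hQ.mono fun w hw => ?_)
  dsimp only
  rw [← mul_assoc, ← ENNReal.ofReal_mul (by positivity)]
  gcongr
  exact jap_rpow_le s hw x

theorem MeasureTheory.MemLp.lintegral_enorm_rpow_ne_top {α : Type*} [MeasurableSpace α]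
    {ν : Measure α} {f : α → ℝ} {a : ℝ} (ha : 0 < a) (hf : MemLp f (ENNReal.ofReal a) ν) :
    ∫⁻ x, ‖f x‖ₑ ^ a ∂ν ≠ ∞ := by
  have h := lintegral_rpow_enorm_lt_top_of_eLpNorm_lt_top (by simpa using ha)
    ENNReal.ofReal_ne_top hf.2
  rw [ENNReal.toReal_ofReal ha.le] at h
  exact h.ne

/-- The weighted Sobolev embedding for functions with one weak derivative. -/
theorem memLp_japMeasure_of_hasWeakDeriv {u : EuclideanSpace ℝ (Fin n) → ℝ}
    {v : Fin n → EuclideanSpace ℝ (Fin n) → ℝ} {a θ δ : ℝ} (ha : 1 ≤ a) (hθ0 : 0 ≤ θ)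
    (hθ1 : θ ≤ 1 / a) (hθ : 1 / a - 1 / n < θ) (hul : LocallyIntegrable u)
    (h : ∀ i, HasWeakDeriv univ [i] u (v i))
    (hu : MemLp (fun x => jap x ^ (-δ) * u x) (ENNReal.ofReal a) (japMeasure n))
    (hv : ∀ i, MemLp (fun x => jap x ^ (1 - δ) * v i x) (ENNReal.ofReal a) (japMeasure n)) :
    MemLp (fun x => jap x ^ (-δ) * u x) (ENNReal.ofReal θ)⁻¹ (japMeasure n) := by
  wlog hmeas : Measurable u ∧ ∀ i, Measurable (v i) generalizing u v
  · have hvl : ∀ i, AEStronglyMeasurable (v i) volume := fun i =>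
      (locallyIntegrableOn_univ.1 (h i).2.1).aestronglyMeasurable
    have e1 := hul.aestronglyMeasurable.ae_eq_mk
    have e2 := fun i => (hvl i).ae_eq_mk
    have e1' : (fun x => jap x ^ (-δ) * u x) =ᵐ[japMeasure n]
        fun x => jap x ^ (-δ) * hul.aestronglyMeasurable.mk u x := by
      filter_upwards [japMeasure_absolutelyContinuous.ae_eq e1] with x hx
      rw [hx]
    refine (memLp_congr_ae e1').2 (this (v := fun i => (hvl i).mk (v i)) ?_ (fun i => ?_)
      ((memLp_congr_ae e1').1 hu) (fun i => (memLp_congr_ae ?_).1 (hv i))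
      ⟨hul.aestronglyMeasurable.stronglyMeasurable_mk.measurable,
        fun i => (hvl i).stronglyMeasurable_mk.measurable⟩)
    · exact hul.congr e1
    · exact (h i).congr_ae isOpen_univ (by simpa using e1) (by simpa using e2 i)
    · filter_upwards [japMeasure_absolutelyContinuous.ae_eq (e2 i)] with x hx
      rw [hx]
  obtain ⟨hum, hvm⟩ := hmeas
  have ha0 : 0 < a := by linarith
  set F₁ : EuclideanSpace ℝ (Fin n) → ℝ≥0∞ := fun y => ENNReal.ofReal (jap y ^ (-δ)) * ‖u y‖ₑ
    with hF₁
  set F₂ : EuclideanSpace ℝ (Fin n) → ℝ≥0∞ := fun y =>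
    ENNReal.ofReal (jap y ^ (1 - δ)) * ∑ i, ‖v i y‖ₑ with hF₂
  have hF₁m : Measurable F₁ := (measurable_japWeight _).mul hum.enorm
  have hF₂m : Measurable F₂ := (measurable_japWeight _).mul
    (Finset.measurable_sum _ fun i _ => (hvm i).enorm)
  have henorm : ∀ (s : ℝ) (f : EuclideanSpace ℝ (Fin n) → ℝ) (y : EuclideanSpace ℝ (Fin n)),
      ENNReal.ofReal (jap y ^ s) * ‖f y‖ₑ = ‖jap y ^ s * f y‖ₑ := fun s f y => by
    rw [enorm_mul, Real.enorm_eq_ofReal (Real.rpow_nonneg (jap_pos y).le _)]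
  have hN₁ : ∫⁻ y, F₁ y ^ a ∂japMeasure n ≠ ∞ := by
    simp_rw [hF₁, henorm]
    exact hu.lintegral_enorm_rpow_ne_top ha0
  have hN₂ : ∫⁻ y, F₂ y ^ a ∂japMeasure n ≠ ∞ := by
    have hsum : MemLp (fun x => ∑ i, |jap x ^ (1 - δ) * v i x|) (ENNReal.ofReal a)
        (japMeasure n) := memLp_finsetSum _ fun i _ => (hv i).abs
    have := hsum.lintegral_enorm_rpow_ne_top ha0
    convert this using 4 with y
    rw [hF₂, Real.enorm_eq_ofReal (Finset.sum_nonneg fun i _ => abs_nonneg _),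
      ENNReal.ofReal_sum_of_nonneg fun i _ => abs_nonneg _]
    dsimp only
    rw [Finset.mul_sum]
    refine Finset.sum_congr rfl fun i _ => ?_
    rw [henorm, Real.enorm_eq_ofReal_abs]
  obtain ⟨b1, -⟩ := eLpNorm_shiftAvg_lt_top hF₁m ha hθ0 hθ1 hθ hN₁
  obtain ⟨-, b2⟩ := eLpNorm_shiftAvg_lt_top hF₂m ha hθ0 hθ1 hθ hN₂
  refine ⟨hu.1, ?_⟩
  set c₁ := ENNReal.ofReal (2 ^ |-δ|) with hc₁
  set c₂ := ENNReal.ofReal (2 ^ |1 - δ|) with hc₂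
  have hq1 : 1 ≤ (ENNReal.ofReal θ)⁻¹ := by
    rw [ENNReal.one_le_inv]
    refine ENNReal.ofReal_le_one.2 (hθ1.trans ?_)
    rw [div_le_one ha0]; exact ha
  have hbound : ∀ᵐ x ∂japMeasure n, ‖jap x ^ (-δ) * u x‖ₑ ≤
      ‖(c₁ • shiftAvg (ballProb n) F₁ + c₂ • shiftAvg (coneProb n) F₂) x‖ₑ := by
    rw [ae_japMeasure]
    filter_upwards [ae_enorm_le_shiftAvg hum hvm h hul] with x hx
    rw [← henorm (-δ) u x]
    refine (mul_le_mul_right hx _).trans ?_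
    -- The factor `⟨x⟩` of the potential estimate turns `⟨x⟩^{-δ}` into `⟨x⟩^{1-δ}`, precisely the
    -- weight carried by the derivative.
    rw [mul_add, ← mul_assoc, ← ENNReal.ofReal_mul (Real.rpow_nonneg (jap_pos x).le _),
      show jap x ^ (-δ) * jap x = jap x ^ (1 - δ) by
        rw [sub_eq_neg_add, Real.rpow_add (jap_pos x), Real.rpow_one]]
    exact add_le_add (ofReal_jap_rpow_mul_shiftAvg_le ae_ballProb _ _ x)
      (ofReal_jap_rpow_mul_shiftAvg_le ae_coneProb _ _ x)
  refine (eLpNorm_mono_enorm_ae hbound).trans_lt ?_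
  have m1 : Measurable (shiftAvg (ballProb n) F₁) := measurable_shiftAvg _ hF₁m
  have m2 : Measurable (shiftAvg (coneProb n) F₂) := measurable_shiftAvg _ hF₂m
  have hsmul : ∀ {c : ℝ≥0∞} {G : EuclideanSpace ℝ (Fin n) → ℝ≥0∞}, c ≠ ∞ →
      eLpNorm G (ENNReal.ofReal θ)⁻¹ (japMeasure n) < ∞ →
      eLpNorm (c • G) (ENNReal.ofReal θ)⁻¹ (japMeasure n) < ∞ := fun {c G} hc hG => by
    lift c to NNReal using hc
    refine (eLpNorm_le_nnreal_smul_eLpNorm_of_ae_le_mul' (f := (c : ℝ≥0∞) • G) (g := G) (c := c)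
      (Eventually.of_forall fun x => ?_) _).trans_lt ?_
    · simp
    · rw [ENNReal.smul_def, smul_eq_mul]
      exact ENNReal.mul_lt_top ENNReal.coe_lt_top hG
  refine (eLpNorm_add_le (m1.const_smul c₁).aestronglyMeasurable
    (m2.const_smul c₂).aestronglyMeasurable hq1).trans_lt ?_
  exact ENNReal.add_lt_top.2 ⟨hsmul ENNReal.ofReal_ne_top b1, hsmul ENNReal.ofReal_ne_top b2⟩

end EmbeddingStep

/-! ### Recursive description of Sobolev spaces -/

section SobolevChain

variable {n : ℕ} {Ω : Set (EuclideanSpace ℝ (Fin n))}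

/-- Functions with weak derivatives of order at most `m`, those of order `i` satisfying
`P (j + i)`. -/
def SobolevChain (Ω : Set (EuclideanSpace ℝ (Fin n)))
    (P : ℕ → (EuclideanSpace ℝ (Fin n) → ℝ) → Prop) :
    ℕ → ℕ → (EuclideanSpace ℝ (Fin n) → ℝ) → Prop
  | 0, j, u => P j u
  | m + 1, j, u => P j u ∧ ∀ i, ∃ v, HasWeakDeriv Ω [i] u v ∧ SobolevChain Ω P m (j + 1) v

theorem SobolevChain.prop {P : ℕ → (EuclideanSpace ℝ (Fin n) → ℝ) → Prop} {m j : ℕ} {u}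
    (h : SobolevChain Ω P m j u) : P j u := by
  cases m with
  | zero => exact h
  | succ m => exact h.1

theorem SobolevChain.of_succ {P : ℕ → (EuclideanSpace ℝ (Fin n) → ℝ) → Prop} {m j : ℕ} {u}
    (h : SobolevChain Ω P (m + 1) j u) : SobolevChain Ω P m j u := by
  induction m generalizing j u with
  | zero => exact h.1
  | succ m ih =>
    refine ⟨h.1, fun i => ?_⟩
    obtain ⟨v, hv, hv'⟩ := h.2 i
    exact ⟨v, hv, ih hv'⟩

/-- Derivatives are peeled off the front of the list. Invariance of `P` under a.e. equality is
needed because the empty list provides only an a.e. equal representative of `u`. -/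
theorem sobolevChain_iff (hΩ : IsOpen Ω) {P : ℕ → (EuclideanSpace ℝ (Fin n) → ℝ) → Prop}
    (hP : ∀ j u, P j u → LocallyIntegrableOn u Ω)
    (hcongr : ∀ j u v, u =ᵐ[volume.restrict Ω] v → P j v → P j u) (m j : ℕ)
    (u : EuclideanSpace ℝ (Fin n) → ℝ) :
    SobolevChain Ω P m j u ↔
      ∀ L : List (Fin n), L.length ≤ m → ∃ v, HasWeakDeriv Ω L u v ∧ P (j + L.length) v := by
  induction m generalizing j u with
  | zero =>
    constructor
    · intro h L hL
      obtain rfl : L = [] := List.length_eq_zero_iff.1 (Nat.le_zero.1 hL)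
      exact ⟨u, hasWeakDeriv_nil (hP j u h), h⟩
    · intro h
      obtain ⟨v, hv, hv'⟩ := h [] le_rfl
      exact hcongr j u v (hv.ae_eq_of_nil hΩ) hv'
  | succ m ih =>
    constructor
    · rintro ⟨h1, h2⟩ L hL
      cases L with
      | nil => exact ⟨u, hasWeakDeriv_nil (hP j u h1), h1⟩
      | cons i L =>
        obtain ⟨v, hv, hv'⟩ := h2 i
        obtain ⟨w, hw, hw'⟩ := (ih (j + 1) v).1 hv' L (by simpa using hL)
        refine ⟨w, hv.cons hw, ?_⟩
        rwa [List.length_cons, Nat.add_comm L.length 1, ← Nat.add_assoc]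
    · intro h
      refine ⟨?_, fun i => ?_⟩
      · obtain ⟨v, hv, hv'⟩ := h [] (Nat.zero_le _)
        exact hcongr j u v (hv.ae_eq_of_nil hΩ) hv'
      · obtain ⟨v, hv, -⟩ := h [i] (by simp)
        refine ⟨v, hv, (ih (j + 1) v).2 fun L hL => ?_⟩
        obtain ⟨w, hw, hw'⟩ := h (i :: L) (by simpa using hL)
        refine ⟨w, hv.of_cons hw, ?_⟩
        rwa [List.length_cons, Nat.add_comm L.length 1, ← Nat.add_assoc] at hw'

end SobolevChain

/-! ### Weighted Sobolev embedding and the multiplication theorem -/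

section WeightedClasses

variable {n : ℕ}

theorem memLp_restrict_of_memLp_japMeasure {f : EuclideanSpace ℝ (Fin n) → ℝ} {q : ℝ≥0∞}
    (hf : MemLp f q (japMeasure n)) {K : Set (EuclideanSpace ℝ (Fin n))} (hK : IsCompact K) :
    MemLp f q (volume.restrict K) := by
  obtain ⟨C, hC⟩ := hK.exists_bound_of_continuousOn (continuous_jap_rpow (n := n) n).continuousOn
  refine hf.of_measure_le_smul (c := ENNReal.ofReal C) ENNReal.ofReal_ne_top ?_
  refine Measure.le_iff.2 fun S hS => ?_
  rw [Measure.restrict_apply hS, Measure.smul_apply, smul_eq_mul]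
  calc volume (S ∩ K) = ∫⁻ _ in S ∩ K, 1 := by simp
    _ ≤ ∫⁻ x in S ∩ K, ENNReal.ofReal C * ENNReal.ofReal (jap x ^ (-(n : ℝ))) := by
        refine setLIntegral_mono' (hS.inter hK.measurableSet) fun x hx => ?_
        have h1 := (Real.le_norm_self _).trans (hC x hx.2)
        have h2 : 0 < jap x ^ (-(n : ℝ)) := Real.rpow_pos_of_pos (jap_pos x) _
        have h3 : 1 ≤ C * jap x ^ (-(n : ℝ)) := by
          calc (1 : ℝ) = jap x ^ (n : ℝ) * jap x ^ (-(n : ℝ)) := by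
                rw [← Real.rpow_add (jap_pos x)]; simp
            _ ≤ _ := by gcongr
        rw [← ENNReal.ofReal_mul' h2.le]
        simpa using ENNReal.ofReal_le_ofReal h3
    _ = ENNReal.ofReal C * ∫⁻ x in S ∩ K, ENNReal.ofReal (jap x ^ (-(n : ℝ))) :=
        lintegral_const_mul' _ _ ENNReal.ofReal_ne_top
    _ ≤ ENNReal.ofReal C * ∫⁻ x in S, ENNReal.ofReal (jap x ^ (-(n : ℝ))) := by
        gcongr
        exact inter_subset_left
    _ = _ := by rw [japMeasure, withDensity_apply _ hS]

theorem jap_rpow_mul_neg (s : ℝ) (x : EuclideanSpace ℝ (Fin n)) (y : ℝ) :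
    jap x ^ s * (jap x ^ (-s) * y) = y := by
  rw [← mul_assoc, ← Real.rpow_add (jap_pos x)]; simp

theorem memLp_restrict_of_weighted {f : EuclideanSpace ℝ (Fin n) → ℝ} {q : ℝ≥0∞} {σ : ℝ}
    (hf : MemLp (fun x => jap x ^ (-σ) * f x) q (japMeasure n))
    {K : Set (EuclideanSpace ℝ (Fin n))} (hK : IsCompact K) : MemLp f q (volume.restrict K) := by
  have h1 := memLp_restrict_of_memLp_japMeasure hf hK
  obtain ⟨C, hC⟩ := hK.exists_bound_of_continuousOn (continuous_jap_rpow (n := n) σ).continuousOn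
  have h2 : MemLp (fun x : EuclideanSpace ℝ (Fin n) => jap x ^ σ) ⊤ (volume.restrict K) :=
    memLp_top_of_bound (continuous_jap_rpow σ).aestronglyMeasurable C
      ((ae_restrict_iff' hK.measurableSet).2 (Eventually.of_forall hC))
  have h3 := h1.mul' h2 (r := q)
  simpa only [jap_rpow_mul_neg] using h3

theorem aestronglyMeasurable_of_weighted {f : EuclideanSpace ℝ (Fin n) → ℝ} {σ : ℝ}
    (hf : AEStronglyMeasurable (fun x => jap x ^ (-σ) * f x) (japMeasure n)) :
    AEStronglyMeasurable f volume := by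
  have h1 := (hf.mono_ac absolutelyContinuous_japMeasure)
  have h2 := (continuous_jap_rpow (n := n) σ).aestronglyMeasurable (μ := volume) |>.mul h1
  refine h2.congr (Eventually.of_forall fun x => ?_)
  exact jap_rpow_mul_neg σ x (f x)

/-- The exponents `θ = 1 / q` reached by the Sobolev embedding of functions with `s` derivatives
in `L^p`. -/
def SobolevExponent (n : ℕ) (p s θ : ℝ) : Prop :=
  0 ≤ θ ∧ θ ≤ 1 / p ∧ (θ = 1 / p ∨ 1 / p - s / n < θ)

/-- `⟨x⟩^{-σ} v ∈ L^{1/θ}(⟨x⟩⁻ⁿ dx)` for all exponents reached by the Sobolev embedding of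
functions with `s` derivatives in `L^p`. -/
def SobolevIntegrable (p s σ : ℝ) (v : EuclideanSpace ℝ (Fin n) → ℝ) : Prop :=
  ∀ θ, SobolevExponent n p s θ →
    MemLp (fun x => jap x ^ (-σ) * v x) (ENNReal.ofReal θ)⁻¹ (japMeasure n)

variable {p : ℝ}

theorem sobolevExponent_self (hp : 0 < p) (s : ℝ) : SobolevExponent n p s (1 / p) :=
  ⟨by positivity, le_rfl, Or.inl rfl⟩

theorem inv_ofReal_one_div (hp : 0 < p) : (ENNReal.ofReal (1 / p))⁻¹ = ENNReal.ofReal p := by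
  rw [one_div, ENNReal.ofReal_inv_of_pos hp, inv_inv]

theorem SobolevIntegrable.memLp (hp : 0 < p) {s σ : ℝ} {v : EuclideanSpace ℝ (Fin n) → ℝ}
    (h : SobolevIntegrable p s σ v) :
    MemLp (fun x => jap x ^ (-σ) * v x) (ENNReal.ofReal p) (japMeasure n) := by
  have := h _ (sobolevExponent_self hp s)
  rwa [inv_ofReal_one_div hp] at this

theorem locallyIntegrable_of_weighted (hp : 1 < p) {σ : ℝ} {v : EuclideanSpace ℝ (Fin n) → ℝ}
    (h : MemLp (fun x => jap x ^ (-σ) * v x) (ENNReal.ofReal p) (japMeasure n)) :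
    LocallyIntegrable v := by
  refine locallyIntegrableOn_univ.1 ((locallyIntegrableOn_iff_isCompact isOpen_univ).2
    fun K _ hK => ?_)
  have : IsFiniteMeasure (volume.restrict K) := ⟨by simpa using hK.measure_lt_top⟩
  exact (memLp_restrict_of_weighted h hK).integrable (by simpa using hp.le)

theorem SobolevIntegrable.locallyIntegrable (hp : 1 < p) {s σ : ℝ}
    {v : EuclideanSpace ℝ (Fin n) → ℝ} (h : SobolevIntegrable p s σ v) : LocallyIntegrable v :=
  locallyIntegrable_of_weighted hp (h.memLp (by linarith))

theorem SobolevExponent.mono {s s' θ : ℝ} (h : SobolevExponent n p s' θ) (hs : s' ≤ s) :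
    SobolevExponent n p s θ := by
  refine ⟨h.1, h.2.1, h.2.2.imp id fun h => lt_of_le_of_lt ?_ h⟩
  have : s' / n ≤ s / n := by gcongr
  linarith

theorem MeasureTheory.MemLp.weight_mono {q : ℝ≥0∞} {σ τ : ℝ} {v : EuclideanSpace ℝ (Fin n) → ℝ}
    (h : MemLp (fun x => jap x ^ (-σ) * v x) q (japMeasure n)) (hσ : σ ≤ τ) :
    MemLp (fun x => jap x ^ (-τ) * v x) q (japMeasure n) := by
  refine h.of_le ?_ (Eventually.of_forall fun x => ?_)
  · exact ((continuous_jap_rpow _).aestronglyMeasurable.mul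
      ((aestronglyMeasurable_of_weighted h.1).mono_ac japMeasure_absolutelyContinuous))
  · rw [norm_mul, norm_mul, Real.norm_of_nonneg (Real.rpow_nonneg (jap_pos x).le _),
      Real.norm_of_nonneg (Real.rpow_nonneg (jap_pos x).le _)]
    gcongr
    exact one_le_jap x

theorem SobolevIntegrable.mono {s s' σ τ : ℝ} {v : EuclideanSpace ℝ (Fin n) → ℝ}
    (h : SobolevIntegrable p s σ v) (hs : s' ≤ s) (hσ : σ ≤ τ) : SobolevIntegrable p s' τ v :=
  fun θ hθ => (h θ (hθ.mono hs)).weight_mono hσ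

theorem SobolevIntegrable.add {s σ : ℝ} {u v : EuclideanSpace ℝ (Fin n) → ℝ}
    (hu : SobolevIntegrable p s σ u) (hv : SobolevIntegrable p s σ v) :
    SobolevIntegrable p s σ fun x => u x + v x := fun θ hθ => by
  refine ((hu θ hθ).add (hv θ hθ)).ae_eq (Eventually.of_forall fun x => ?_)
  simp [mul_add]

theorem SobolevIntegrable.const_mul {s σ : ℝ} {u : EuclideanSpace ℝ (Fin n) → ℝ}
    (hu : SobolevIntegrable p s σ u) (c : ℝ) : SobolevIntegrable p s σ fun x => c * u x :=
  fun θ hθ => by simpa only [mul_left_comm c] using (hu θ hθ).const_mul c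

theorem weighted_congr_ae {σ : ℝ} {u v : EuclideanSpace ℝ (Fin n) → ℝ} (h : u =ᵐ[volume] v) :
    (fun x => jap x ^ (-σ) * u x) =ᵐ[japMeasure n] fun x => jap x ^ (-σ) * v x := by
  filter_upwards [japMeasure_absolutelyContinuous.ae_eq h] with x hx
  rw [hx]

theorem SobolevIntegrable.congr_ae {s σ : ℝ} {u v : EuclideanSpace ℝ (Fin n) → ℝ}
    (hu : SobolevIntegrable p s σ u) (h : u =ᵐ[volume] v) : SobolevIntegrable p s σ v :=
  fun θ hθ => (memLp_congr_ae (weighted_congr_ae h)).1 (hu θ hθ)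

/-- Exponents for Hölder's inequality between the Sobolev scales. -/
theorem SobolevExponent.exists_split (hn : 0 < n) {a b c θ : ℝ} (hc : 0 ≤ c) (hca : c ≤ a)
    (hcb : c ≤ b) (habc : n / p < a + b - c) (hθ : SobolevExponent n p c θ) :
    ∃ θ₁ θ₂, SobolevExponent n p a θ₁ ∧ SobolevExponent n p b θ₂ ∧ θ₁ + θ₂ = θ := by
  obtain ⟨h0, h1, h2⟩ := hθ
  have hn' : (0 : ℝ) < n := by exact_mod_cast hn
  have hA : c / n ≤ a / n := by gcongr
  have hB : c / n ≤ b / n := by gcongr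
  have hC : 0 ≤ c / n := by positivity
  have hab : 1 / p + c / n < a / n + b / n := by
    have h3 : 1 / p = n / p / n := by field_simp
    have h4 : (a + b - c) / n = a / n + b / n - c / n := by ring
    have h5 : n / p / n < (a + b - c) / n := by gcongr
    linarith
  have hθ' : 1 / p - a / n + (1 / p - b / n) < θ := by
    rcases h2 with h2 | h2 <;> linarith
  -- If one factor embeds in `L^∞` it takes the exponent zero and the other takes `θ`. Otherwise
  -- both critical exponents are nonnegative with sum below `θ`, and each receives half of the slack
  -- `2d`.
  rcases lt_or_ge (1 / p - a / n) 0 with hA0 | hA0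
  · refine ⟨0, θ, ⟨le_rfl, h0.trans h1, Or.inr hA0⟩, ⟨h0, h1, h2.imp id fun h => ?_⟩, zero_add _⟩
    linarith
  rcases lt_or_ge (1 / p - b / n) 0 with hB0 | hB0
  · refine ⟨θ, 0, ⟨h0, h1, h2.imp id fun h => ?_⟩, ⟨le_rfl, h0.trans h1, Or.inr hB0⟩, add_zero _⟩
    linarith
  set d := (θ - (1 / p - a / n + (1 / p - b / n))) / 2 with hd
  have hd0 : 0 < d := by rw [hd]; linarith
  exact ⟨1 / p - a / n + d, 1 / p - b / n + d,
    ⟨by linarith, by linarith, Or.inr (by linarith)⟩,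
    ⟨by linarith, by linarith, Or.inr (by linarith)⟩, by rw [hd]; ring⟩

theorem holderTriple_inv_ofReal {θ₁ θ₂ : ℝ} (h1 : 0 ≤ θ₁) (h2 : 0 ≤ θ₂) :
    ENNReal.HolderTriple (ENNReal.ofReal θ₁)⁻¹ (ENNReal.ofReal θ₂)⁻¹
      (ENNReal.ofReal (θ₁ + θ₂))⁻¹ :=
  ⟨by rw [inv_inv, inv_inv, inv_inv, ENNReal.ofReal_add h1 h2]⟩

/-- Hölder with the split exponents. The measure `⟨x⟩^{-n} dx` does not depend on the weights, so
these simply add. -/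
theorem SobolevIntegrable.mul (hn : 0 < n) {a b c σ τ : ℝ} (hc : 0 ≤ c) (hca : c ≤ a)
    (hcb : c ≤ b) (habc : n / p < a + b - c) {u v : EuclideanSpace ℝ (Fin n) → ℝ}
    (hu : SobolevIntegrable p a σ u) (hv : SobolevIntegrable p b τ v) :
    SobolevIntegrable p c (σ + τ) fun x => u x * v x := fun θ hθ => by
  obtain ⟨θ₁, θ₂, h1, h2, rfl⟩ := hθ.exists_split hn hc hca hcb habc
  have := holderTriple_inv_ofReal h1.1 h2.1
  refine ((hv θ₂ h2).mul' (hu θ₁ h1) (r := (ENNReal.ofReal (θ₁ + θ₂))⁻¹)).ae_eq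
    (Eventually.of_forall fun x => ?_)
  dsimp only
  rw [neg_add, Real.rpow_add (jap_pos x)]
  ring

/-- Pair `1/θ₁` with its conjugate `1/(1 - θ₁)`, finite since `θ₁ ≤ 1/p < 1`. On compact sets the
exponent `1/θ₂` is large enough, because `θ₁ + θ₂ = 1/p < 1`. -/
theorem SobolevIntegrable.locHolder (hp : 1 < p) (hn : 0 < n) {a b c σ τ : ℝ} (hc : 0 ≤ c)
    (hca : c ≤ a) (hcb : c ≤ b) (habc : n / p < a + b - c) {u v : EuclideanSpace ℝ (Fin n) → ℝ}
    (hu : SobolevIntegrable p a σ u) (hv : SobolevIntegrable p b τ v) : LocHolder u v := by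
  have hp0 : 0 < p := by linarith
  obtain ⟨θ₁, θ₂, h1, h2, h12⟩ :=
    (sobolevExponent_self (n := n) hp0 c).exists_split hn hc hca hcb habc
  have hp1 : 1 / p < 1 := by rw [div_lt_one hp0]; exact hp
  have hθ : 0 < 1 - θ₁ := by linarith [h1.2.1]
  refine ⟨1 / (1 - θ₁), (ENNReal.ofReal θ₁)⁻¹, ?_, ⟨?_⟩, fun K hK => ?_, fun K hK =>
    memLp_restrict_of_weighted (hu θ₁ h1) hK⟩
  · rw [le_div_iff₀ hθ]; linarith [h1.1]
  · rw [inv_inv, one_div, ENNReal.ofReal_inv_of_pos hθ, inv_inv, ← ENNReal.ofReal_add hθ.le h1.1]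
    simp
  · have : IsFiniteMeasure (volume.restrict K) := ⟨by simpa using hK.measure_lt_top⟩
    refine (memLp_restrict_of_weighted (hv θ₂ h2) hK).mono_exponent ?_
    rw [one_div, ENNReal.ofReal_inv_of_pos hθ, ENNReal.inv_le_inv]
    exact ENNReal.ofReal_le_ofReal (by linarith)

/-- Functions whose weak derivatives of order `j ≤ l` satisfy `SobolevIntegrable (s - j) (σ - j)`. -/
def MemSobolevScale (p : ℝ) : ℕ → ℝ → ℝ → (EuclideanSpace ℝ (Fin n) → ℝ) → Prop
  | 0, s, σ, u => SobolevIntegrable p s σ u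
  | l + 1, s, σ, u => SobolevIntegrable p s σ u ∧
      ∀ i, ∃ v, HasWeakDeriv univ [i] u v ∧ MemSobolevScale p l (s - 1) (σ - 1) v

namespace MemSobolevScale

variable {l : ℕ} {s σ τ : ℝ} {u v : EuclideanSpace ℝ (Fin n) → ℝ}

theorem sobolevIntegrable (h : MemSobolevScale p l s σ u) : SobolevIntegrable p s σ u := by
  cases l with
  | zero => exact h
  | succ l => exact h.1

theorem of_succ (h : MemSobolevScale p (l + 1) s σ u) : MemSobolevScale p l s σ u := by
  induction l generalizing s σ u with
  | zero => exact h.1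
  | succ l ih =>
    refine ⟨h.1, fun i => ?_⟩
    obtain ⟨v, hv, hv'⟩ := h.2 i
    exact ⟨v, hv, ih hv'⟩

theorem of_le {l' : ℕ} (h : MemSobolevScale p l s σ u) (hl : l' ≤ l) :
    MemSobolevScale p l' s σ u := by
  induction l with
  | zero => rwa [Nat.le_zero.1 hl]
  | succ l ih =>
    rcases Nat.le_succ_iff.1 hl with h1 | h1
    · exact ih h.of_succ h1
    · rwa [h1]

theorem mono {s' : ℝ} (h : MemSobolevScale p l s σ u) (hs : s' ≤ s) (hσ : σ ≤ τ) :
    MemSobolevScale p l s' τ u := by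
  induction l generalizing s s' σ τ u with
  | zero => exact SobolevIntegrable.mono h hs hσ
  | succ l ih =>
    refine ⟨h.1.mono hs hσ, fun i => ?_⟩
    obtain ⟨v, hv, hv'⟩ := h.2 i
    exact ⟨v, hv, ih hv' (by linarith) (by linarith)⟩

theorem add (hu : MemSobolevScale p l s σ u) (hv : MemSobolevScale p l s σ v) :
    MemSobolevScale p l s σ fun x => u x + v x := by
  induction l generalizing s σ u v with
  | zero => exact SobolevIntegrable.add hu hv
  | succ l ih =>
    refine ⟨hu.1.add hv.1, fun i => ?_⟩
    obtain ⟨u', hu1, hu2⟩ := hu.2 i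
    obtain ⟨v', hv1, hv2⟩ := hv.2 i
    exact ⟨_, hu1.add hv1, ih hu2 hv2⟩

theorem const_mul (hu : MemSobolevScale p l s σ u) (c : ℝ) :
    MemSobolevScale p l s σ fun x => c * u x := by
  induction l generalizing s σ u with
  | zero => exact SobolevIntegrable.const_mul hu c
  | succ l ih =>
    refine ⟨hu.1.const_mul c, fun i => ?_⟩
    obtain ⟨u', hu1, hu2⟩ := hu.2 i
    exact ⟨_, hu1.const_mul c, ih hu2⟩

theorem sub (hu : MemSobolevScale p l s σ u) (hv : MemSobolevScale p l s σ v) :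
    MemSobolevScale p l s σ fun x => u x - v x := by
  convert hu.add (hv.const_mul (-1)) using 2
  ring

theorem congr_ae (hu : MemSobolevScale p l s σ u) (h : u =ᵐ[volume] v) :
    MemSobolevScale p l s σ v := by
  cases l with
  | zero => exact SobolevIntegrable.congr_ae hu h
  | succ l =>
    refine ⟨hu.1.congr_ae h, fun i => ?_⟩
    obtain ⟨u', hu1, hu2⟩ := hu.2 i
    exact ⟨u', hu1.congr_ae isOpen_univ (by simpa using h) (ae_eq_refl _), hu2⟩

theorem congr (hu : MemSobolevScale p l s σ u) (h : ∀ x, u x = v x) :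
    MemSobolevScale p l s σ v := by
  rwa [show v = u from funext fun x => (h x).symm]

theorem zero : MemSobolevScale p l s σ fun _ : EuclideanSpace ℝ (Fin n) => (0 : ℝ) := by
  induction l generalizing s σ with
  | zero =>
    intro θ _
    simp
  | succ l ih =>
    refine ⟨fun θ _ => by simp, fun i => ⟨_, hasWeakDeriv_zero, ih⟩⟩

theorem sum {ι : Type*} (t : Finset ι) {f : ι → EuclideanSpace ℝ (Fin n) → ℝ}
    (h : ∀ j ∈ t, MemSobolevScale p l s σ (f j)) :
    MemSobolevScale p l s σ fun x => ∑ j ∈ t, f j x := by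
  classical
  induction t using Finset.induction_on with
  | empty => simpa using zero
  | insert a t ha ih =>
    simp_rw [Finset.sum_insert ha]
    exact (h a (by simp)).add (ih fun j hj => h j (by simp [hj]))

/-- The multiplication theorem. -/
theorem mul (hp : 1 < p) (hn : 0 < n) {a b c : ℝ} (hc : (l : ℝ) ≤ c) (hca : c ≤ a) (hcb : c ≤ b)
    (habc : n / p < a + b - c) (hu : MemSobolevScale p l a σ u) (hv : MemSobolevScale p l b τ v) :
    MemSobolevScale p l c (σ + τ) fun x => u x * v x := by
  induction l generalizing a b c σ τ u v with
  | zero => exact SobolevIntegrable.mul hn (by simpa using hc) hca hcb habc hu hv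
  | succ l ih =>
    push_cast at hc
    have hl : (0 : ℝ) ≤ l := Nat.cast_nonneg l
    refine ⟨hu.1.mul hn (by linarith) hca hcb habc hv.1, fun i => ?_⟩
    obtain ⟨u', hu1, hu2⟩ := hu.2 i
    obtain ⟨v', hv1, hv2⟩ := hv.2 i
    have h := hu1.mul hv1 (hu.1.locHolder hp hn (c := c) (by linarith) hca hcb habc hv.1)
      (hu2.sobolevIntegrable.locHolder hp hn (c := c - 1) (by linarith) (by linarith)
        (by linarith) (by linarith) hv.1)
      (hu.1.locHolder hp hn (c := c - 1) (by linarith) (by linarith)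
        (by linarith) (by linarith) hv2.sobolevIntegrable)
    have e : (fun x => v x * u x) = fun x => u x * v x := by ext x; ring
    rw [e] at h
    -- Differentiating one factor lowers that factor's index and the target index `c` by one each,
    -- so the condition on `a + b - c` is unchanged.
    refine ⟨_, h, MemSobolevScale.add ?_ ?_⟩
    · refine ((ih (c := c - 1) (by linarith) (by linarith) (by linarith) (by linarith) hu2
        hv.of_succ).congr fun x => mul_comm _ _).mono le_rfl (by linarith)
    · refine ((ih (c := c - 1) (by linarith) (by linarith) (by linarith) (by linarith) hu.of_succ
        hv2).congr fun x => mul_comm _ _).mono le_rfl (by linarith)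

end MemSobolevScale

/-- The weighted Sobolev embedding. -/
theorem SobolevChain.memSobolevScale (hp : 1 < p) (hn : 0 < n) {δ : ℝ} {m j : ℕ}
    {u : EuclideanSpace ℝ (Fin n) → ℝ}
    (h : SobolevChain univ (fun (j : ℕ) (v : EuclideanSpace ℝ (Fin n) → ℝ) =>
      MemLp (fun x => jap x ^ (-(δ - j)) * v x) (ENNReal.ofReal p) (japMeasure n)) m j u) :
    MemSobolevScale p m m (δ - j) u := by
  have hp0 : 0 < p := by linarith
  have hn' : (0 : ℝ) < n := by exact_mod_cast hn
  induction m generalizing j u with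
  | zero =>
    intro θ hθ
    obtain rfl : θ = 1 / p := by
      rcases hθ.2.2 with h | h
      · exact h
      · refine le_antisymm hθ.2.1 (le_of_lt (by simpa using h))
    rw [inv_ofReal_one_div hp0]
    exact h
  | succ m ih =>
    have hu := ih h.of_succ
    have hv : ∀ i, ∃ v, HasWeakDeriv univ [i] u v ∧ MemSobolevScale p m m (δ - j - 1) v := by
      intro i
      obtain ⟨v, hv, hv'⟩ := h.2 i
      refine ⟨v, hv, (ih hv').mono le_rfl (by push_cast; linarith)⟩
    refine ⟨?_, fun i => ?_⟩
    swap
    · obtain ⟨v, hv, hv'⟩ := hv i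
      exact ⟨v, hv, hv'.mono (by push_cast; linarith) le_rfl⟩
    choose v hv hv' using hv
    intro θ hθ
    by_cases hθp : θ = 1 / p
    · rw [hθp, inv_ofReal_one_div hp0]
      exact h.prop
    obtain ⟨h0, h1, h2⟩ := hθ
    replace h2 := h2.resolve_left hθp
    replace h1 := lt_of_le_of_ne h1 hθp
    have hn1 : 0 < 1 / (n : ℝ) := by positivity
    have hmn : ((m + 1 : ℕ) : ℝ) / n = m / n + 1 / n := by push_cast; ring
    rw [hmn] at h2
    -- One embedding step gains strictly less than `1/n`. So look for an exponent `θ + t` with `t <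
    -- 1/n` that `m` derivatives already reach; the minimum with `1/p` below keeps it in range. The
    -- inductive hypothesis applies there to `u` and to its first derivatives.
    obtain ⟨t, ht0, ht1, ht2⟩ : ∃ t, 0 < t ∧ t < 1 / (n : ℝ) ∧ 1 / p - m / n < θ + t := by
      rcases lt_or_ge (1 / p - m / n) θ with h | h
      · exact ⟨1 / (2 * n), by positivity, by gcongr; linarith, by
          have : 0 < 1 / (2 * (n : ℝ)) := by positivity
          linarith⟩
      · refine ⟨(1 / p - m / n - θ + 1 / n) / 2, ?_, ?_, ?_⟩ <;> linarith
    have hθ' : SobolevExponent n p m (min (1 / p) (θ + t)) := by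
      refine ⟨by positivity, min_le_left _ _, ?_⟩
      rcases le_total (1 / p) (θ + t) with h | h
      · left; exact min_eq_left h
      · right; rwa [min_eq_right h]
    have hpos : 0 < min (1 / p) (θ + t) := lt_min (by positivity) (by linarith)
    have hp1 : 1 / p ≤ 1 := by rw [div_le_one hp0]; exact hp.le
    generalize hθd : min (1 / p) (θ + t) = θ' at *
    have e : (ENNReal.ofReal θ')⁻¹ = ENNReal.ofReal (1 / θ') := by
      rw [one_div, ENNReal.ofReal_inv_of_pos hpos]
    have hle : θ' ≤ θ + t := hθd ▸ min_le_right _ _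
    have hge : θ ≤ θ' := hθd ▸ le_min h1.le (by linarith)
    refine memLp_japMeasure_of_hasWeakDeriv (a := 1 / θ') ?_ h0 ?_ ?_
      (hu.sobolevIntegrable.locallyIntegrable hp) hv ?_ fun i => ?_
    · rw [le_div_iff₀ hpos]; linarith [hθ'.2.1]
    · rwa [one_div_one_div]
    · rw [one_div_one_div]; linarith
    · rw [← e]; exact hu.sobolevIntegrable _ hθ'
    · have := (hv' i).sobolevIntegrable _ hθ'
      rw [← e]
      rwa [neg_sub] at this

/-- The weight factors as `⟨x⟩^{-n}` times the `p`-th power of `⟨x⟩^{-(δ - j)}`. -/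
theorem integrable_weight_iff (hp : 0 < p) {δ : ℝ} (j : ℕ) {v : EuclideanSpace ℝ (Fin n) → ℝ}
    (hv : AEStronglyMeasurable v volume) :
    Integrable (fun x => Real.sqrt (1 + ‖x‖ ^ 2) ^ (-(n : ℝ) - p * δ + p * (j : ℝ)) *
        |v x| ^ p) ↔
      MemLp (fun x => jap x ^ (-(δ - j)) * v x) (ENNReal.ofReal p) (japMeasure n) := by
  have hm : AEStronglyMeasurable (fun x => jap x ^ (-(δ - j)) * v x) (japMeasure n) :=
    (continuous_jap_rpow _).aestronglyMeasurable.mul (hv.mono_ac japMeasure_absolutelyContinuous)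
  rw [← integrable_norm_rpow_iff hm (by simpa using hp) ENNReal.ofReal_ne_top, japMeasure,
    integrable_withDensity_iff_integrable_smul' (measurable_japWeight _) (by simp)]
  refine iff_of_eq (congrArg (Integrable · volume) (funext fun x => ?_))
  have hx := jap_pos x
  rw [ENNReal.toReal_ofReal (Real.rpow_nonneg hx.le _), ENNReal.toReal_ofReal hp.le, norm_mul,
    Real.norm_of_nonneg (Real.rpow_nonneg hx.le _), Real.mul_rpow (Real.rpow_nonneg hx.le _)
      (norm_nonneg _), ← Real.rpow_mul hx.le, smul_eq_mul, ← mul_assoc, ← Real.rpow_add hx,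
    Real.norm_eq_abs]
  congr 2
  ring

theorem memWeightedSobolev_iff_sobolevChain (hp : 1 < p) {δ : ℝ} {m : ℕ}
    {u : EuclideanSpace ℝ (Fin n) → ℝ} :
    MemWeightedSobolev m p δ u ↔
      SobolevChain univ (fun (j : ℕ) (v : EuclideanSpace ℝ (Fin n) → ℝ) =>
        MemLp (fun x => jap x ^ (-(δ - j)) * v x) (ENNReal.ofReal p) (japMeasure n)) m 0 u := by
  rw [sobolevChain_iff isOpen_univ
    (P := fun (j : ℕ) (v : EuclideanSpace ℝ (Fin n) → ℝ) =>
      MemLp (fun x => jap x ^ (-(δ - j)) * v x) (ENNReal.ofReal p) (japMeasure n))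
    (fun j u h => (locallyIntegrable_of_weighted hp h).locallyIntegrableOn univ)
    (fun j u v h hv => (memLp_congr_ae (weighted_congr_ae (by simpa using h))).2 hv)]
  refine forall₂_congr fun L hL => exists_congr fun v => and_congr_right fun hv => ?_
  rw [Nat.zero_add]
  exact integrable_weight_iff (by linarith) _
    (locallyIntegrableOn_univ.1 hv.2.1).aestronglyMeasurable

theorem MemWeightedSobolev.memSobolevScale (hp : 1 < p) (hn : 0 < n) {δ : ℝ} {m : ℕ}
    {u : EuclideanSpace ℝ (Fin n) → ℝ} (h : MemWeightedSobolev m p δ u) :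
    MemSobolevScale p m m δ u := by
  simpa using ((memWeightedSobolev_iff_sobolevChain hp).1 h).memSobolevScale hp hn

theorem MemSobolevScale.sobolevChain (hp : 1 < p) {l j : ℕ} {s δ : ℝ}
    {u : EuclideanSpace ℝ (Fin n) → ℝ} (h : MemSobolevScale p l s (δ - j) u) :
    SobolevChain univ (fun (j : ℕ) (v : EuclideanSpace ℝ (Fin n) → ℝ) =>
      MemLp (fun x => jap x ^ (-(δ - j)) * v x) (ENNReal.ofReal p) (japMeasure n)) l j u := by
  induction l generalizing j s u with
  | zero => exact h.sobolevIntegrable.memLp (by linarith)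
  | succ l ih =>
    refine ⟨h.1.memLp (by linarith), fun i => ?_⟩
    obtain ⟨v, hv, hv'⟩ := h.2 i
    exact ⟨v, hv, ih (hv'.mono le_rfl (by push_cast; linarith))⟩

/-- The exponent `1/p` is admissible at every `s`, so the extra integrability is just forgotten and
`s` need not be related to `l`. -/
theorem MemSobolevScale.memWeightedSobolev (hp : 1 < p) {l : ℕ} {s δ : ℝ}
    {u : EuclideanSpace ℝ (Fin n) → ℝ} (h : MemSobolevScale p l s δ u) :
    MemWeightedSobolev l p δ u :=
  (memWeightedSobolev_iff_sobolevChain hp).2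
    (MemSobolevScale.sobolevChain hp (s := s) (by simpa using h))

end WeightedClasses

/-! ### Asymptotically constant functions and the inverse metric -/

section AsymptoticallyConstant

variable {n : ℕ} {p : ℝ} {l : ℕ} {s σ τ : ℝ}

namespace MemSobolevScale

/-- Write `f = c + (f - c)`. The decaying part multiplies the class into itself because `s > n/p`
and its weight `σ` is nonpositive. -/
theorem mul_left_of_sub (hp : 1 < p) (hn : 0 < n) (hσ : σ ≤ 0) {t c : ℝ} (hl : (l : ℝ) ≤ t)
    (hts : t ≤ s) (hs : n / p < s) {f u : EuclideanSpace ℝ (Fin n) → ℝ}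
    (hf : MemSobolevScale p l s σ fun x => f x - c) (hu : MemSobolevScale p l t τ u) :
    MemSobolevScale p l t τ fun x => f x * u x := by
  refine (((hf.mul hp hn hl hts le_rfl (by linarith) hu).mono le_rfl (by linarith)).add
    (hu.const_mul c)).congr fun x => ?_
  ring

/-- From `f g - c d = f (g - d) + d (f - c)`. It gives control of polynomials in the metric
coefficients, in particular of determinants and cofactors. -/
theorem mul_sub_mul (hp : 1 < p) (hn : 0 < n) (hσ : σ ≤ 0) (hl : (l : ℝ) ≤ s) (hs : n / p < s)
    {f g : EuclideanSpace ℝ (Fin n) → ℝ} {c d : ℝ}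
    (hf : MemSobolevScale p l s σ fun x => f x - c)
    (hg : MemSobolevScale p l s σ fun x => g x - d) :
    MemSobolevScale p l s σ fun x => f x * g x - c * d := by
  refine ((hf.mul_left_of_sub hp hn hσ hl le_rfl hs hg).add (hf.const_mul d)).congr fun x => ?_
  ring

theorem prod_sub_prod (hp : 1 < p) (hn : 0 < n) (hσ : σ ≤ 0) (hl : (l : ℝ) ≤ s) (hs : n / p < s)
    {ι : Type*} (t : Finset ι) {f : ι → EuclideanSpace ℝ (Fin n) → ℝ} {c : ι → ℝ}
    (hf : ∀ i, MemSobolevScale p l s σ fun x => f i x - c i) :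
    MemSobolevScale p l s σ fun x => ∏ i ∈ t, f i x - ∏ i ∈ t, c i := by
  classical
  induction t using Finset.induction_on with
  | empty => simpa using zero
  | insert a t ha ih =>
    simp_rw [Finset.prod_insert ha]
    exact (hf a).mul_sub_mul hp hn hσ hl hs ih

theorem det_sub_det (hp : 1 < p) (hn : 0 < n) (hσ : σ ≤ 0) (hl : (l : ℝ) ≤ s) (hs : n / p < s)
    {ι : Type*} [Fintype ι] [DecidableEq ι] {A : EuclideanSpace ℝ (Fin n) → Matrix ι ι ℝ}
    {C : Matrix ι ι ℝ} (hA : ∀ i j, MemSobolevScale p l s σ fun x => A x i j - C i j) :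
    MemSobolevScale p l s σ fun x => (A x).det - C.det := by
  simp_rw [Matrix.det_apply', ← Finset.sum_sub_distrib, ← mul_sub]
  exact MemSobolevScale.sum _ fun e _ => (prod_sub_prod hp hn hσ hl hs _ fun i => hA _ _).const_mul _

theorem adjugate_sub_adjugate (hp : 1 < p) (hn : 0 < n) (hσ : σ ≤ 0) (hl : (l : ℝ) ≤ s)
    (hs : n / p < s) {ι : Type*} [Fintype ι] [DecidableEq ι]
    {A : EuclideanSpace ℝ (Fin n) → Matrix ι ι ℝ} {C : Matrix ι ι ℝ}
    (hA : ∀ i j, MemSobolevScale p l s σ fun x => A x i j - C i j) (i j : ι) :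
    MemSobolevScale p l s σ fun x => (A x).adjugate i j - C.adjugate i j := by
  simp_rw [Matrix.adjugate_apply]
  refine det_sub_det hp hn hσ hl hs fun a b => ?_
  by_cases h : a = j
  · subst h; simpa using zero
  · simpa [Matrix.updateRow_ne h] using hA a b

end MemSobolevScale

/-- For `s > n/p` the exponent zero is admissible, so `⟨x⟩^{-σ} d` is essentially bounded.
Continuity upgrades this to a bound everywhere, and `⟨x⟩^σ` tends to zero. -/
theorem tendsto_cocompact_of_sobolevIntegrable (hn : 0 < n) (hσ : σ < 0) (hs : n / p < s)
    (hp : 0 < p) {d : EuclideanSpace ℝ (Fin n) → ℝ} (hd : Continuous d)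
    (h : SobolevIntegrable p s σ d) : Tendsto d (cocompact _) (𝓝 0) := by
  have hn' : (0 : ℝ) < n := by exact_mod_cast hn
  have h0 : SobolevExponent n p s 0 := by
    refine ⟨le_rfl, by positivity, Or.inr ?_⟩
    have : n / p / n < s / n := by gcongr
    have h3 : 1 / p = n / p / n := by field_simp
    linarith
  have h1 := h 0 h0
  rw [ENNReal.ofReal_zero, ENNReal.inv_zero] at h1
  have h2 := absolutelyContinuous_japMeasure.ae_le (ae_le_eLpNormEssSup (f := fun x => jap x ^ (-σ) * d x)
    (μ := japMeasure n))
  set C := (eLpNormEssSup (fun x => jap x ^ (-σ) * d x) (japMeasure n)).toReal with hC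
  have h3 : ∀ x, ‖jap x ^ (-σ) * d x‖ ≤ C := by
    have hcl : IsClosed {x : EuclideanSpace ℝ (Fin n) | ‖jap x ^ (-σ) * d x‖ ≤ C} :=
      isClosed_le ((continuous_jap_rpow _).mul hd).norm continuous_const
    have hden : Dense {x : EuclideanSpace ℝ (Fin n) | ‖jap x ^ (-σ) * d x‖ ≤ C} := by
      refine Measure.dense_of_ae (μ := volume) ?_
      filter_upwards [h2] with x hx
      rw [hC]
      rw [← toReal_enorm]
      exact ENNReal.toReal_mono (by simpa [eLpNorm_exponent_top] using h1.2.ne) hx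
    intro x
    have := hcl.closure_eq ▸ hden x
    exact this
  have hC0 : 0 ≤ C := ENNReal.toReal_nonneg
  have h4 : Tendsto (fun x : EuclideanSpace ℝ (Fin n) => C * ‖x‖ ^ σ) (cocompact _) (𝓝 0) := by
    have := (tendsto_rpow_neg_atTop (neg_pos.2 hσ)).comp
      (tendsto_norm_cocompact_atTop (E := EuclideanSpace ℝ (Fin n)))
    simpa using this.const_mul C
  refine squeeze_zero_norm' ?_ h4
  filter_upwards [(tendsto_norm_cocompact_atTop
    (E := EuclideanSpace ℝ (Fin n))).eventually_gt_atTop 0] with x hx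
  have h5 := h3 x
  rw [norm_mul, Real.norm_of_nonneg (Real.rpow_nonneg (jap_pos x).le _)] at h5
  calc ‖d x‖ = jap x ^ σ * (jap x ^ (-σ) * ‖d x‖) := (jap_rpow_mul_neg σ x _).symm
    _ ≤ jap x ^ σ * C := by gcongr; exact Real.rpow_nonneg (jap_pos x).le _
    _ ≤ ‖x‖ ^ σ * C := by
      exact mul_le_mul_of_nonneg_right
        (Real.rpow_le_rpow_of_nonpos hx (norm_le_jap x) hσ.le) hC0
    _ = _ := mul_comm _ _

theorem exists_pos_forall_le_of_tendsto {f : EuclideanSpace ℝ (Fin n) → ℝ} (hf : Continuous f)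
    (hpos : ∀ x, 0 < f x) (h : Tendsto f (cocompact _) (𝓝 1)) : ∃ c, 0 < c ∧ ∀ x, c ≤ f x := by
  have h1 : ∀ᶠ x in cocompact _, 1 / 2 < f x := h.eventually (lt_mem_nhds (by norm_num))
  obtain ⟨K, hK, hK'⟩ := mem_cocompact.1 h1
  rcases K.eq_empty_or_nonempty with rfl | hne
  · exact ⟨1 / 2, by norm_num, fun x => le_of_lt (hK' (by simp))⟩
  obtain ⟨y, -, hy⟩ := hK.exists_isMinOn hne hf.continuousOn
  refine ⟨min (1 / 2) (f y), lt_min (by norm_num) (hpos y), fun x => ?_⟩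
  by_cases hx : x ∈ K
  · exact (min_le_right _ _).trans (hy hx)
  · exact (min_le_left _ _).trans (le_of_lt (hK' hx))

theorem hasWeakDeriv_of_sub_const {i : Fin n} {f v : EuclideanSpace ℝ (Fin n) → ℝ} {c : ℝ}
    (h : HasWeakDeriv univ [i] (fun x => f x - c) v) : HasWeakDeriv univ [i] f v := by
  simpa using h.add (hasWeakDeriv_const isOpen_univ c i)

/-- A bootstrap on the number of derivatives: since `∂(1/f) = -f⁻² ∂f`, control of `l` derivatives
of `1/f` gives control of `l + 1`. It starts from `1/f - 1 = -(1/f)(f - 1)` and a positive lower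
bound for `f`, which decay at infinity supplies. -/
theorem MemSobolevScale.inv_sub_one (hp : 1 < p) (hn : 0 < n) (hσ : σ < 0) {m : ℕ}
    (hm : n / p < m) {f : EuclideanSpace ℝ (Fin n) → ℝ} (hf : Continuous f) (hpos : ∀ x, 0 < f x)
    (h : MemSobolevScale p m m σ fun x => f x - 1) :
    MemSobolevScale p m m σ fun x => (f x)⁻¹ - 1 := by
  obtain ⟨c, hc, hcf⟩ := exists_pos_forall_le_of_tendsto hf hpos (by
    simpa using (tendsto_cocompact_of_sobolevIntegrable hn hσ hm (by linarith)
      (hf.sub continuous_const) h.sobolevIntegrable).add_const 1)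
  have hX : SobolevIntegrable p m σ fun x => (f x)⁻¹ - 1 := by
    intro θ hθ
    refine (h.sobolevIntegrable θ hθ).of_le_mul (c := c⁻¹) ?_ (Eventually.of_forall fun x => ?_)
    · exact ((continuous_jap_rpow _).mul
        ((hf.inv₀ fun x => (hpos x).ne').sub continuous_const)).aestronglyMeasurable
    · have e : (f x)⁻¹ - 1 = -((f x)⁻¹ * (f x - 1)) := by
        field_simp [(hpos x).ne']
        ring
      dsimp only
      rw [e, norm_mul, norm_mul, norm_neg, norm_mul, mul_left_comm,
        Real.norm_of_nonneg (inv_nonneg.2 (hpos x).le)]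
      gcongr
      exact hcf x
  suffices H : ∀ l : ℕ, l ≤ m → MemSobolevScale p l m σ fun x => (f x)⁻¹ - 1 from H m le_rfl
  intro l hl
  induction l with
  | zero => exact hX
  | succ l ih =>
    have hl' : ((l + 1 : ℕ) : ℝ) ≤ m := by exact_mod_cast hl
    push_cast at hl'
    refine ⟨hX, fun i => ?_⟩
    obtain ⟨v, hv, hv'⟩ := (h.of_le hl).2 i
    have h1 := (hasWeakDeriv_of_sub_const hv).inv hf hpos
    have h2 := h1.sub (hasWeakDeriv_const isOpen_univ 1 i)
    refine ⟨_, h2, ?_⟩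
    have h3 := ih (by omega)
    have h4 := h3.mul_sub_mul hp hn hσ.le (by linarith) hm h3
    refine ((h4.mul_left_of_sub hp hn hσ.le (by linarith) (by linarith) hm hv').const_mul
      (-1)).congr fun x => ?_
    ring

/-- Cramer's rule: the inverse is the reciprocal of the determinant times the adjugate, and both
factors tend to their Euclidean values. -/
theorem MemSobolevScale.matrix_inv_sub_one (hp : 1 < p) (hn : 0 < n) (hσ : σ < 0) {m : ℕ}
    (hm : n / p < m) {g : EuclideanSpace ℝ (Fin n) → Matrix (Fin n) (Fin n) ℝ}
    (hg : Continuous g) (hpos : ∀ x, (g x).PosDef)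
    (h : ∀ a b, MemSobolevScale p m m σ fun x =>
      g x a b - (1 : Matrix (Fin n) (Fin n) ℝ) a b) (a b : Fin n) :
    MemSobolevScale p m m σ fun x =>
      (g x)⁻¹ a b - (1 : Matrix (Fin n) (Fin n) ℝ) a b := by
  have h1 := MemSobolevScale.det_sub_det hp hn hσ.le le_rfl hm h
  rw [Matrix.det_one] at h1
  have h2 := h1.inv_sub_one hp hn hσ hm hg.matrix_det fun x => (hpos x).det_pos
  have h3 := MemSobolevScale.adjugate_sub_adjugate hp hn hσ.le le_rfl hm h a b
  refine (h2.mul_sub_mul hp hn hσ.le le_rfl hm h3).congr fun x => ?_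
  rw [Matrix.inv_def, Matrix.smul_apply, Ring.inverse_eq_inv', Matrix.adjugate_one, smul_eq_mul,
    one_mul]

end AsymptoticallyConstant

/-! ### Linear part and quadratic remainder of the scalar curvature -/

section Curvature

variable {n : ℕ} {p : ℝ} {m : ℕ} {σ : ℝ}

theorem HasWeakDeriv.weakDeriv {L : List (Fin n)} {u v : EuclideanSpace ℝ (Fin n) → ℝ}
    (h : HasWeakDeriv univ L u v) : HasWeakDeriv univ L u (weakDeriv L u) := by
  have hex : ∃ v, HasWeakDeriv univ L u v := ⟨v, h⟩
  rw [_root_.weakDeriv, dif_pos hex]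
  exact hex.choose_spec

section

variable {G : EuclideanSpace ℝ (Fin n) → Matrix (Fin n) (Fin n) ℝ}
  {D : EuclideanSpace ℝ (Fin n) → Fin n → Matrix (Fin n) (Fin n) ℝ}
  {H : EuclideanSpace ℝ (Fin n) → Fin n → Fin n → Matrix (Fin n) (Fin n) ℝ}
  (hp : 1 < p) (hn : 0 < n) (hσ : σ ≤ 0) (hm : n / p < m + 2)
  (hG : ∀ a b, MemSobolevScale p m (m + 2) σ fun x =>
    (G x)⁻¹ a b - (1 : Matrix (Fin n) (Fin n) ℝ) a b)
  (hD : ∀ c a b, MemSobolevScale p m (m + 1) (σ - 1) fun x => D x c a b)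
  (hH : ∀ e c a b, MemSobolevScale p m m (σ - 2) fun x => H x e c a b)

include hp hn hσ hm hG hD

theorem memSobolevScale_christoffel (c a b : Fin n) :
    MemSobolevScale p m (m + 1) (σ - 1) fun x => christoffel (G x) (D x) c a b := by
  refine (MemSobolevScale.sum _ fun d _ => ?_).const_mul _
  exact (hG c d).mul_left_of_sub hp hn hσ (by linarith) (by linarith) hm
    (((hD a b d).add (hD b a d)).sub (hD d a b))

include hH

/-- Differentiating the inverse metric gives terms with two first derivatives. Replacing the
undifferentiated inverse by the identity costs a factor of weight `σ` against a second derivative.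
Both have weight `2σ - 2`. -/
theorem memSobolevScale_christoffelDeriv_sub (e c a b : Fin n) :
    MemSobolevScale p m m (2 * σ - 2) fun x => christoffelDeriv (G x) (D x) (H x) e c a b -
      1 / 2 * (H x e a b c + H x e b a c - H x e c a b) := by
  -- Two factors of index `m + 1` multiply into index `m` because `(m + 1) + (m + 1) - m = m + 2 >
  -- n/p`; this is where products of first derivatives fit.
  have hT : ∀ u v : EuclideanSpace ℝ (Fin n) → ℝ, MemSobolevScale p m (m + 1) (σ - 1) u →
      MemSobolevScale p m (m + 1) (σ - 1) v → MemSobolevScale p m m (2 * σ - 2)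
        fun x => u x * v x := fun u v hu hv =>
    (hu.mul hp hn le_rfl (by linarith) (by linarith) (by linarith) hv).mono le_rfl (by linarith)
  have hA : ∀ c d, MemSobolevScale p m (m + 1) (σ - 1) fun x =>
      ((G x)⁻¹ * D x e * (G x)⁻¹) c d := by
    intro c d
    simp_rw [Matrix.mul_apply]
    refine MemSobolevScale.sum _ fun j _ => ?_
    refine ((hG j d).mul_left_of_sub hp hn hσ (by linarith) (by linarith) hm
      (MemSobolevScale.sum Finset.univ fun i _ => (hG c i).mul_left_of_sub hp hn hσ (by linarith)
        (by linarith) hm (hD e i j))).congr fun x => ?_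
    exact mul_comm _ _
  have hB : ∀ d, MemSobolevScale p m m (2 * σ - 2) fun x =>
      -((G x)⁻¹ * D x e * (G x)⁻¹) c d * (D x a b d + D x b a d - D x d a b) +
        ((G x)⁻¹ c d - (1 : Matrix (Fin n) (Fin n) ℝ) c d) *
          (H x e a b d + H x e b a d - H x e d a b) := by
    intro d
    refine MemSobolevScale.add ?_ ?_
    · exact ((hT _ _ (hA c d) (((hD a b d).add (hD b a d)).sub (hD d a b))).const_mul
        (-1)).congr fun x => by ring
    · exact ((hG c d).mul hp hn le_rfl (by linarith) le_rfl (by linarith)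
        (((hH e a b d).add (hH e b a d)).sub (hH e d a b))).mono le_rfl (by linarith)
  refine ((MemSobolevScale.sum Finset.univ fun d _ => hB d).const_mul (1 / 2)).congr fun x => ?_
  have hδ : H x e a b c + H x e b a c - H x e c a b = ∑ d, (1 : Matrix (Fin n) (Fin n) ℝ) c d *
      (H x e a b d + H x e b a d - H x e d a b) := by
    simp [Matrix.one_apply]
  rw [hδ, christoffelDeriv, ← mul_sub, ← Finset.sum_sub_distrib]
  congr 1
  refine Finset.sum_congr rfl fun d _ => ?_
  ring

theorem memSobolevScale_ricci_sub (a b : Fin n) :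
    MemSobolevScale p m m (2 * σ - 2) fun x => ricci (G x) (D x) (H x) a b -
      ∑ c, 1 / 2 * (H x c a b c + H x c b a c - H x c c a b - H x b a c c) := by
  have hΓ := memSobolevScale_christoffel hp hn hσ hm hG hD
  have hΓ' := memSobolevScale_christoffelDeriv_sub hp hn hσ hm hG hD hH
  have hT : ∀ u v : EuclideanSpace ℝ (Fin n) → ℝ, MemSobolevScale p m (m + 1) (σ - 1) u →
      MemSobolevScale p m (m + 1) (σ - 1) v → MemSobolevScale p m m (2 * σ - 2)
        fun x => u x * v x := fun u v hu hv =>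
    (hu.mul hp hn le_rfl (by linarith) (by linarith) (by linarith) hv).mono le_rfl (by linarith)
  refine ((MemSobolevScale.sum Finset.univ fun c _ => (hΓ' c c a b).sub (hΓ' b c a c)).add
    (MemSobolevScale.sum Finset.univ fun c _ => MemSobolevScale.sum Finset.univ fun d _ =>
      (hT _ _ (hΓ c c d) (hΓ d a b)).sub (hT _ _ (hΓ c b d) (hΓ d a c)))).congr fun x => ?_
  rw [ricci, add_sub_right_comm, ← Finset.sum_sub_distrib]
  congr 1
  refine Finset.sum_congr rfl fun c _ => ?_
  ring

/-- With `L` the linear part of the Ricci tensor, the contraction splits into `G⁻¹` against `Ric -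
L`, `G⁻¹ - 1` against `L`, and the Euclidean trace of `L`. Renaming summation indices in this trace
is enough; symmetry of second derivatives plays no role. -/
theorem memSobolevScale_scalar_sub :
    MemSobolevScale p m m (2 * σ - 2) fun x =>
      ∑ a, ∑ b, (G x)⁻¹ a b * ricci (G x) (D x) (H x) a b -
        ∑ a, ∑ c, (H x c a a c - H x c c a a) := by
  have hR := memSobolevScale_ricci_sub hp hn hσ hm hG hD hH
  have hL : ∀ a b, MemSobolevScale p m m (σ - 2) fun x =>
      ∑ c, 1 / 2 * (H x c a b c + H x c b a c - H x c c a b - H x b a c c) := fun a b =>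
    MemSobolevScale.sum _ fun c _ =>
      ((((hH c a b c).add (hH c b a c)).sub (hH c c a b)).sub (hH b a c c)).const_mul _
  have hB : ∀ a b, MemSobolevScale p m m (2 * σ - 2) fun x =>
      (G x)⁻¹ a b * (ricci (G x) (D x) (H x) a b -
        ∑ c, 1 / 2 * (H x c a b c + H x c b a c - H x c c a b - H x b a c c)) +
      ((G x)⁻¹ a b - (1 : Matrix (Fin n) (Fin n) ℝ) a b) *
        ∑ c, 1 / 2 * (H x c a b c + H x c b a c - H x c c a b - H x b a c c) := fun a b =>
    ((hG a b).mul_left_of_sub hp hn hσ le_rfl (by linarith) hm (hR a b)).add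
      (((hG a b).mul hp hn le_rfl (by linarith) le_rfl (by linarith) (hL a b)).mono le_rfl
        (by linarith))
  refine (MemSobolevScale.sum Finset.univ fun a _ =>
    MemSobolevScale.sum Finset.univ fun b _ => hB a b).congr fun x => ?_
  have hδ : ∑ a, ∑ c, (H x c a a c - H x c c a a) = ∑ a, ∑ b,
      (1 : Matrix (Fin n) (Fin n) ℝ) a b *
        ∑ c, 1 / 2 * (H x c a b c + H x c b a c - H x c c a b - H x b a c c) := by
    have h1 : ∑ a, ∑ c, H x a a c c = ∑ a, ∑ c, H x c c a a := Finset.sum_comm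
    simp only [Matrix.one_apply, ite_mul, one_mul, zero_mul, Finset.sum_ite_eq, Finset.mem_univ,
      if_true, ← Finset.mul_sum, Finset.sum_sub_distrib, Finset.sum_add_distrib, h1]
    ring
  rw [hδ, ← Finset.sum_sub_distrib]
  refine Finset.sum_congr rfl fun a _ => ?_
  rw [← Finset.sum_sub_distrib]
  refine Finset.sum_congr rfl fun b _ => ?_
  ring

end

/-- The second order part of the linearisation of the scalar curvature at the flat metric. -/
noncomputable def linearCurvature (g : EuclideanSpace ℝ (Fin n) → Matrix (Fin n) (Fin n) ℝ) :
    EuclideanSpace ℝ (Fin n) → ℝ :=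
  fun x => ∑ a, ∑ c, (weakDeriv [c, a] (fun y => g y a c) x - weakDeriv [c, c] (fun y => g y a a) x)

/-- Applies the algebraic estimate to `g` and its weak derivatives, the chosen representatives
agreeing a.e. with those of the Sobolev scale. -/
theorem memWeightedSobolev_scalarCurvature_sub (hp : 1 < p) (hn : 0 < n) (hσ : σ < 0)
    (hm : n / p < m + 2) {g : EuclideanSpace ℝ (Fin n) → Matrix (Fin n) (Fin n) ℝ}
    (hg : Continuous g) (hpos : ∀ x, (g x).PosDef)
    (h : ∀ a b, MemWeightedSobolev (m + 2) p σ fun x =>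
      g x a b - (1 : Matrix (Fin n) (Fin n) ℝ) a b) :
    MemWeightedSobolev m p (2 * σ - 2) fun x => scalarCurvature g x - linearCurvature g x := by
  have hS : ∀ a b, MemSobolevScale p (m + 2) (m + 2) σ fun x =>
      g x a b - (1 : Matrix (Fin n) (Fin n) ℝ) a b := fun a b => by
    simpa using (h a b).memSobolevScale hp hn
  have hI : ∀ a b, MemSobolevScale p m (m + 2) σ fun x =>
      (g x)⁻¹ a b - (1 : Matrix (Fin n) (Fin n) ℝ) a b := fun a b => by
    have := MemSobolevScale.matrix_inv_sub_one hp hn hσ (m := m + 2) (by push_cast; linarith)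
      hg hpos (fun a b => by simpa using hS a b) a b
    simpa using this.of_le (l' := m) (by omega)
  have hd : ∀ c a b, ∃ v, HasWeakDeriv univ [c] (fun x => g x a b) v ∧
      MemSobolevScale p (m + 1) (m + 1) (σ - 1) v := fun c a b => by
    obtain ⟨v, hv, hv'⟩ := (hS a b).2 c
    exact ⟨v, hasWeakDeriv_of_sub_const hv, hv'.mono (by linarith) le_rfl⟩
  refine MemSobolevScale.memWeightedSobolev hp (memSobolevScale_scalar_sub hp hn hσ.le hm
    (G := g) hI (D := fun x c => Matrix.of fun i j => weakDeriv [c] (fun y => g y i j) x)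
    (H := fun x e c => Matrix.of fun i j => weakDeriv [e, c] (fun y => g y i j) x) ?_ ?_)
  · intro c a b
    obtain ⟨v, hv, hv'⟩ := hd c a b
    exact hv'.of_succ.congr_ae (by simpa using hv.ae_unique isOpen_univ (ae_eq_refl _) hv.weakDeriv)
  · intro e c a b
    obtain ⟨v, hv, hv'⟩ := hd e a b
    obtain ⟨w, hw, hw'⟩ := hv'.2 c
    have h1 := hv.cons hw
    have h2 := h1.ae_unique isOpen_univ (ae_eq_refl _) h1.weakDeriv
    exact (hw'.congr_ae (by simpa using h2)).mono (by linarith) (by linarith)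

end Curvature

/-! ### Local Sobolev spaces -/

section LocalSobolev

variable {n : ℕ} {Ω : Set (EuclideanSpace ℝ (Fin n))} {p : ℝ}

/-- `L^p_loc(Ω)`, with the dummy index that `SobolevChain` needs. -/
def MemLpLoc (p : ℝ) (Ω : Set (EuclideanSpace ℝ (Fin n))) (_ : ℕ)
    (v : EuclideanSpace ℝ (Fin n) → ℝ) : Prop :=
  ∀ K ⊆ Ω, IsCompact K → MemLp v (ENNReal.ofReal p) (volume.restrict K)

theorem MemLpLoc.locallyIntegrableOn (hΩ : IsOpen Ω) (hp : 1 ≤ p) {j : ℕ}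
    {v : EuclideanSpace ℝ (Fin n) → ℝ} (h : MemLpLoc p Ω j v) : LocallyIntegrableOn v Ω := by
  refine (locallyIntegrableOn_iff_isCompact hΩ).2 fun K hKΩ hK => ?_
  have : IsFiniteMeasure (volume.restrict K) := ⟨by simpa using hK.measure_lt_top⟩
  exact (h K hKΩ hK).integrable (by simpa using hp)

theorem MemLpLoc.congr_ae {j : ℕ} {u v : EuclideanSpace ℝ (Fin n) → ℝ}
    (h : u =ᵐ[volume.restrict Ω] v) (hv : MemLpLoc p Ω j v) : MemLpLoc p Ω j u :=
  fun K hKΩ hK => (memLp_congr_ae (ae_restrict_of_ae_restrict_of_subset hKΩ h)).2 (hv K hKΩ hK)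

theorem MemLpLoc.continuousOn_mul {j : ℕ} {f v : EuclideanSpace ℝ (Fin n) → ℝ}
    (hf : ContinuousOn f Ω) (hv : MemLpLoc p Ω j v) : MemLpLoc p Ω j fun x => f x * v x := by
  intro K hKΩ hK
  obtain ⟨C, hC⟩ := hK.exists_bound_of_continuousOn (hf.mono hKΩ)
  have h2 : MemLp f ⊤ (volume.restrict K) :=
    memLp_top_of_bound ((hf.mono hKΩ).aestronglyMeasurable hK.measurableSet) C
      ((ae_restrict_iff' hK.measurableSet).2 (Eventually.of_forall hC))
  exact (hv K hKΩ hK).mul' h2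

theorem memSobolevLoc_iff_sobolevChain (hΩ : IsOpen Ω) (hp : 1 ≤ p) {m : ℕ}
    {u : EuclideanSpace ℝ (Fin n) → ℝ} :
    MemSobolevLoc m p Ω u ↔ SobolevChain Ω (MemLpLoc p Ω) m 0 u := by
  rw [sobolevChain_iff hΩ (fun j u h => h.locallyIntegrableOn hΩ hp)
    (fun j u v h hv => hv.congr_ae h)]
  rfl

theorem SobolevChain.memLpLoc_index {m j j' : ℕ} {u : EuclideanSpace ℝ (Fin n) → ℝ}
    (h : SobolevChain Ω (MemLpLoc p Ω) m j u) : SobolevChain Ω (MemLpLoc p Ω) m j' u := by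
  induction m generalizing j j' u with
  | zero => exact h
  | succ m ih =>
    refine ⟨h.1, fun i => ?_⟩
    obtain ⟨v, hv, hv'⟩ := h.2 i
    exact ⟨v, hv, ih hv'⟩

theorem SobolevChain.memLpLoc_add {m j : ℕ} {u v : EuclideanSpace ℝ (Fin n) → ℝ}
    (hu : SobolevChain Ω (MemLpLoc p Ω) m j u) (hv : SobolevChain Ω (MemLpLoc p Ω) m j v) :
    SobolevChain Ω (MemLpLoc p Ω) m j fun x => u x + v x := by
  induction m generalizing j u v with
  | zero => exact fun K hKΩ hK => (hu K hKΩ hK).add (hv K hKΩ hK)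
  | succ m ih =>
    refine ⟨fun K hKΩ hK => (hu.1 K hKΩ hK).add (hv.1 K hKΩ hK), fun i => ?_⟩
    obtain ⟨u', hu1, hu2⟩ := hu.2 i
    obtain ⟨v', hv1, hv2⟩ := hv.2 i
    exact ⟨_, hu1.add hv1, ih hu2 hv2⟩

theorem contDiffOn_pderiv (hΩ : IsOpen Ω) {f : EuclideanSpace ℝ (Fin n) → ℝ}
    (hf : ContDiffOn ℝ (⊤ : ℕ∞) f Ω) (i : Fin n) : ContDiffOn ℝ (⊤ : ℕ∞) (pderiv i f) Ω :=
  (hf.fderiv_of_isOpen hΩ (by simp)).clm_apply contDiffOn_const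

theorem SobolevChain.smooth_mul (hΩ : IsOpen Ω) {m j : ℕ} {f u : EuclideanSpace ℝ (Fin n) → ℝ}
    (hf : ContDiffOn ℝ (⊤ : ℕ∞) f Ω) (hu : SobolevChain Ω (MemLpLoc p Ω) m j u) :
    SobolevChain Ω (MemLpLoc p Ω) m j fun x => f x * u x := by
  induction m generalizing j f u with
  | zero => exact MemLpLoc.continuousOn_mul hf.continuousOn hu
  | succ m ih =>
    refine ⟨MemLpLoc.continuousOn_mul hf.continuousOn hu.1, fun i => ?_⟩
    obtain ⟨v, hv, hv'⟩ := hu.2 i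
    exact ⟨_, hv.smooth_mul hΩ hf, (ih hf hv').memLpLoc_add
      (ih (contDiffOn_pderiv hΩ hf i) hu.of_succ.memLpLoc_index)⟩

namespace MemSobolevLoc

variable {m : ℕ} {f u v : EuclideanSpace ℝ (Fin n) → ℝ}

theorem smooth_mul (hΩ : IsOpen Ω) (hp : 1 ≤ p) (hf : ContDiffOn ℝ (⊤ : ℕ∞) f Ω)
    (hu : MemSobolevLoc m p Ω u) : MemSobolevLoc m p Ω fun x => f x * u x := by
  rw [memSobolevLoc_iff_sobolevChain hΩ hp] at *
  exact hu.smooth_mul hΩ hf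

theorem add (hΩ : IsOpen Ω) (hp : 1 ≤ p) (hu : MemSobolevLoc m p Ω u)
    (hv : MemSobolevLoc m p Ω v) : MemSobolevLoc m p Ω fun x => u x + v x := by
  rw [memSobolevLoc_iff_sobolevChain hΩ hp] at *
  exact hu.memLpLoc_add hv

theorem sub (hΩ : IsOpen Ω) (hp : 1 ≤ p) (hu : MemSobolevLoc m p Ω u)
    (hv : MemSobolevLoc m p Ω v) : MemSobolevLoc m p Ω fun x => u x - v x := by
  convert hu.add hΩ hp (hv.smooth_mul hΩ hp (f := fun _ => -1) contDiffOn_const) using 2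
  ring

theorem zero : MemSobolevLoc m p Ω fun _ => 0 :=
  fun _ _ => ⟨_, hasWeakDeriv_zero, fun _ _ _ => MemLp.zero'⟩

theorem sum (hΩ : IsOpen Ω) (hp : 1 ≤ p) {ι : Type*} (t : Finset ι)
    {f : ι → EuclideanSpace ℝ (Fin n) → ℝ} (h : ∀ j ∈ t, MemSobolevLoc m p Ω (f j)) :
    MemSobolevLoc m p Ω fun x => ∑ j ∈ t, f j x := by
  classical
  induction t using Finset.induction_on with
  | empty => simpa using zero
  | insert a t ha ih =>
    simp_rw [Finset.sum_insert ha]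
    exact (h a (by simp)).add hΩ hp (ih fun j hj => h j (by simp [hj]))

theorem congr_ae (hΩ : IsOpen Ω) (hu : MemSobolevLoc m p Ω u)
    (h : u =ᵐ[volume.restrict Ω] v) : MemSobolevLoc m p Ω v := by
  intro L hL
  obtain ⟨w, hw, hw'⟩ := hu L hL
  exact ⟨w, hw.congr_ae hΩ h (ae_eq_refl _), hw'⟩

theorem locallyIntegrableOn (hu : MemSobolevLoc m p Ω u) : LocallyIntegrableOn u Ω := by
  obtain ⟨w, hw, -⟩ := hu [] (Nat.zero_le _)
  exact hw.1

theorem memLp (hΩ : IsOpen Ω) (hp : 1 ≤ p) (hu : MemSobolevLoc m p Ω u)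
    {K : Set (EuclideanSpace ℝ (Fin n))} (hKΩ : K ⊆ Ω) (hK : IsCompact K) :
    MemLp u (ENNReal.ofReal p) (volume.restrict K) :=
  ((memSobolevLoc_iff_sobolevChain hΩ hp).1 hu).prop K hKΩ hK

theorem exists_hasWeakDeriv_pair (hΩ : IsOpen Ω) (hp : 1 ≤ p)
    (hu : MemSobolevLoc (m + 2) p Ω u) (e c : Fin n) :
    ∃ w, HasWeakDeriv Ω [e, c] u w ∧ MemSobolevLoc m p Ω w := by
  rw [memSobolevLoc_iff_sobolevChain hΩ hp] at hu
  obtain ⟨v, hv, hv'⟩ := hu.2 e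
  obtain ⟨w, hw, hw'⟩ := hv'.2 c
  exact ⟨w, hv.cons hw, (memSobolevLoc_iff_sobolevChain hΩ hp).2 hw'.memLpLoc_index⟩

end MemSobolevLoc

end LocalSobolev

/-! ### Weak derivatives under dilations -/

section Scaling

variable {n : ℕ}

theorem ae_comp_smul {E : Type*} [NormedAddCommGroup E] [NormedSpace ℝ E] [MeasurableSpace E]
    [BorelSpace E] [FiniteDimensional ℝ E] {μ : Measure E} [μ.IsAddHaarMeasure] {P : E → Prop}
    (h : ∀ᵐ x ∂μ, P x) {t : ℝ} (ht : t ≠ 0) : ∀ᵐ x ∂μ, P (t • x) := by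
  rw [ae_iff] at *
  have := Measure.addHaar_preimage_smul μ ht {x | ¬ P x}
  rw [h, mul_zero] at this
  exact this

theorem multiDeriv_comp_smul {L : List (Fin n)} {φ : EuclideanSpace ℝ (Fin n) → ℝ}
    (hφ : ContDiff ℝ (⊤ : ℕ∞) φ) (t : ℝ) :
    multiDeriv L (fun x => φ (t • x)) = fun x => t ^ L.length * multiDeriv L φ (t • x) := by
  have hL : ∀ L : List (Fin n), ContDiff ℝ (⊤ : ℕ∞) (multiDeriv L φ) := by
    intro L
    induction L with
    | nil => exact hφ
    | cons i L ih => exact ih.pderiv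
  induction L with
  | nil => simp [multiDeriv]
  | cons i L ih =>
    change pderiv i (multiDeriv L fun x => φ (t • x)) = _
    rw [ih]
    ext x
    have h1 : DifferentiableAt ℝ (fun x => multiDeriv L φ (t • x)) x :=
      ((hL L).comp (contDiff_const_smul t)).differentiable (by simp) x
    have h2 := fderiv_comp_smul (𝕜 := ℝ) (f := multiDeriv L φ) (x := x) t
    rw [pderiv, fderiv_const_mul h1, h2]
    simp only [_root_.smul_apply, smul_eq_mul, List.length_cons, pow_succ]
    rw [mul_assoc]
    rfl

theorem IsTest.comp_smul {φ : EuclideanSpace ℝ (Fin n) → ℝ} (h : IsTest {0}ᶜ φ) {t : ℝ}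
    (ht : t ≠ 0) : IsTest {0}ᶜ fun x => φ (t • x) := by
  refine ⟨h.contDiff.comp (contDiff_const_smul t),
    h.hasCompactSupport.comp_homeomorph (Homeomorph.smulOfNeZero t ht), ?_⟩
  have h1 := tsupport_comp_subset_preimage φ (continuous_const_smul (T := EuclideanSpace ℝ (Fin n)) t)
  intro x hx
  have h2 := h.tsupport_subset (h1 hx)
  rintro rfl
  simp at h2

theorem MeasureTheory.LocallyIntegrableOn.comp_smul {u : EuclideanSpace ℝ (Fin n) → ℝ}
    (hu : LocallyIntegrableOn u {0}ᶜ) {t : ℝ} (ht : t ≠ 0) :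
    LocallyIntegrableOn (fun x => u (t • x)) {0}ᶜ := by
  rw [locallyIntegrableOn_iff_isCompact isOpen_compl_singleton] at *
  intro K hK0 hK
  have h1 := hu ((fun x => t • x) '' K) (by
    rintro _ ⟨x, hx, rfl⟩
    have := hK0 hx
    simpa [ht] using this) (hK.image (continuous_const_smul t))
  rw [← integrable_indicator_iff (hK.image (continuous_const_smul t)).measurableSet] at h1
  rw [← integrable_indicator_iff hK.measurableSet]
  have h2 := (integrable_comp_smul_iff volume _ ht).2 h1
  refine h2.congr (Eventually.of_forall fun x => ?_)
  have hinj : Function.Injective fun x : EuclideanSpace ℝ (Fin n) => t • x := smul_right_injective _ ht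
  by_cases hx : x ∈ K
  · simp only [indicator_of_mem hx]
    rw [indicator_of_mem (mem_image_of_mem _ hx)]
  · simp only [indicator_of_notMem hx]
    rw [indicator_of_notMem]
    rintro ⟨y, hy, hyx⟩
    exact hx (hinj hyx ▸ hy)

/-- Change of variables, moving the dilation onto the test function as its inverse. -/
theorem HasWeakDeriv.comp_smul {L : List (Fin n)} {u v : EuclideanSpace ℝ (Fin n) → ℝ}
    (h : HasWeakDeriv {0}ᶜ L u v) {t : ℝ} (ht : t ≠ 0) :
    HasWeakDeriv {0}ᶜ L (fun x => u (t • x)) fun x => t ^ L.length * v (t • x) := by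
  refine ⟨h.1.comp_smul ht, (h.2.1.comp_smul ht).smul (t ^ L.length), fun φ h1 h2 h3 => ?_⟩
  have hφ : IsTest {0}ᶜ φ := ⟨h1, h2, h3⟩
  have h4 := h.integral_eq (hφ.comp_smul (inv_ne_zero ht))
  rw [multiDeriv_comp_smul h1] at h4
  have e1 : ∫ x, u (t • x) * multiDeriv L φ x =
      |(t ^ Module.finrank ℝ (EuclideanSpace ℝ (Fin n)))⁻¹| •
        ∫ x, u x * multiDeriv L φ (t⁻¹ • x) := by
    rw [← Measure.integral_comp_smul]
    simp_rw [inv_smul_smul₀ ht]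
  have e2 : ∫ x, v (t • x) * φ x =
      |(t ^ Module.finrank ℝ (EuclideanSpace ℝ (Fin n)))⁻¹| • ∫ x, v x * φ (t⁻¹ • x) := by
    rw [← Measure.integral_comp_smul]
    simp_rw [inv_smul_smul₀ ht]
  simp_rw [mul_left_comm (u _)] at h4
  rw [integral_const_mul, inv_pow, inv_mul_eq_iff_eq_mul₀ (pow_ne_zero _ ht)] at h4
  simp_rw [mul_assoc]
  rw [integral_const_mul, e1, e2, h4, smul_eq_mul, smul_eq_mul]
  ring

/-- The dilated function and `t^q u` coincide, so uniqueness of weak derivatives applies to them.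
The exceptional null set depends on `t`. -/
theorem HasWeakDeriv.ae_homogeneous [NeZero n] {L : List (Fin n)} {u v : EuclideanSpace ℝ (Fin n) → ℝ}
    (h : HasWeakDeriv {0}ᶜ L u v) {q : ℝ} {t : ℝ} (ht : 0 < t)
    (hu : ∀ x, x ≠ 0 → u (t • x) = t ^ q * u x) :
    ∀ᵐ x, v (t • x) = t ^ (q - L.length) * v x := by
  have h1 := HasWeakDeriv.ae_unique isOpen_compl_singleton
    ((ae_restrict_iff' (measurableSet_singleton _).compl).2 (Eventually.of_forall hu))
    (h.comp_smul ht.ne') (h.const_mul (t ^ q))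
  rw [restrict_compl_singleton] at h1
  filter_upwards [h1] with x hx
  rw [Real.rpow_sub ht, Real.rpow_natCast, div_mul_eq_mul_div, ← hx,
    mul_div_cancel_left₀ _ (pow_pos ht _).ne']

end Scaling

/-! ### Functions on the sphere and polar coordinates -/

section Sphere

variable {n : ℕ}

theorem sphereExt_eq (ζ : Metric.sphere (0 : EuclideanSpace ℝ (Fin n)) 1 → ℝ)
    (x : ({0}ᶜ : Set (EuclideanSpace ℝ (Fin n)))) :
    sphereExt ζ x = ζ (homeomorphUnitSphereProd _ x).1 := by
  have hx : (x : EuclideanSpace ℝ (Fin n)) ≠ 0 := x.2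
  rw [sphereExt, dif_neg hx]
  congr 1
  ext1
  simp

/-- A function that is homogeneous of degree zero a.e. comes from a function on the sphere. -/
theorem exists_sphereExt_ae_eq [NeZero n] {Z : EuclideanSpace ℝ (Fin n) → ℝ}
    (hZ : AEStronglyMeasurable Z) (h : ∀ t : ℝ, 0 < t → ∀ᵐ x, Z (t • x) = Z x) :
    ∃ ζ : Metric.sphere (0 : EuclideanSpace ℝ (Fin n)) 1 → ℝ,
      StronglyMeasurable ζ ∧ sphereExt ζ =ᵐ[volume] Z := by
  obtain ⟨Z', hZ', hZZ'⟩ := hZ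
  -- The sphere is a null set, so restricting to it makes no sense for an a.e. class. Instead
  -- average along each ray over `(1, 2]`, an interval of length one.
  refine ⟨fun ω => ∫ s in Ioc (1 : ℝ) 2, Z' (s • (ω : EuclideanSpace ℝ (Fin n))), ?_, ?_⟩
  · exact StronglyMeasurable.integral_prod_right
      (f := fun (ω : Metric.sphere (0 : EuclideanSpace ℝ (Fin n)) 1) (s : ℝ) =>
        Z' (s • (ω : EuclideanSpace ℝ (Fin n)))) (hZ'.comp_measurable
          (g := fun z : Metric.sphere (0 : EuclideanSpace ℝ (Fin n)) 1 × ℝ =>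
            z.2 • (z.1 : EuclideanSpace ℝ (Fin n))) (by fun_prop))
  · have h1 : ∀ᵐ t : ℝ, ∀ᵐ x, 0 < t → Z' (t • x) = Z' x := by
      refine Eventually.of_forall fun t => ?_
      by_cases ht : 0 < t
      · filter_upwards [h t ht, hZZ', ae_comp_smul hZZ' ht.ne'] with x h1 h2 h3 _
        rw [← h2, ← h3, h1]
      · exact Eventually.of_forall fun x hx => absurd hx ht
    -- Fubini turns "for every `t`, for a.e. `x`" into "for a.e. `x`, for a.e. `t`", so that almost
    -- every ray can be treated by itself.
    rw [Measure.ae_ae_comm] at h1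
    swap
    · have h2 : MeasurableSet {z : ℝ × EuclideanSpace ℝ (Fin n) | Z' (z.1 • z.2) = Z' z.2} :=
        measurableSet_eq_fun (hZ'.measurable.comp (by fun_prop))
          (hZ'.measurable.comp measurable_snd)
      have h3 : MeasurableSet {z : ℝ × EuclideanSpace ℝ (Fin n) | ¬ 0 < z.1} :=
        (measurableSet_lt measurable_const measurable_fst).compl
      convert h3.union h2 using 1
      ext z
      simp only [mem_ofPred_eq, mem_union]
      tauto
    filter_upwards [h1, hZZ', Measure.ae_ne volume (0 : EuclideanSpace ℝ (Fin n))] with x hx hx' hx0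
    have hn0 : 0 < ‖x‖⁻¹ := inv_pos.2 (norm_pos_iff.2 hx0)
    rw [sphereExt, dif_neg hx0, hx']
    have h2 : ∀ᵐ s : ℝ ∂volume.restrict (Ioc 1 2), Z' (s • ‖x‖⁻¹ • x) = Z' x := by
      refine (ae_restrict_iff' measurableSet_Ioc).2 ?_
      filter_upwards [ae_comp_smul hx hn0.ne'] with s hs hs'
      rw [smul_smul, mul_comm]
      exact hs (mul_pos hn0 (by linarith [hs'.1]))
    rw [integral_congr_ae h2]
    norm_num

instance : IsFiniteMeasure (sphereMeasure n) :=
  inferInstanceAs (IsFiniteMeasure (volume : Measure (EuclideanSpace ℝ (Fin n))).toSphere)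

/-- Polar coordinates: off the origin, Lebesgue measure is the product of the surface measure and
`r^{n-1} dr`. -/
theorem integral_mul_sphereExt [NeZero n] (h : ℝ → ℝ)
    (ζ : Metric.sphere (0 : EuclideanSpace ℝ (Fin n)) 1 → ℝ) :
    ∫ x, sphereExt ζ x * h ‖x‖ = (∫ ω, ζ ω ∂(sphereMeasure n)) *
      ∫ r : Ioi (0 : ℝ), h r ∂(Measure.volumeIoiPow
        (Module.finrank ℝ (EuclideanSpace ℝ (Fin n)) - 1)) :=
  calc
    ∫ x, sphereExt ζ x * h ‖x‖ = ∫ x : ({0}ᶜ : Set (EuclideanSpace ℝ (Fin n))),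
        sphereExt ζ x * h ‖x.1‖ ∂(volume.comap Subtype.val) := by
      rw [integral_subtype_comap (measurableSet_singleton _).compl
        fun x => sphereExt ζ x * h ‖x‖, restrict_compl_singleton]
    _ = ∫ z, ζ z.1 * h z.2 ∂(sphereMeasure n).prod (.volumeIoiPow
        (Module.finrank ℝ (EuclideanSpace ℝ (Fin n)) - 1)) := by
      simp_rw [sphereExt_eq]
      simpa [sphereMeasure] using (volume : Measure (EuclideanSpace ℝ (Fin n))).measurePreserving_homeomorphUnitSphereProd.integral_comp
        (Homeomorph.measurableEmbedding _) fun z => ζ z.1 * h z.2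
    _ = _ := integral_prod_mul ζ fun r : Ioi (0 : ℝ) => h r

theorem lintegral_mul_sphereExt [NeZero n] {h : ℝ → ℝ≥0∞} (hh : Measurable h) {F : ℝ → ℝ≥0∞}
    (hF : Measurable F) {ζ : Metric.sphere (0 : EuclideanSpace ℝ (Fin n)) 1 → ℝ}
    (hζ : StronglyMeasurable ζ) :
    ∫⁻ x, F (sphereExt ζ x) * h ‖x‖ = (∫⁻ ω, F (ζ ω) ∂(sphereMeasure n)) *
      ∫⁻ r : Ioi (0 : ℝ), h r ∂(Measure.volumeIoiPow
        (Module.finrank ℝ (EuclideanSpace ℝ (Fin n)) - 1)) :=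
  calc
    ∫⁻ x, F (sphereExt ζ x) * h ‖x‖ = ∫⁻ x : ({0}ᶜ : Set (EuclideanSpace ℝ (Fin n))),
        F (sphereExt ζ x) * h ‖x.1‖ ∂(volume.comap Subtype.val) := by
      rw [lintegral_subtype_comap (measurableSet_singleton _).compl
        fun x => F (sphereExt ζ x) * h ‖x‖, restrict_compl_singleton]
    _ = ∫⁻ z, F (ζ z.1) * h z.2 ∂(sphereMeasure n).prod (.volumeIoiPow
        (Module.finrank ℝ (EuclideanSpace ℝ (Fin n)) - 1)) := by
      simp_rw [sphereExt_eq]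
      simpa [sphereMeasure] using (volume : Measure (EuclideanSpace ℝ (Fin n))).measurePreserving_homeomorphUnitSphereProd.lintegral_comp_emb
        (Homeomorph.measurableEmbedding _) fun z => F (ζ z.1) * h z.2
    _ = _ := lintegral_prod_mul (f := fun ω => F (ζ ω)) (g := fun r : Ioi (0 : ℝ) => h r)
      (hF.comp hζ.measurable).aemeasurable
      (hh.comp measurable_subtype_coe).aemeasurable

/-- Integrals over the sphere are bounded by integrals over an annulus. -/
theorem exists_lintegral_sphere_eq [NeZero n] : ∃ c : ℝ≥0∞, c ≠ 0 ∧ ∀ F : ℝ → ℝ≥0∞, Measurable F →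
    ∀ ζ : Metric.sphere (0 : EuclideanSpace ℝ (Fin n)) 1 → ℝ, StronglyMeasurable ζ →
      (∫⁻ ω, F (ζ ω) ∂(sphereMeasure n)) * c =
        ∫⁻ x in {x : EuclideanSpace ℝ (Fin n) | ‖x‖ ∈ Icc 1 2}, F (sphereExt ζ x) := by
  have hA : MeasurableSet {x : EuclideanSpace ℝ (Fin n) | ‖x‖ ∈ Icc (1 : ℝ) 2} :=
    measurableSet_Icc.preimage measurable_norm
  have hh : Measurable ((Icc (1 : ℝ) 2).indicator fun _ => (1 : ℝ≥0∞)) :=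
    measurable_const.indicator measurableSet_Icc
  have key : ∀ F : ℝ → ℝ≥0∞, Measurable F →
    ∀ ζ : Metric.sphere (0 : EuclideanSpace ℝ (Fin n)) 1 → ℝ, StronglyMeasurable ζ →
      (∫⁻ ω, F (ζ ω) ∂(sphereMeasure n)) * (∫⁻ r : Ioi (0 : ℝ),
          (Icc (1 : ℝ) 2).indicator (fun _ => (1 : ℝ≥0∞)) r ∂(Measure.volumeIoiPow
        (Module.finrank ℝ (EuclideanSpace ℝ (Fin n)) - 1))) =
        ∫⁻ x in {x : EuclideanSpace ℝ (Fin n) | ‖x‖ ∈ Icc (1 : ℝ) 2}, F (sphereExt ζ x) := by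
    intro F hF ζ hζ
    rw [← lintegral_mul_sphereExt hh hF hζ, ← lintegral_indicator hA]
    refine lintegral_congr fun x => ?_
    by_cases hx : ‖x‖ ∈ Icc (1 : ℝ) 2
    · rw [indicator_of_mem hx, indicator_of_mem (by exact hx), mul_one]
    · rw [indicator_of_notMem hx, indicator_of_notMem (by exact hx), mul_zero]
  -- The constant is the radial mass of `[1, 2]`. Were it zero, testing with `F = 1` would make the
  -- annulus a null set.
  refine ⟨_, fun h0 => ?_, key⟩
  have h1 := key (fun _ => 1) measurable_const (fun _ => 0) stronglyMeasurable_const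
  rw [h0, mul_zero, setLIntegral_one] at h1
  have h2 : IsOpen {x : EuclideanSpace ℝ (Fin n) | ‖x‖ ∈ Ioo (1 : ℝ) 2} :=
    isOpen_Ioo.preimage continuous_norm
  have h3 : {x : EuclideanSpace ℝ (Fin n) | ‖x‖ ∈ Ioo (1 : ℝ) 2}.Nonempty := by
    refine ⟨EuclideanSpace.single 0 (3 / 2), ?_⟩
    simp only [mem_ofPred_eq, PiLp.norm_single]
    norm_num
  refine (h2.measure_pos volume h3).ne' (measure_mono_null (fun x hx => ?_) h1.symm)
  exact Ioo_subset_Icc_self hx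

theorem isCompact_annulus : IsCompact {x : EuclideanSpace ℝ (Fin n) | ‖x‖ ∈ Icc (1 : ℝ) 2} := by
  refine (isCompact_closedBall (0 : EuclideanSpace ℝ (Fin n)) 2).of_isClosed_subset
    (isClosed_Icc.preimage continuous_norm) fun x hx => ?_
  simpa using hx.2

theorem annulus_subset : {x : EuclideanSpace ℝ (Fin n) | ‖x‖ ∈ Icc (1 : ℝ) 2} ⊆ {0}ᶜ := by
  rintro x hx rfl
  have := hx.1
  norm_num at this

theorem memSobolevSphere_of_stronglyMeasurable [NeZero n] {p : ℝ} (hp : 1 ≤ p) {m : ℕ}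
    {ζ : Metric.sphere (0 : EuclideanSpace ℝ (Fin n)) 1 → ℝ} (hζ : StronglyMeasurable ζ)
    (h : MemSobolevLoc m p {0}ᶜ (sphereExt ζ)) : MemSobolevSphere m p ζ := by
  refine ⟨⟨hζ.aestronglyMeasurable, ?_⟩, h⟩
  have hp0 : 0 < p := by linarith
  have h1 : ENNReal.ofReal p ≠ 0 := by simpa using hp0
  have h2 := (h.memLp isOpen_compl_singleton hp annulus_subset isCompact_annulus).2
  rw [eLpNorm_lt_top_iff_lintegral_rpow_enorm_lt_top h1 ENNReal.ofReal_ne_top] at h2 ⊢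
  obtain ⟨c, hc, hF⟩ := exists_lintegral_sphere_eq (n := n)
  rw [← hF (fun y => ‖y‖ₑ ^ (ENNReal.ofReal p).toReal) (by fun_prop) ζ hζ] at h2
  exact ENNReal.lt_top_of_mul_ne_top_left h2.ne hc

theorem ae_eq_zero_of_sphereExt [NeZero n]
    {ζ : Metric.sphere (0 : EuclideanSpace ℝ (Fin n)) 1 → ℝ} (hζ : StronglyMeasurable ζ)
    (h : sphereExt ζ =ᵐ[volume] 0) : ζ =ᵐ[sphereMeasure n] 0 := by
  obtain ⟨c, hc, hF⟩ := exists_lintegral_sphere_eq (n := n)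
  have h1 := hF (fun y => ‖y‖ₑ) (by fun_prop) ζ hζ
  rw [lintegral_congr_ae (g := fun _ => 0) (ae_restrict_of_ae (h.mono fun x hx => by simp [hx])),
    lintegral_zero, mul_eq_zero, or_iff_left hc, lintegral_eq_zero_iff hζ.measurable.enorm] at h1
  exact h1.mono fun ω hω => by simpa using hω

end Sphere

/-! ### Vanishing of the spherical mean -/

section MeanValue

variable {n : ℕ}

theorem tsupport_subset_compl_zero {f : EuclideanSpace ℝ (Fin n) → ℝ}
    (h : ∀ x, ‖x‖ < 1 → f x = 0) : tsupport f ⊆ {0}ᶜ := by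
  rintro x hx rfl
  refine (notMem_tsupport_iff_eventuallyEq.2 ?_) hx
  filter_upwards [Metric.ball_mem_nhds (0 : EuclideanSpace ℝ (Fin n)) one_pos] with x hx
  exact h x (by simpa using hx)

/-- A radial cut-off function. -/
noncomputable def radialCutoff (x : EuclideanSpace ℝ (Fin n)) : ℝ :=
  Real.smoothTransition (2 - ‖x‖ ^ 2)

theorem contDiff_radialCutoff : ContDiff ℝ (⊤ : ℕ∞) (radialCutoff (n := n)) :=
  Real.smoothTransition.contDiff.comp (contDiff_const.sub (contDiff_norm_sq ℝ))

theorem radialCutoff_eq_one {x : EuclideanSpace ℝ (Fin n)} (hx : ‖x‖ ≤ 1) : radialCutoff x = 1 :=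
  Real.smoothTransition.one_of_one_le (by nlinarith [norm_nonneg x])

theorem hasCompactSupport_radialCutoff : HasCompactSupport (radialCutoff (n := n)) := by
  refine HasCompactSupport.intro (isCompact_closedBall 0 2) fun x hx => ?_
  refine Real.smoothTransition.zero_of_nonpos ?_
  have : 2 < ‖x‖ := by simpa using hx
  nlinarith

/-- The cut-off is constant near the origin, so its derivatives are test functions on the punctured
space although it is not one itself. -/
theorem isTest_pderiv_radialCutoff (i : Fin n) : IsTest {0}ᶜ (pderiv i radialCutoff) := by
  have h : IsTest univ (radialCutoff (n := n)) :=
    ⟨contDiff_radialCutoff, hasCompactSupport_radialCutoff, subset_univ _⟩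
  refine ⟨(h.pderiv i).contDiff, (h.pderiv i).hasCompactSupport,
    tsupport_subset_compl_zero fun x hx => ?_⟩
  have : radialCutoff =ᶠ[𝓝 x] fun _ => 1 := by
    filter_upwards [Metric.isOpen_ball.mem_nhds (show x ∈ Metric.ball 0 1 by simpa using hx)]
      with y hy
    exact radialCutoff_eq_one (by simpa using (mem_ball_zero_iff.1 hy).le)
  rw [pderiv, this.fderiv_eq]
  simp

/-- The difference of two radial cut-off functions: a test function on the punctured space. -/
noncomputable def annularCutoff (x : EuclideanSpace ℝ (Fin n)) : ℝ :=
  radialCutoff ((2 : ℝ)⁻¹ • x) - radialCutoff x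

theorem isTest_annularCutoff : IsTest {0}ᶜ (annularCutoff (n := n)) := by
  refine ⟨(contDiff_radialCutoff.comp (contDiff_const_smul _)).sub contDiff_radialCutoff,
    (hasCompactSupport_radialCutoff.comp_homeomorph
      (Homeomorph.smulOfNeZero (2 : ℝ)⁻¹ (by norm_num))).sub hasCompactSupport_radialCutoff,
    tsupport_subset_compl_zero fun x hx => ?_⟩
  rw [annularCutoff, radialCutoff_eq_one hx.le, radialCutoff_eq_one, sub_self]
  rw [norm_smul]
  norm_num
  linarith

theorem annularCutoff_nonneg (x : EuclideanSpace ℝ (Fin n)) : 0 ≤ annularCutoff x := by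
  refine sub_nonneg.2 (Real.smoothTransition.monotone ?_)
  have : ‖(2 : ℝ)⁻¹ • x‖ ≤ ‖x‖ := by
    rw [norm_smul]
    norm_num
    linarith [norm_nonneg x]
  gcongr

theorem pderiv_sub {f g : EuclideanSpace ℝ (Fin n) → ℝ} {i : Fin n}
    (hf : ContDiff ℝ (⊤ : ℕ∞) f) (hg : ContDiff ℝ (⊤ : ℕ∞) g) :
    pderiv i (fun x => f x - g x) = fun x => pderiv i f x - pderiv i g x := by
  ext x
  rw [pderiv, fderiv_fun_sub (hf.differentiable (by simp) x) (hg.differentiable (by simp) x)]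
  rfl

theorem multiDeriv_annularCutoff (e c : Fin n) (x : EuclideanSpace ℝ (Fin n)) :
    multiDeriv [e, c] annularCutoff x = 1 / 4 * multiDeriv [e, c] radialCutoff ((2 : ℝ)⁻¹ • x) -
      multiDeriv [e, c] radialCutoff x := by
  have h1 : ContDiff ℝ (⊤ : ℕ∞) fun x : EuclideanSpace ℝ (Fin n) =>
      radialCutoff ((2 : ℝ)⁻¹ • x) := contDiff_radialCutoff.comp (contDiff_const_smul _)
  have h2 : multiDeriv [e, c] (annularCutoff (n := n)) = fun x =>
      multiDeriv [e, c] (fun x => radialCutoff ((2 : ℝ)⁻¹ • x)) x -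
        multiDeriv [e, c] radialCutoff x := by
    change pderiv e (pderiv c fun _ => (_ - _)) = _
    rw [pderiv_sub h1 contDiff_radialCutoff, pderiv_sub h1.pderiv contDiff_radialCutoff.pderiv]
    rfl
  rw [h2, multiDeriv_comp_smul contDiff_radialCutoff]
  norm_num

/-- After integrating by parts twice, the two cut-offs in the difference contribute equally: under
`x = 2y` the factors `2^{-2}` from the derivatives, `2^n` from the volume and `2^{2-n}` from
homogeneity multiply to one. -/
theorem integral_mul_annularCutoff [NeZero n] {e c : Fin n}
    {u w : EuclideanSpace ℝ (Fin n) → ℝ} (h : HasWeakDeriv {0}ᶜ [e, c] u w)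
    (hu : ∀ t : ℝ, 0 < t → ∀ x, x ≠ 0 → u (t • x) = t ^ (2 - (n : ℝ)) * u x) :
    ∫ x, w x * annularCutoff x = 0 := by
  have h1 := h.integral_eq isTest_annularCutoff
  simp only [List.length_cons, List.length_nil, zero_add, Nat.reduceAdd, even_two,
    Even.neg_one_pow, one_mul] at h1
  rw [← h1]
  set θ := multiDeriv [e, c] (radialCutoff (n := n)) with hθ
  have hθt : IsTest {0}ᶜ θ := (isTest_pderiv_radialCutoff c).pderiv e
  have hi1 := hθt.integrable_mul h.1
  have hi2 := (hθt.comp_smul (t := (2 : ℝ)⁻¹) (by norm_num)).integrable_mul h.1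
  have e1 : ∀ x, u x * multiDeriv [e, c] annularCutoff x =
      1 / 4 * (u x * θ ((2 : ℝ)⁻¹ • x)) - u x * θ x := fun x => by
    rw [multiDeriv_annularCutoff]; ring
  simp_rw [e1]
  rw [integral_sub (hi2.const_mul _) hi1, integral_const_mul]
  have e2 : ∫ x, u x * θ ((2 : ℝ)⁻¹ • x) = 4 * ∫ x, u x * θ x := by
    have := Measure.integral_comp_inv_smul_of_nonneg (volume : Measure (EuclideanSpace ℝ (Fin n)))
      (fun y => u ((2 : ℝ) • y) * θ y) (R := 2) (by norm_num)
    simp only [smul_inv_smul₀ (two_ne_zero' ℝ)] at this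
    rw [this, integral_congr_ae (g := fun y => (2 : ℝ) ^ (2 - (n : ℝ)) * (u y * θ y)),
      integral_const_mul, smul_eq_mul, ← mul_assoc, finrank_euclideanSpace_fin,
      ← Real.rpow_natCast, ← Real.rpow_add two_pos]
    · norm_num
    · filter_upwards [Measure.ae_ne volume (0 : EuclideanSpace ℝ (Fin n))] with y hy
      rw [hu 2 two_pos y hy, mul_assoc]
  rw [e2]
  ring

theorem contDiffOn_norm_rpow (q : ℝ) :
    ContDiffOn ℝ (⊤ : ℕ∞) (fun x : EuclideanSpace ℝ (Fin n) => ‖x‖ ^ q) {0}ᶜ := fun _ hx =>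
  ((contDiffAt_norm ℝ hx).rpow_const_of_ne (norm_ne_zero_iff.2 hx)).contDiffWithinAt

/-- In polar coordinates the integral is the spherical integral of `ζ` times a radial one. The
radial factor is nonzero, as the same formula with `ζ = 1` computes the integral of a nonnegative
nonzero function. -/
theorem integral_sphere_eq_zero [NeZero n]
    {ζ : Metric.sphere (0 : EuclideanSpace ℝ (Fin n)) 1 → ℝ} {W : EuclideanSpace ℝ (Fin n) → ℝ}
    (hW : W =ᵐ[volume] fun x => ‖x‖ ^ (-(n : ℝ)) * sphereExt ζ x)
    (h : ∫ x, W x * annularCutoff x = 0) : ∫ ω, ζ ω ∂(sphereMeasure n) = 0 := by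
  set H : ℝ → ℝ := fun r => r ^ (-(n : ℝ)) *
    (Real.smoothTransition (2 - (2⁻¹ * r) ^ 2) - Real.smoothTransition (2 - r ^ 2)) with hH
  have e1 : ∀ x : EuclideanSpace ℝ (Fin n), H ‖x‖ = ‖x‖ ^ (-(n : ℝ)) * annularCutoff x := by
    intro x
    simp [hH, annularCutoff, radialCutoff, norm_smul]
  have h1 := integral_mul_sphereExt H ζ
  have h2 := integral_mul_sphereExt (n := n) H fun _ => 1
  have h3 : ∫ x, sphereExt ζ x * H ‖x‖ = 0 := by
    rw [← h]
    refine integral_congr_ae ?_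
    filter_upwards [hW] with x hx
    rw [hx, e1]
    ring
  have h4 : 0 < ∫ x : EuclideanSpace ℝ (Fin n), H ‖x‖ := by
    simp_rw [e1]
    have ht := isTest_annularCutoff.smooth_mul isOpen_compl_singleton
      (contDiffOn_norm_rpow (n := n) (-(n : ℝ)))
    -- At norm `3/2` the outer cut-off is one, since `3/4 ≤ 1`, and the inner one vanishes, since
    -- `9/4 ≥ 2`.
    refine ht.contDiff.continuous.integral_pos_of_hasCompactSupport_nonneg_nonzero
      (x := EuclideanSpace.single 0 (3 / 2)) ht.hasCompactSupport (fun x =>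
      mul_nonneg (Real.rpow_nonneg (norm_nonneg _) _) (annularCutoff_nonneg x)) ?_
    refine mul_ne_zero (Real.rpow_pos_of_pos ?_ _).ne' ?_
    · rw [PiLp.norm_single]; norm_num
    · rw [annularCutoff, radialCutoff_eq_one, radialCutoff,
        Real.smoothTransition.zero_of_nonpos]
      · norm_num
      · rw [PiLp.norm_single]; norm_num
      · rw [norm_smul, PiLp.norm_single]; norm_num
  have h5 : ∫ x : EuclideanSpace ℝ (Fin n), sphereExt (fun _ => 1) x * H ‖x‖ = ∫ x : EuclideanSpace ℝ (Fin n), H ‖x‖ := by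
    refine integral_congr_ae ?_
    filter_upwards [Measure.ae_ne volume (0 : EuclideanSpace ℝ (Fin n))] with x hx
    rw [sphereExt, dif_neg hx, one_mul]
  rw [h3] at h1
  rw [h5] at h2
  refine (mul_eq_zero.1 h1.symm).resolve_right fun h0 => ?_
  rw [h0, mul_zero] at h2
  exact h4.ne' h2

end MeanValue

/-! ### Derivatives of powers of the norm -/

section Harmonic

variable {n : ℕ}

theorem hasFDerivAt_norm_rpow_of_ne {x : EuclideanSpace ℝ (Fin n)} (hx : x ≠ 0) (q : ℝ) :
    HasFDerivAt (fun y : EuclideanSpace ℝ (Fin n) => ‖y‖ ^ q)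
      ((q * ‖x‖ ^ (q - 2)) • innerSL ℝ x) x := by
  have h0 : 0 < ‖x‖ := norm_pos_iff.2 hx
  have h1 : HasFDerivAt (fun y : EuclideanSpace ℝ (Fin n) => ‖y‖ ^ 2) (2 • innerSL ℝ x) x :=
    (hasStrictFDerivAt_norm_sq x).hasFDerivAt
  have h2 := h1.rpow_const (p := q / 2) (Or.inl (by positivity))
  have e : ∀ (y : EuclideanSpace ℝ (Fin n)) (s : ℝ), (‖y‖ ^ 2) ^ s = ‖y‖ ^ (2 * s) := fun y s => by
    rw [← Real.rpow_natCast, ← Real.rpow_mul (norm_nonneg y)]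
    norm_num
  simp_rw [e] at h2
  rw [show 2 * (q / 2) = q by ring, show 2 * (q / 2 - 1) = q - 2 by ring] at h2
  refine h2.congr_fderiv ?_
  rw [← Nat.cast_smul_eq_nsmul ℝ, smul_smul]
  congr 1
  push_cast
  ring

theorem pderiv_norm_rpow {x : EuclideanSpace ℝ (Fin n)} (hx : x ≠ 0) (q : ℝ) (i : Fin n) :
    pderiv i (fun y : EuclideanSpace ℝ (Fin n) => ‖y‖ ^ q) x = q * ‖x‖ ^ (q - 2) * x i := by
  rw [pderiv, (hasFDerivAt_norm_rpow_of_ne hx q).fderiv]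
  simp [EuclideanSpace.inner_single_right]

theorem pderiv_pderiv_norm_rpow {x : EuclideanSpace ℝ (Fin n)} (hx : x ≠ 0) (q : ℝ) (i : Fin n) :
    pderiv i (pderiv i fun y : EuclideanSpace ℝ (Fin n) => ‖y‖ ^ q) x =
      q * ((q - 2) * ‖x‖ ^ (q - 2 - 2) * x i ^ 2 + ‖x‖ ^ (q - 2)) := by
  have h1 : pderiv i (fun y : EuclideanSpace ℝ (Fin n) => ‖y‖ ^ q) =ᶠ[𝓝 x]
      fun y => q * (‖y‖ ^ (q - 2) * y i) := by
    filter_upwards [isOpen_compl_singleton.mem_nhds (show x ∈ ({0}ᶜ : Set _) from hx)] with y hy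
    rw [pderiv_norm_rpow hy]
    ring
  have h2 : HasFDerivAt (fun y : EuclideanSpace ℝ (Fin n) => y i)
      (EuclideanSpace.proj i : EuclideanSpace ℝ (Fin n) →L[ℝ] ℝ) x :=
    (EuclideanSpace.proj i : EuclideanSpace ℝ (Fin n) →L[ℝ] ℝ).hasFDerivAt
  have h3 := (((hasFDerivAt_norm_rpow_of_ne hx (q - 2)).mul h2).const_mul q)
  replace h3 : HasFDerivAt (fun y : EuclideanSpace ℝ (Fin n) => q * (‖y‖ ^ (q - 2) * y i)) _ x := h3
  rw [pderiv, h1.fderiv_eq, h3.fderiv]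
  simp [EuclideanSpace.inner_single_right]
  ring

/-- `‖x‖ ^ (2 - n)` is harmonic. -/
theorem sum_pderiv_pderiv_norm_rpow {x : EuclideanSpace ℝ (Fin n)} (hx : x ≠ 0) :
    ∑ i, pderiv i (pderiv i fun y : EuclideanSpace ℝ (Fin n) => ‖y‖ ^ (2 - (n : ℝ))) x = 0 := by
  have h0 : 0 < ‖x‖ := norm_pos_iff.2 hx
  simp_rw [pderiv_pderiv_norm_rpow hx]
  rw [← Finset.mul_sum, Finset.sum_add_distrib, ← Finset.mul_sum, ← EuclideanSpace.real_norm_sq_eq]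
  rw [Finset.sum_const, Finset.card_univ, Fintype.card_fin, nsmul_eq_mul, mul_assoc,
    ← Real.rpow_natCast ‖x‖ 2, ← Real.rpow_add h0]
  norm_num

end Harmonic

/-! ### The homogeneous leading term -/

section HomogeneousPart

variable {n : ℕ} {p : ℝ} {m : ℕ}

/-- The linearised scalar curvature of a perturbation that is homogeneous of degree `2 - n`. -/
theorem exists_sphere_curvature [NeZero n] (hp : 1 ≤ p)
    {β : EuclideanSpace ℝ (Fin n) → Matrix (Fin n) (Fin n) ℝ}
    (hβ : ∀ a b, MemSobolevLoc (m + 2) p {0}ᶜ fun x => β x a b)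
    (hβ_hom : ∀ t : ℝ, 0 < t → ∀ x, x ≠ 0 → β (t • x) = β x) :
    ∃ (ζ : Metric.sphere (0 : EuclideanSpace ℝ (Fin n)) 1 → ℝ)
      (w : Fin n → Fin n → Fin n → Fin n → EuclideanSpace ℝ (Fin n) → ℝ),
      (∀ e c a b, HasWeakDeriv {0}ᶜ [e, c] (fun x => ‖x‖ ^ (2 - (n : ℝ)) * β x a b) (w e c a b)) ∧
      (∀ᵐ x, ∑ a, ∑ c, (w c a a c x - w c c a a x) = ‖x‖ ^ (-(n : ℝ)) * sphereExt ζ x) ∧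
      MemSobolevSphere m p ζ ∧ ∫ ω, ζ ω ∂(sphereMeasure n) = 0 ∧
      ((∃ c : ℝ, ∀ᵐ x, β x = c • (1 : Matrix (Fin n) (Fin n) ℝ)) →
        ζ =ᵐ[sphereMeasure n] 0) := by
  have hΩ : IsOpen ({0}ᶜ : Set (EuclideanSpace ℝ (Fin n))) := isOpen_compl_singleton
  have hB : ∀ a b, MemSobolevLoc (m + 2) p {0}ᶜ fun x => ‖x‖ ^ (2 - (n : ℝ)) * β x a b :=
    fun a b => (hβ a b).smooth_mul hΩ hp (contDiffOn_norm_rpow _)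
  have hBhom : ∀ a b, ∀ t : ℝ, 0 < t → ∀ x : EuclideanSpace ℝ (Fin n), x ≠ 0 →
      ‖t • x‖ ^ (2 - (n : ℝ)) * β (t • x) a b =
        t ^ (2 - (n : ℝ)) * (‖x‖ ^ (2 - (n : ℝ)) * β x a b) := by
    intro a b t ht x hx
    rw [hβ_hom t ht x hx, norm_smul, Real.norm_of_nonneg ht.le,
      Real.mul_rpow ht.le (norm_nonneg x), mul_assoc]
  choose w hw hwm using fun e c a b => (hB a b).exists_hasWeakDeriv_pair hΩ hp e c
  set W : EuclideanSpace ℝ (Fin n) → ℝ := fun x => ∑ a, ∑ c, (w c a a c x - w c c a a x) with hWdef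
  have hWm : MemSobolevLoc m p {0}ᶜ W := MemSobolevLoc.sum hΩ hp _ fun a _ =>
    MemSobolevLoc.sum hΩ hp _ fun c _ => (hwm c a a c).sub hΩ hp (hwm c c a a)
  have hWhom : ∀ t : ℝ, 0 < t → ∀ᵐ x, W (t • x) = t ^ (-(n : ℝ)) * W x := by
    intro t ht
    have h1 : ∀ e c a b, ∀ᵐ x, w e c a b (t • x) = t ^ (-(n : ℝ)) * w e c a b x := by
      intro e c a b
      filter_upwards [(hw e c a b).ae_homogeneous ht (hBhom a b t ht)] with x hx
      rw [hx]
      congr 2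
      simp
    simp only [← ae_all_iff] at h1
    filter_upwards [h1] with x hx
    simp only [hWdef, hx, Finset.mul_sum, mul_sub]
  -- `W` is homogeneous of degree `-n`, so this normalisation has degree zero and descends to the
  -- sphere.
  set Z : EuclideanSpace ℝ (Fin n) → ℝ := fun x => ‖x‖ ^ (n : ℝ) * W x with hZdef
  have hZm : MemSobolevLoc m p {0}ᶜ Z := hWm.smooth_mul hΩ hp (contDiffOn_norm_rpow _)
  have hZmeas : AEStronglyMeasurable Z := by
    have := hZm.locallyIntegrableOn.aestronglyMeasurable
    rwa [restrict_compl_singleton] at this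
  obtain ⟨ζ, hζ, hζZ⟩ := exists_sphereExt_ae_eq hZmeas (by
    intro t ht
    filter_upwards [hWhom t ht] with x hx
    rw [hZdef]
    dsimp only
    rw [hx, norm_smul, Real.norm_of_nonneg ht.le, Real.mul_rpow ht.le (norm_nonneg x),
      Real.rpow_neg ht.le]
    field_simp)
  have hWζ : ∀ᵐ x, W x = ‖x‖ ^ (-(n : ℝ)) * sphereExt ζ x := by
    filter_upwards [hζZ, Measure.ae_ne volume (0 : EuclideanSpace ℝ (Fin n))] with x hx hx0
    rw [hx, hZdef]
    dsimp only
    rw [← mul_assoc, ← Real.rpow_add (norm_pos_iff.2 hx0), neg_add_cancel, Real.rpow_zero, one_mul]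
  refine ⟨ζ, w, hw, hWζ, ?_, ?_, ?_⟩
  · exact memSobolevSphere_of_stronglyMeasurable hp hζ
      (hZm.congr_ae hΩ (ae_restrict_of_ae hζZ.symm))
  · refine integral_sphere_eq_zero hWζ ?_
    have hi : ∀ e c a b, Integrable fun x => w e c a b x * annularCutoff x := fun e c a b =>
      isTest_annularCutoff.integrable_mul (hw e c a b).2.1
    have h0 : ∀ e c a b, ∫ x, w e c a b x * annularCutoff x = 0 := fun e c a b =>
      integral_mul_annularCutoff (hw e c a b) (hBhom a b)
    simp_rw [hWdef, Finset.sum_mul, sub_mul]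
    have hd : ∀ a c, Integrable fun x =>
        w c a a c x * annularCutoff x - w c c a a x * annularCutoff x :=
      fun a c => (hi c a a c).sub (hi c c a a)
    rw [integral_finsetSum _ fun a _ => integrable_finsetSum _ fun c _ => hd a c]
    refine Finset.sum_eq_zero fun a _ => ?_
    rw [integral_finsetSum _ fun c _ => hd a c]
    refine Finset.sum_eq_zero fun c _ => ?_
    rw [integral_sub (hi _ _ _ _) (hi _ _ _ _), h0, h0, sub_self]
  · rintro ⟨c₀, hc₀⟩
    refine ae_eq_zero_of_sphereExt hζ (hζZ.trans ?_)
    set f : EuclideanSpace ℝ (Fin n) → ℝ := fun x => ‖x‖ ^ (2 - (n : ℝ)) with hf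
    have hfs : ContDiffOn ℝ (⊤ : ℕ∞) f {0}ᶜ := contDiffOn_norm_rpow _
    have hfd : ∀ e c, HasWeakDeriv {0}ᶜ [e, c] f (pderiv c (pderiv e f)) := fun e c =>
      (hasWeakDeriv_pderiv hΩ (hfs.of_le (by exact_mod_cast le_top)) e).cons
        (hasWeakDeriv_pderiv hΩ ((contDiffOn_pderiv hΩ hfs e).of_le (by exact_mod_cast le_top)) c)
    have h1 : ∀ e c a b, ∀ᵐ x, w e c a b x =
        c₀ * (1 : Matrix (Fin n) (Fin n) ℝ) a b * pderiv c (pderiv e f) x := by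
      intro e c a b
      have h2 := HasWeakDeriv.ae_unique hΩ (ae_restrict_of_ae (hc₀.mono fun x hx => ?_))
        (hw e c a b) ((hfd e c).const_mul (c₀ * (1 : Matrix (Fin n) (Fin n) ℝ) a b))
      · rwa [restrict_compl_singleton] at h2
      · simp only [hx, Matrix.smul_apply, smul_eq_mul, hf]
        ring
    simp only [← ae_all_iff] at h1
    filter_upwards [h1, Measure.ae_ne volume (0 : EuclideanSpace ℝ (Fin n))] with x hx hx0
    have h3 := sum_pderiv_pderiv_norm_rpow hx0
    -- For `β = c₀ δ` the double divergence gives `c₀ Δf` and the Laplacian of the trace gives `n c₀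
    -- Δf`; both vanish because `f` is harmonic.
    simp only [hZdef, hWdef, hx, Matrix.one_apply, Pi.zero_apply, mul_ite, mul_one, mul_zero,
      ite_mul, zero_mul, Finset.sum_sub_distrib, Finset.sum_ite_eq, Finset.mem_univ, if_true,
      ← Finset.mul_sum]
    rw [h3]
    simp

end HomogeneousPart

/-! ### Weighted Sobolev spaces and the linearised curvature -/

section WeightedSobolev

variable {n : ℕ} {p : ℝ} {m : ℕ} {δ δ' : ℝ} {u v : EuclideanSpace ℝ (Fin n) → ℝ}

theorem MemWeightedSobolev.mono (hp : 1 < p) (hn : 0 < n) (h : MemWeightedSobolev m p δ u)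
    (hδ : δ ≤ δ') : MemWeightedSobolev m p δ' u :=
  ((h.memSobolevScale hp hn).mono le_rfl hδ).memWeightedSobolev hp

theorem MemWeightedSobolev.add (hp : 1 < p) (hn : 0 < n) (hu : MemWeightedSobolev m p δ u)
    (hv : MemWeightedSobolev m p δ v) : MemWeightedSobolev m p δ fun x => u x + v x :=
  ((hu.memSobolevScale hp hn).add (hv.memSobolevScale hp hn)).memWeightedSobolev hp

theorem MemWeightedSobolev.hasWeakDeriv_weakDeriv {L : List (Fin n)}
    (hu : MemWeightedSobolev m p δ u) (hL : L.length ≤ m) :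
    HasWeakDeriv univ L u (_root_.weakDeriv L u) := by
  obtain ⟨v, hv, -⟩ := hu L hL
  exact hv.weakDeriv

theorem memWeightedSobolev_linearCurvature (hp : 1 < p) (hn : 0 < n)
    {γ : EuclideanSpace ℝ (Fin n) → Matrix (Fin n) (Fin n) ℝ}
    (h : ∀ a b, MemWeightedSobolev (m + 2) p δ fun x => γ x a b) :
    MemWeightedSobolev m p (δ - 2) (linearCurvature γ) := by
  have h2 : ∀ e c a b, MemSobolevScale p m m (δ - 2) (weakDeriv [e, c] fun x => γ x a b) := by
    intro e c a b
    obtain ⟨v, hv, hv'⟩ := ((h a b).memSobolevScale hp hn).2 e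
    obtain ⟨w, hw, hw'⟩ := hv'.2 c
    have h1 := hv.cons hw
    have h2 := h1.ae_unique isOpen_univ (ae_eq_refl _) h1.weakDeriv
    refine (hw'.congr_ae (by simpa using h2)).mono ?_ (by linarith)
    push_cast
    linarith
  exact MemSobolevScale.memWeightedSobolev hp (MemSobolevScale.sum _ fun a _ =>
    MemSobolevScale.sum _ fun c _ => (h2 c a a c).sub (h2 c c a a))

theorem hasWeakDeriv_const_pair {Ω : Set (EuclideanSpace ℝ (Fin n))} (hΩ : IsOpen Ω) (c : ℝ)
    (i j : Fin n) : HasWeakDeriv Ω [i, j] (fun _ => c) fun _ => 0 :=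
  (hasWeakDeriv_const hΩ c i).cons hasWeakDeriv_zero

end WeightedSobolev

end

/-! ### Assembly of the decomposition -/

theorem mainTheorem12 (n k : ℕ) (p : ℝ) (hn : 3 ≤ n) (hp : 1 < p)
    (hk : 1 + (n : ℝ) / p < (k : ℝ))
    (g β γ : EuclideanSpace ℝ (Fin n) → Matrix (Fin n) (Fin n) ℝ) (R η : ℝ)
    (hg : IsAsymptoticallyEuclideanPlus k p (2 - (n : ℝ)) g)
    (hR : 0 < R) (hη : η < 2 - (n : ℝ))
    (hβ : ∀ a b, MemSobolevLoc k p {0}ᶜ (fun x => β x a b))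
    (hβ_hom : ∀ t : ℝ, 0 < t → ∀ x, x ≠ 0 → β (t • x) = β x)
    (hγ : ∀ a b, MemWeightedSobolev k p η (fun x => γ x a b))
    (hdecomp : ∀ᵐ x, R < ‖x‖ → g x = 1 + ‖x‖ ^ (2 - (n : ℝ)) • β x + γ x) :
    ∃ (ζ : Metric.sphere (0 : EuclideanSpace ℝ (Fin n)) 1 → ℝ)
      (Rfast : EuclideanSpace ℝ (Fin n) → ℝ),
      MemSobolevSphere (k - 2) p ζ ∧
      (MemWeightedSobolev (k - 2) p (η - 2) Rfast ∨
        MemWeightedSobolevPlus (k - 2) p (2 - 2 * (n : ℝ)) Rfast) ∧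
      (∀ᵐ x, R < ‖x‖ →
        scalarCurvature g x = ‖x‖ ^ (-(n : ℝ)) * sphereExt ζ x + Rfast x) ∧
      ∫ ω, ζ ω ∂(sphereMeasure n) = 0 ∧
      ((∃ c : ℝ, ∀ᵐ x, β x = c • (1 : Matrix (Fin n) (Fin n) ℝ)) →
        ζ =ᵐ[sphereMeasure n] 0) := by
  have hn0 : 0 < n := by omega
  have : NeZero n := ⟨hn0.ne'⟩
  have hn3 : (3 : ℝ) ≤ n := by exact_mod_cast hn
  have hnp : 0 < (n : ℝ) / p := by positivity
  obtain ⟨m, rfl⟩ : ∃ m, k = m + 2 := by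
    have : 1 < k := by exact_mod_cast (show (1 : ℝ) < k by linarith)
    exact ⟨k - 2, by omega⟩
  push_cast at hk
  rw [Nat.add_sub_cancel]
  obtain ⟨hgc, hgpos, hgW⟩ := hg
  obtain ⟨ζ, w, hw, hwζ, hζ, hζ0, hζc⟩ := exists_sphere_curvature hp.le hβ hβ_hom
  have hL := memWeightedSobolev_linearCurvature hp hn0 hγ
  have hQ : ∀ ε : ℝ, 0 < ε → MemWeightedSobolev m p (2 - 2 * (n : ℝ) + ε)
      fun x => scalarCurvature g x - linearCurvature g x := by
    intro ε hε
    -- The bound `1/2` keeps the weight `2 - n + ε'` negative, as `n ≥ 3`. The bound `ε/2` allows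
    -- for the doubling of the weight in the quadratic remainder.
    have h1 : 0 < min (ε / 2) (1 / 2) := lt_min (by linarith) (by norm_num)
    have h2 : min (ε / 2) (1 / 2) ≤ ε / 2 := min_le_left _ _
    have h3 : min (ε / 2) (1 / 2) ≤ 1 / 2 := min_le_right _ _
    exact (memWeightedSobolev_scalarCurvature_sub hp hn0 (by linarith) (by linarith) hgc hgpos
      fun a b => hgW a b _ h1).mono hp hn0 (by linarith)
  refine ⟨ζ, fun x => linearCurvature γ x + (scalarCurvature g x - linearCurvature g x), hζ, ?_,
    ?_, hζ0, hζc⟩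
  · rcases le_or_gt (η - 2) (2 - 2 * (n : ℝ)) with h | h
    · exact Or.inr fun ε hε => (hL.mono hp hn0 (by linarith)).add hp hn0 (hQ ε hε)
    · refine Or.inl (hL.add hp hn0 ?_)
      convert hQ (η - 2 - (2 - 2 * (n : ℝ))) (by linarith) using 1
      ring
  · have hΩ : IsOpen {x : EuclideanSpace ℝ (Fin n) | R < ‖x‖} :=
      isOpen_lt continuous_const continuous_norm
    have hΩ0 : {x : EuclideanSpace ℝ (Fin n) | R < ‖x‖} ⊆ {0}ᶜ := by
      rintro x hx rfl
      have hx' : R < ‖(0 : EuclideanSpace ℝ (Fin n))‖ := hx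
      rw [norm_zero] at hx'
      linarith
    -- The derivatives of `g` and `γ` are global, those of the homogeneous term live on the
    -- punctured space. All restrict to the exterior region, where uniqueness of weak derivatives
    -- allows the decomposition to be differentiated.
    have hg2 : ∀ e c a b, ∀ᵐ x, R < ‖x‖ → weakDeriv [e, c] (fun y => g y a b) x =
        w e c a b x + weakDeriv [e, c] (fun y => γ y a b) x := by
      intro e c a b
      have h1 := ((hgW a b 1 one_pos).hasWeakDeriv_weakDeriv (L := [e, c]) (by simp)).add
        (hasWeakDeriv_const_pair isOpen_univ ((1 : Matrix (Fin n) (Fin n) ℝ) a b) e c)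
      simp only [sub_add_cancel, add_zero] at h1
      have h2 := ((hw e c a b).mono hΩ0).add
        (((hγ a b).hasWeakDeriv_weakDeriv (L := [e, c]) (by simp)).mono (Set.subset_univ _))
      have h3 := h2.add (hasWeakDeriv_const_pair hΩ ((1 : Matrix (Fin n) (Fin n) ℝ) a b) e c)
      refine (ae_restrict_iff' hΩ.measurableSet).1 (HasWeakDeriv.ae_unique hΩ
        ((ae_restrict_iff' hΩ.measurableSet).2 (hdecomp.mono fun x hx hxR => ?_))
        (h1.weakDeriv.mono (Set.subset_univ _)) (by simpa only [add_zero] using h3))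
      simp only [hx hxR, Matrix.add_apply, Matrix.smul_apply, smul_eq_mul]
      ring
    simp only [← ae_all_iff] at hg2
    filter_upwards [hg2, hwζ] with x hx hxζ hxR
    have h4 : linearCurvature g x = ∑ a, ∑ c, (w c a a c x - w c c a a x) +
        linearCurvature γ x := by
      simp only [linearCurvature, hx _ _ _ _ hxR, ← Finset.sum_add_distrib]
      refine Finset.sum_congr rfl fun a _ => Finset.sum_congr rfl fun c _ => ?_
      ring
    rw [← hxζ, h4]
    ring
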